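/- Let $L,H,c>0$, let $d_1\in\mathbb{R}$, let $S=(0,L)\times\mathbb{R}$ with points $\mathbf{x}=(x,z)$, and let $L^2(S)$ be complex valued. Let $$H^1_{\rm p}(S)=\{u\in H^1(S): u(L,z)=u(0,z)\text{ for a.e. } z\in\mathbb{R}\text{ (in the sense of traces)}\},\qquad \|u\|_{H^1_{\rm p}(S)}^2=\|u\|_{L^2(S)}^2+\|\nabla u\|_{L^2(S)}^2 .$$ Let $\hat b=\hat b(\mathbf{x},s)$ be defined for $\mathbf{x}\in S$ and $s\in\mathbb{C}$ with $\Re s>0$, measurable in $\mathbf{x}$ (for example piecewise continuously differentiable), such that 1. for almost every $\mathbf{x}\in S$, $\hat b(\mathbf{x},\cdot)$ is analytic in $\Re s>0$, and for every $\sigma_0>0$ there is $M$ with $|\hat b(\mathbf{x},s)|\le M$ for almost every $\mathbf{x}\in S$ and all $s$ with $\Re s>\sigma_0$; 2. there is $\gamma_0>0$ with $\Re\big(s(\hat b(\mathbf{x},s)-d_1^2)\big)>\gamma_0\,\Re s$ for almost every $\mathbf{x}\in S$ and all $s$ with $\Re s>0$; 3. $\hat b(\mathbf{x},s)=1$ if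 $z<0$ or $z>H$. Let $b(\mathbf{x},\cdot)$ be the causal distribution in time with Laplace transform $\hat b(\mathbf{x},\cdot)$, and let $*$ be convolution in time. For a Hilbert space $X$, an integer $m\ge 0$ and $T>0$ let $$H^m_0((0,T),X)=\{g|_{(0,T)}: g\in H^m(\mathbb{R},X),\ g=0\text{ for } t<0\},\qquad \|g\|_{H^m((0,T),X)}^2=\sum_{j=0}^m\|\partial_t^jg\|^2_{L^2((0,T),X)} .$$ For $F\in L^2((0,T),L^2(S))$ consider the problem $$\Big(\frac{b-d_1^2\delta}{c^2}\Big)*\frac{\partial^2w}{\partial t^2}=\Delta w-\frac{2d_1}{c}\frac{\partial^2w}{\partial t\,\partial x}+F\ \text{ in } S\times(0,T),\qquad w=\frac{\partial w}{\partial t}=0\ \text{ at } t=0,$$ with $w$ and $\partial w/\partial x$ taking equal values on $x=0$ and $x=L$. A weak solution is a function $w\in L^2((0,T),H^1_{\rm p}(S))$, extended by zero to $t\le 0$, such that for all $\xi\in H^1_{\rm p}(S)$ and all $\varphi\in C_c^\infty((-\infty,T))$ $$\frac1{c^2}\int_S\big\langle (b-d_1^2\delta)*w,\varphi''\big\rangle\,\overline{\xi}\,dA+\int_0^T\!\!\int_S\nabla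 w\cdot\nabla\overline{\xi}\,dA\,\varphi\,dt-\frac{2d_1}{c}\int_0^T\!\!\int_S\frac{\partial w}{\partial x}\,\overline{\xi}\,dA\,\varphi'\,dt=\int_0^T\!\!\int_SF\,\overline{\xi}\,dA\,\varphi\,dt ,$$ where $\langle\cdot,\cdot\rangle$ is the distributional pairing in $t$. Theorem. Suppose $F\in H^m_0((0,T),L^2(S))$ for some integer $m\ge 0$ and some $T>0$. Then there exists a unique weak solution $w^s$, and $w^s\in H^m_0((0,T),H^1_{\rm p}(S))$. Moreover, for every $\sigma_0>0$ there is a constant $C$, depending only on $\sigma_0$ and on $\hat b$, $L$, $H$, $c$, $d_1$, such that for all $\sigma>\sigma_0$, all $m$, $T$ and all such $F$, $$\|e^{-\sigma t}w^s\|_{H^m((0,T),H^1_{\rm p}(S))}\le C\,\|e^{-\sigma t}F\|_{H^m((0,T),L^2(S))} .$$ -/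

import Mathlib

open MeasureTheory Set
open scoped ContDiff ComplexConjugate

noncomputable section

namespace Grating

/-! ### Function spaces on the strip -/

/-- The unbounded strip `S = (0, L) × ℝ`; points are pairs `(x, z)`. -/
def strip (L : ℝ) : Set (ℝ × ℝ) := Ioo 0 L ×ˢ univ

/-- The complex Hilbert space `L²(S)`. -/
abbrev L2S (L : ℝ) : Type := Lp ℂ 2 (volume.restrict (strip L))

/-- Smooth compactly supported complex-valued functions. -/
def IsTest {E : Type*} [NormedAddCommGroup E] [NormedSpace ℝ E] (φ : E → ℂ) : Prop :=
  ContDiff ℝ ∞ φ ∧ HasCompactSupport φ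

/-- `∂φ/∂x`. -/
def dx (φ : ℝ × ℝ → ℂ) (p : ℝ × ℝ) : ℂ := fderiv ℝ φ p (1, 0)

/-- `∂φ/∂z`. -/
def dz (φ : ℝ × ℝ → ℂ) (p : ℝ × ℝ) : ℂ := fderiv ℝ φ p (0, 1)

/-- `(ux, uz)` is the weak gradient of `u` in `S`. -/
def IsWeakGrad (L : ℝ) (u ux uz : L2S L) : Prop :=
  ∀ φ : ℝ × ℝ → ℂ, IsTest φ → tsupport φ ⊆ strip L →
    (∫ p in strip L, u p * dx φ p) = -∫ p in strip L, ux p * φ p ∧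
    (∫ p in strip L, u p * dz φ p) = -∫ p in strip L, uz p * φ p

/-- Equality of the traces of `u ∈ H¹(S)` on `x = 0` and `x = L`, where `ux` is the weak
`x`-derivative of `u`. By Green's formula
`∫_S (u ∂ₓφ + ∂ₓu φ) dA = ∫_ℝ (u(L,z) φ(L,z) - u(0,z) φ(0,z)) dz`,
so that, over all test functions on the plane that satisfy `φ(0,z) = φ(L,z)`, the left-hand side
vanishes exactly when `u(L,z) = u(0,z)` for almost every `z`. -/
def HasPeriodicTrace (L : ℝ) (u ux : L2S L) : Prop :=
  ∀ φ : ℝ × ℝ → ℂ, IsTest φ → (∀ z : ℝ, φ (0, z) = φ (L, z)) →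
    (∫ p in strip L, u p * dx φ p) = -∫ p in strip L, ux p * φ p

lemma exists_functional (L : ℝ) {a : ℝ × ℝ → ℂ} (ha : Continuous a) (hc : HasCompactSupport a) :
    ∃ l : L2S L →L[ℂ] ℂ, ∀ f : L2S L, (∫ p in strip L, f p * a p) = l f := by
  have hm : MemLp (fun p => conj (a p)) 2 (volume.restrict (strip L)) :=
    (Complex.continuous_conj.comp ha).memLp_of_hasCompactSupport
      (hc.comp_left (g := fun w : ℂ => conj w) (by simp))
  refine ⟨innerSL ℂ (hm.toLp _), fun f => ?_⟩
  rw [innerSL_apply_apply, L2.inner_def]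
  refine integral_congr_ae ?_
  filter_upwards [hm.coeFn_toLp] with p hp
  rw [hp]
  simp

lemma IsTest.continuous_dir {φ : ℝ × ℝ → ℂ} (h : IsTest φ) (v : ℝ × ℝ) :
    Continuous (fun p => fderiv ℝ φ p v) :=
  (h.1.continuous_fderiv (by simp)).clm_apply continuous_const

lemma IsTest.compact_dir {φ : ℝ × ℝ → ℂ} (h : IsTest φ) (v : ℝ × ℝ) :
    HasCompactSupport (fun p => fderiv ℝ φ p v) :=
  (h.2.fderiv (𝕜 := ℝ)).comp_left (g := fun l : ℝ × ℝ →L[ℝ] ℂ => l v) (by simp)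

lemma exists_pair (L : ℝ) {φ : ℝ × ℝ → ℂ} (h : IsTest φ) (v : ℝ × ℝ) :
    ∃ l k : L2S L →L[ℂ] ℂ,
      (∀ f : L2S L, (∫ p in strip L, f p * fderiv ℝ φ p v) = l f) ∧
      (∀ f : L2S L, (∫ p in strip L, f p * φ p) = k f) := by
  obtain ⟨l, hl⟩ := exists_functional L (h.continuous_dir v) (h.compact_dir v)
  obtain ⟨k, hk⟩ := exists_functional L h.1.continuous h.2
  exact ⟨l, k, hl, hk⟩

/-- The Hilbert space `H¹ₚ(S)` of functions in `H¹(S)` with `u(L,z) = u(0,z)`. An element is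
recorded as the triple `(u, ∂ₓu, ∂_z u)`, the last two entries being determined by `u`, and the norm
is the `H¹` norm: `‖u‖² + ‖∂ₓu‖² + ‖∂_z u‖²` is its square. -/
def H1p (L : ℝ) : Submodule ℂ (PiLp 2 (fun _ : Fin 3 => L2S L)) where
  carrier := {U | IsWeakGrad L (U 0) (U 1) (U 2) ∧ HasPeriodicTrace L (U 0) (U 1)}
  zero_mem' := by
    refine ⟨fun φ h _ => ?_, fun φ h _ => ?_⟩
    · obtain ⟨l, k, hl, hk⟩ := exists_pair L h (1, 0)
      obtain ⟨l', k', hl', hk'⟩ := exists_pair L h (0, 1)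
      simp only [dx, dz, hl, hk, hl']
      simp
    · obtain ⟨l, k, hl, hk⟩ := exists_pair L h (1, 0)
      simp only [dx, hl, hk]
      simp
  add_mem' := by
    rintro U V ⟨hU, hU'⟩ ⟨hV, hV'⟩
    refine ⟨fun φ h hs => ?_, fun φ h hs => ?_⟩
    · obtain ⟨l, k, hl, hk⟩ := exists_pair L h (1, 0)
      obtain ⟨l', k', hl', hk'⟩ := exists_pair L h (0, 1)
      have h1 := hU φ h hs
      have h2 := hV φ h hs
      simp only [dx, dz, hl, hk, hl'] at h1 h2 ⊢
      simp only [PiLp.add_apply, map_add, h1, h2]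
      constructor <;> ring
    · obtain ⟨l, k, hl, hk⟩ := exists_pair L h (1, 0)
      have h1 := hU' φ h hs
      have h2 := hV' φ h hs
      simp only [dx, hl, hk] at h1 h2 ⊢
      simp only [PiLp.add_apply, map_add, h1, h2]
      ring
  smul_mem' := by
    rintro a U ⟨hU, hU'⟩
    refine ⟨fun φ h hs => ?_, fun φ h hs => ?_⟩
    · obtain ⟨l, k, hl, hk⟩ := exists_pair L h (1, 0)
      obtain ⟨l', k', hl', hk'⟩ := exists_pair L h (0, 1)
      have h1 := hU φ h hs
      simp only [dx, dz, hl, hk, hl'] at h1 ⊢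
      simp only [PiLp.smul_apply, map_smul, h1, smul_eq_mul]
      constructor <;> ring
    · obtain ⟨l, k, hl, hk⟩ := exists_pair L h (1, 0)
      have h1 := hU' φ h hs
      simp only [dx, hl, hk] at h1 ⊢
      simp only [PiLp.smul_apply, map_smul, h1, smul_eq_mul]
      ring

lemma isClosed_H1p (L : ℝ) : IsClosed (H1p L : Set (PiLp 2 (fun _ : Fin 3 => L2S L))) := by
  have hc : ∀ i : Fin 3, Continuous (fun U : PiLp 2 (fun _ : Fin 3 => L2S L) => U i) :=
    fun i => PiLp.continuous_apply 2 _ i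
  have hset : (H1p L : Set (PiLp 2 (fun _ : Fin 3 => L2S L))) =
      {U | IsWeakGrad L (U 0) (U 1) (U 2) ∧ HasPeriodicTrace L (U 0) (U 1)} := rfl
  rw [hset, ofPred_and]
  refine IsClosed.inter ?_ ?_
  · simp only [IsWeakGrad, ofPred_forall]
    refine isClosed_iInter fun φ => isClosed_iInter fun h => isClosed_iInter fun _ => ?_
    obtain ⟨l, k, hl, hk⟩ := exists_pair L h (1, 0)
    obtain ⟨l', k', hl', hk'⟩ := exists_pair L h (0, 1)
    simp only [dx, dz, hl, hk, hl', ofPred_and]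
    exact (isClosed_eq (l.continuous.comp (hc 0)) (k.continuous.comp (hc 1)).neg).inter
      (isClosed_eq (l'.continuous.comp (hc 0)) (k.continuous.comp (hc 2)).neg)
  · simp only [HasPeriodicTrace, ofPred_forall]
    refine isClosed_iInter fun φ => isClosed_iInter fun h => isClosed_iInter fun _ => ?_
    obtain ⟨l, k, hl, hk⟩ := exists_pair L h (1, 0)
    simp only [dx, hl, hk]
    exact isClosed_eq (l.continuous.comp (hc 0)) (k.continuous.comp (hc 1)).neg

/-- `H¹ₚ(S)` is complete, as Bochner integration requires. -/
instance instCompleteSpaceH1p (L : ℝ) : CompleteSpace (H1p L) :=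
  (isClosed_H1p L).completeSpace_coe

/-- The function `u` underlying an element of `H¹ₚ(S)`. -/
def H1p.fn {L : ℝ} (u : H1p L) : L2S L := u.1 0

/-- The weak derivative `∂ₓu`. -/
def H1p.gx {L : ℝ} (u : H1p L) : L2S L := u.1 1

/-- The weak derivative `∂_z u`. -/
def H1p.gz {L : ℝ} (u : H1p L) : L2S L := u.1 2

/-! ### Sobolev spaces in time, with values in a Banach space -/

/-- The Bochner space `L²(I, X)`. -/
abbrev L2t (I : Set ℝ) (X : Type*) [NormedAddCommGroup X] : Type _ :=
  Lp X 2 (volume.restrict I)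

section Time

variable {X : Type*} [NormedAddCommGroup X] [NormedSpace ℂ X]

/-- `h` is the `j`-th weak derivative of `g` on the open set `I`. -/
def IsWeakDeriv (I : Set ℝ) (j : ℕ) (g h : ℝ → X) : Prop :=
  ∀ φ : ℝ → ℂ, IsTest φ → tsupport φ ⊆ I →
    (∫ t in I, iteratedDeriv j φ t • g t) = (-1 : ℂ) ^ j • ∫ t in I, φ t • h t

/-- `g ∈ Hᵐ(I, X)`: `g` is in `L²(I, X)` with its weak derivatives up to order `m`. -/
def MemH (m : ℕ) (I : Set ℝ) (g : ℝ → X) : Prop :=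
  MemLp g 2 (volume.restrict I) ∧ ∀ j ≤ m, ∃ h : L2t I X, IsWeakDeriv I j g h

/-- The norm `(∑_{j ≤ m} ‖∂ₜʲ g‖²_{L²(I, X)})^{1/2}` of `Hᵐ(I, X)`, with values in `[0, ∞]`; it is
`∞` if a weak derivative does not exist in `L²(I, X)`. (The infimum is over the weak derivatives,
of which there is at most one.) -/
def normH (m : ℕ) (I : Set ℝ) (g : ℝ → X) : ENNReal :=
  (∑ j ∈ Finset.range (m + 1), (⨅ (h : L2t I X) (_ : IsWeakDeriv I j g h), ‖h‖ₑ) ^ 2)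
    ^ (1 / 2 : ℝ)

/-- `g ∈ H₀ᵐ((0,T), X)`: `g` is the restriction to `(0,T)` of a function in `Hᵐ(ℝ, X)` that
vanishes for `t < 0`. -/
def MemH0 (m : ℕ) (T : ℝ) (g : L2t (Ioo 0 T) X) : Prop :=
  ∃ G : ℝ → X, MemH m univ G ∧ (∀ᵐ t : ℝ, t < 0 → G t = 0) ∧
    G =ᵐ[volume.restrict (Ioo 0 T)] g

end Time

/-! ### The coefficient -/

/-- The assumption on the Laplace transform `b̂(x, s)` of the coefficient `b`: measurability in
space, analyticity in `s` and boundedness in every half plane `Re s > σ₀ > 0`, positivity of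
`s (b̂ - d₁²)`, and `b̂ = 1` outside the grating. -/
structure CoeffAssumption (L H d₁ : ℝ) (bhat : ℝ × ℝ → ℂ → ℂ) : Prop where
  measurable : ∀ s : ℂ, 0 < s.re →
    AEStronglyMeasurable (fun x => bhat x s) (volume.restrict (strip L))
  analytic : ∀ᵐ x ∂(volume.restrict (strip L)), AnalyticOnNhd ℂ (bhat x) {s | 0 < s.re}
  bounded : ∀ σ₀ : ℝ, 0 < σ₀ → ∃ M : ℝ, ∀ᵐ x ∂(volume.restrict (strip L)),
    ∀ s : ℂ, σ₀ < s.re → ‖bhat x s‖ ≤ M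
  positive : ∃ γ₀ : ℝ, 0 < γ₀ ∧ ∀ᵐ x ∂(volume.restrict (strip L)),
    ∀ s : ℂ, 0 < s.re → s.re * γ₀ < (s * (bhat x s - (d₁ : ℂ) ^ 2)).re
  outside : ∀ᵐ x ∂(volume.restrict (strip L)), x.2 < 0 ∨ H < x.2 →
    ∀ s : ℂ, 0 < s.re → bhat x s = 1

/-- The time-domain coefficient `b(x, ·)` is the causal distribution in time whose Laplace transform
is `b̂(x, ·)`. By the inversion formula
`⟨b(x,·), φ⟩ = (2π)⁻¹ ∫_ℝ b̂(x, s) (∫_ℝ e^{sτ} φ(τ) dτ) dη`, `s = 1 + iη`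
(any other abscissa `Re s > 0` gives the same distribution).
This is `∫_S ⟨b(x,·), ψ(·)(x)⟩ conj ξ(x) dA`, for a test function `ψ` with values in `L²(S)` and
`ξ ∈ L²(S)`. -/
def coeffPairing (L : ℝ) (bhat : ℝ × ℝ → ℂ → ℂ) (ψ : ℝ → L2S L) (ξ : L2S L) : ℂ :=
  (2 * (Real.pi : ℂ))⁻¹ * ∫ η : ℝ, ∫ x in strip L,
    bhat x (1 + η * Complex.I)
      * (∫ τ : ℝ, Complex.exp ((1 + η * Complex.I) * τ) • ψ τ : L2S L) x * conj (ξ x)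

/-- The time convolution `b * w` of the distribution `b` with `w`, where `w` lives on `(0,T)` and is
extended by zero, applied to the test function `φ(t) ξ(x)`:
`∫_S ⟨b(x,·) * w(·)(x), φ⟩ conj ξ(x) dA`, where `⟨b * w, φ⟩ = ⟨b, τ ↦ ∫ w(t) φ(t + τ) dt⟩`.
For `φ` supported in `(-∞, T)` only the values of `w` on `(0,T)` matter because `b` is causal. -/
def convPairing (L T : ℝ) (bhat : ℝ × ℝ → ℂ → ℂ) (w : ℝ → L2S L) (φ : ℝ → ℂ) (ξ : L2S L) : ℂ :=
  coeffPairing L bhat (fun τ => ∫ t in Ioo 0 T, φ (t + τ) • w t) ξ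

/-! ### The time-domain problem -/

/-- `w ∈ L²((0,T), H¹ₚ(S))` is a weak solution on `(0,T)` of
`c⁻² (b - d₁² δ) * ∂ₜ² w = Δ w - 2 (d₁ / c) ∂ₜ ∂ₓ w + F` in `S`, with `w = ∂ₜ w = 0` at `t = 0`,
and `w`, `∂ₓ w` periodic in `x`. The equation is tested with `φ(t) conj ξ(x)`, `ξ ∈ H¹ₚ(S)` and `φ`
smooth and compactly supported in `(-∞, T)`. As `φ` need not vanish at `t = 0`, the initial
conditions are part of this; as `ξ` is periodic, so is the periodicity of `∂ₓ w`.
Note that `inner ℂ ξ v = ∫_S v conj ξ dA`. -/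
def IsWeakSolution (L c d₁ T : ℝ) (bhat : ℝ × ℝ → ℂ → ℂ)
    (F : L2t (Ioo 0 T) (L2S L)) (w : L2t (Ioo 0 T) (H1p L)) : Prop :=
  ∀ (φ : ℝ → ℂ) (ξ : H1p L), IsTest φ → tsupport φ ⊆ Iio T →
    ((c : ℂ) ^ 2)⁻¹ *
        (convPairing L T bhat (fun t => H1p.fn (w t)) (iteratedDeriv 2 φ) (H1p.fn ξ)
          - (d₁ : ℂ) ^ 2 * ∫ t in Ioo 0 T, iteratedDeriv 2 φ t * inner ℂ (H1p.fn ξ) (H1p.fn (w t)))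
      + (∫ t in Ioo 0 T, φ t * (inner ℂ (H1p.gx ξ) (H1p.gx (w t)) + inner ℂ (H1p.gz ξ) (H1p.gz (w t))))
      - 2 * ((d₁ : ℂ) / c) * (∫ t in Ioo 0 T, deriv φ t * inner ℂ (H1p.fn ξ) (H1p.gx (w t)))
      = ∫ t in Ioo 0 T, φ t * inner ℂ (H1p.fn ξ) (F t)

end Grating

end

/-! The Laplace transform in time turns the equation into `A(s) ŵ(s) = ι* F̂(s)` on `H1p`, where `ι`
is the embedding into `L²(S)` and `A(s)` is `opA`, the operator of a sesquilinear form that is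
analytic in `Re s > 0`. Multiplying the form by `conj s` makes it coercive. The coefficient term
becomes `|s|² c⁻² s (b̂ - d₁²)`, whose real part is controlled by the positivity assumption. The
gradient term becomes `conj s ‖∇u‖²`. The mixed term becomes a real multiple of `(∂ₓu, u)`, which is
purely imaginary because `∂ₓ` is antisymmetric on periodic functions
(`inner_add_inner_of_periodic`). Hence `A(s)` is invertible, and the factor `|s|` lost on the
right-hand side is absorbed by the term `|s|² ‖u‖²` on the left. So `resolv` is bounded from `L²(S)`
to `H1p` uniformly on `Re s > σ₀` (`exists_resolv_le`).

The rest concerns operator-valued multipliers `Φ` that are analytic and bounded on such half planes.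
Plancherel on `Re s = σ` gives the weighted `L²` estimate with the bound of `Φ` as constant
(`exists_isSol_line`). Cauchy's theorem makes the solution independent of `σ`, and moving the
contour to infinity gives causality: the solution before time `a` depends on the source before `a`
only (`IsSol.ae_eq`). Multipliers commute with time derivatives, also after conjugation with
`e^{-σt}`, so every derivative satisfies the same estimate. Causality allows the source to be
changed after `T`, so the estimates localise to `(0,T)`.

By Parseval, being a weak solution means that the frequency residual pairs to zero with all test
functions supported before `T` (`isWeakSolution_iff`). For existence, truncating the multiplier
solution at `T` creates a residual carried by times after `T`, which these test functions do not
see.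

For uniqueness, let `w` be the difference of two solutions. Then `A(s) ŵ(s)` grows polynomially and
is invisible before `T`. A Paley–Wiener argument shows that, once multiplied by the transform of a
mollifier, it is `O(e^{-T Re s})` (`exists_norm_lap_smul_le`). Inverting `A(s)` costs one factor
`|s|`, so the mollified `w` is invisible before `T`. Removing the mollifier gives `w = 0` there. -/

noncomputable section

namespace Grating

open Filter Topology FourierTransform SchwartzMap

/-! ### The two-sided Laplace transform -/

section Laplace

variable {E : Type*} [NormedAddCommGroup E] [NormedSpace ℂ E]

/-- The two-sided Laplace transform `∫ e^{-st} g(t) dt`. -/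
def lap (s : ℂ) (g : ℝ → E) : E := ∫ t : ℝ, Complex.exp (-(s * t)) • g t

/-- The point of the vertical line `Re s = σ` with frequency `ξ`. -/
def vline (σ ξ : ℝ) : ℂ := σ + 2 * Real.pi * ξ * Complex.I

@[simp] lemma vline_re (σ ξ : ℝ) : (vline σ ξ).re = σ := by simp [vline]

lemma continuous_vline (σ : ℝ) : Continuous (vline σ) := by unfold vline; fun_prop

lemma norm_exp_neg_mul (s : ℂ) (t : ℝ) : ‖Complex.exp (-(s * t))‖ = Real.exp (-s.re * t) := by
  rw [Complex.norm_exp]; simp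

/-- `e^{-σt} g(t)` is integrable. -/
def WInt (σ : ℝ) (g : ℝ → E) : Prop := Integrable fun t : ℝ => (Real.exp (-σ * t) : ℂ) • g t

lemma exp_split (s : ℂ) (t : ℝ) : Complex.exp (-(s * t))
    = Complex.exp (-(s.im * t * Complex.I)) * (Real.exp (-s.re * t) : ℂ) := by
  rw [Complex.ofReal_exp, ← Complex.exp_add]
  congr 1
  conv_lhs => rw [← Complex.re_add_im s]
  push_cast; ring

lemma WInt.integrable {g : ℝ → E} {s : ℂ} (h : WInt s.re g) :
    Integrable fun t : ℝ => Complex.exp (-(s * t)) • g t := by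
  have hc : Continuous fun t : ℝ => Complex.exp (-(s.im * t * Complex.I)) := by fun_prop
  have h2 := Integrable.bdd_smul h 1 (φ := fun t : ℝ => Complex.exp (-(s.im * t * Complex.I)))
    hc.aestronglyMeasurable (ae_of_all _ fun t => by rw [Complex.norm_exp]; simp)
  refine h2.congr (ae_of_all _ fun t => ?_)
  simp only [exp_split s t, mul_smul, Pi.smul_apply']

lemma WInt.norm_integrable {g : ℝ → E} {σ : ℝ} (h : WInt σ g) :
    Integrable fun t : ℝ => Real.exp (-σ * t) * ‖g t‖ := by
  refine h.norm.congr (ae_of_all _ fun t => ?_)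
  simp [norm_smul, Complex.norm_exp]

lemma norm_lap_le {g : ℝ → E} (s : ℂ) : ‖lap s g‖ ≤ ∫ t : ℝ, Real.exp (-s.re * t) * ‖g t‖ := by
  refine (norm_integral_le_integral_norm _).trans (le_of_eq ?_)
  simp only [norm_smul, norm_exp_neg_mul]

lemma lap_congr {g h : ℝ → E} {s : ℂ} (hgh : g =ᵐ[volume] h) : lap s g = lap s h := by
  refine integral_congr_ae ?_
  filter_upwards [hgh] with t ht
  rw [ht]

lemma lap_clm [CompleteSpace E] {E' : Type*} [NormedAddCommGroup E'] [NormedSpace ℂ E']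
    [CompleteSpace E'] (A : E →L[ℂ] E')
    {g : ℝ → E} {s : ℂ} (hg : WInt s.re g) : lap s (fun t => A (g t)) = A (lap s g) := by
  simp only [lap]
  rw [← A.integral_comp_comm hg.integrable]
  simp

/-- The factor `2π` in `vline` matches the normalisation `e^{-2πitξ}` of `𝓕`, so Plancherel applies
on vertical lines without extra constants. -/
lemma lap_vline (σ ξ : ℝ) (g : ℝ → E) :
    lap (vline σ ξ) g = 𝓕 (fun t : ℝ => (Real.exp (-σ * t) : ℂ) • g t) ξ := by
  rw [Real.fourier_real_eq_integral_exp_smul]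
  refine integral_congr_ae (ae_of_all _ fun t => ?_)
  simp only [smul_smul]
  congr 1
  rw [Complex.ofReal_exp, ← Complex.exp_add]
  congr 1
  unfold vline; push_cast; ring

lemma lap_neg_vline (σ ξ : ℝ) (g : ℝ → E) :
    lap (-vline σ ξ) g = 𝓕⁻ (fun t : ℝ => (Real.exp (σ * t) : ℂ) • g t) ξ := by
  rw [Real.fourierInv_eq']
  refine integral_congr_ae (ae_of_all _ fun t => ?_)
  simp only [smul_smul]
  congr 1
  rw [Complex.ofReal_exp, ← Complex.exp_add]
  congr 1
  simp [vline]; ring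

/-! ### Test functions in time -/

lemma IsTest.deriv {θ : ℝ → ℂ} (h : IsTest θ) : IsTest (deriv θ) :=
  ⟨by
    have := (contDiff_infty_iff_deriv (𝕜 := ℝ) (f := θ)).1 h.1
    exact this.2, h.2.deriv⟩

lemma IsTest.iteratedDeriv {θ : ℝ → ℂ} (h : IsTest θ) (n : ℕ) : IsTest (iteratedDeriv n θ) := by
  induction n with
  | zero => simpa using h
  | succ n ih => rw [iteratedDeriv_succ]; exact ih.deriv

lemma IsTest.smooth_mul {θ a : ℝ → ℂ} (h : IsTest θ) (ha : ContDiff ℝ ∞ a) :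
    IsTest (fun t => a t * θ t) :=
  ⟨ha.mul h.1, h.2.mul_left⟩

lemma contDiff_exp_mul (z : ℂ) : ContDiff ℝ ∞ (fun t : ℝ => Complex.exp (z * t)) := by
  have : ContDiff ℝ ∞ (fun t : ℝ => (t : ℂ)) := Complex.ofRealCLM.contDiff
  exact (contDiff_const.mul this).cexp

lemma contDiff_rexp_mul (σ : ℝ) : ContDiff ℝ ∞ (fun t : ℝ => (Real.exp (σ * t) : ℂ)) := by
  simpa using contDiff_exp_mul (σ : ℂ)

lemma wInt_of_compact {g : ℝ → ℂ} (hg : Continuous g) (hc : HasCompactSupport g) (σ : ℝ) :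
    WInt σ g := by
  refine Continuous.integrable_of_hasCompactSupport (by fun_prop) ?_
  exact hc.mul_left

lemma IsTest.wInt {θ : ℝ → ℂ} (h : IsTest θ) (σ : ℝ) : WInt σ θ :=
  wInt_of_compact h.1.continuous h.2 σ

lemma IsTest.integrable {θ : ℝ → ℂ} (h : IsTest θ) : Integrable θ :=
  h.1.continuous.integrable_of_hasCompactSupport h.2

lemma lap_deriv {θ : ℝ → ℂ} (h : IsTest θ) (z : ℂ) : lap z (deriv θ) = z * lap z θ := by
  have h1 := integral_mul_deriv_eq_deriv_mul_of_integrable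
    (u := fun t : ℝ => Complex.exp (-(z * t))) (v := θ)
    (u' := fun t : ℝ => -z * Complex.exp (-(z * t))) (v' := _root_.deriv θ)
    (fun t _ => by
      have : HasDerivAt (fun t : ℝ => -(z * (t : ℂ))) (-(z * 1)) t :=
        ((Complex.ofRealCLM.hasDerivAt (x := t)).const_mul z).neg
      have h2 := this.cexp
      rwa [show Complex.exp (-(z * t)) * -(z * 1) = -z * Complex.exp (-(z * t)) by ring] at h2)
    (fun t _ => (h.1.differentiable (by simp) t).hasDerivAt)
    (h.deriv.wInt z.re).integrable
    (by
      have := (h.wInt z.re).integrable.const_mul (-z)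
      refine this.congr (ae_of_all _ fun t => ?_)
      simp [mul_assoc])
    (h.wInt z.re).integrable
  simp only [lap, smul_eq_mul]
  rw [h1, ← integral_const_mul, ← integral_neg]
  congr 1; ext t; ring

lemma lap_iteratedDeriv {θ : ℝ → ℂ} (h : IsTest θ) (z : ℂ) (n : ℕ) :
    lap z (iteratedDeriv n θ) = z ^ n * lap z θ := by
  induction n with
  | zero => simp
  | succ n ih => rw [iteratedDeriv_succ, lap_deriv (h.iteratedDeriv n), ih]; ring

lemma tsupport_deriv_subset' (θ : ℝ → ℂ) : tsupport (deriv θ) ⊆ tsupport θ :=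
  closure_minimal (support_deriv_subset) (isClosed_tsupport θ)

lemma tsupport_iteratedDeriv_subset' (θ : ℝ → ℂ) (n : ℕ) :
    tsupport (iteratedDeriv n θ) ⊆ tsupport θ := by
  induction n with
  | zero => simp
  | succ n ih => rw [iteratedDeriv_succ]; exact (tsupport_deriv_subset' _).trans ih

/-- On the support `t ≤ a`, hence `|e^{st}| ≤ e^{a Re s}`. Only the right end of the support
matters, which is how causality enters the frequency domain. -/
lemma norm_lap_test_le {θ : ℝ → ℂ} (h : IsTest θ) {a : ℝ} (ha : tsupport θ ⊆ Iic a) {s : ℂ}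
    (hs : 0 ≤ s.re) : ‖lap (-s) θ‖ ≤ Real.exp (a * s.re) * ∫ t, ‖θ t‖ := by
  refine (norm_lap_le _).trans ?_
  rw [← integral_const_mul]
  refine integral_mono_of_nonneg (ae_of_all _ fun t => by positivity)
    (h.integrable.norm.const_mul _) (ae_of_all _ fun t => ?_)
  by_cases ht : θ t = 0
  · simp [ht]
  · have : t ≤ a := ha (subset_tsupport _ ht)
    refine mul_le_mul_of_nonneg_right (Real.exp_le_exp.2 ?_) (norm_nonneg _)
    simp only [Complex.neg_re, neg_neg]
    rw [mul_comm]
    exact mul_le_mul_of_nonneg_right this hs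

/-- Rapid decay of the transform of a test function in right half planes. -/
lemma exists_norm_lap_test_le {θ : ℝ → ℂ} (h : IsTest θ) {a : ℝ} (ha : tsupport θ ⊆ Iic a)
    (n : ℕ) : ∃ C : ℝ, 0 ≤ C ∧ ∀ s : ℂ, 0 ≤ s.re →
      ‖lap (-s) θ‖ * ‖s‖ ^ n ≤ C * Real.exp (a * s.re) := by
  -- Each derivative of `θ` produces a factor `-s`, so the constant is the `L¹` norm of the `n`-th
  -- derivative.
  refine ⟨∫ t, ‖iteratedDeriv n θ t‖, integral_nonneg fun _ => norm_nonneg _, fun s hs => ?_⟩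
  have h1 := norm_lap_test_le (h.iteratedDeriv n)
    ((tsupport_iteratedDeriv_subset' θ n).trans ha) hs
  rw [lap_iteratedDeriv h, norm_mul, norm_pow, norm_neg] at h1
  linarith

lemma IsTest.exists_tsupport_subset {θ : ℝ → ℂ} (h : IsTest θ) {T : ℝ} (hT : tsupport θ ⊆ Iio T) :
    ∃ a < T, tsupport θ ⊆ Iic a := by
  rcases (tsupport θ).eq_empty_or_nonempty with he | hne
  · exact ⟨T - 1, by linarith, by simp [he]⟩
  · obtain ⟨a, ha, hmax⟩ := h.2.isCompact.exists_isGreatest hne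
    exact ⟨a, hT ha, fun x hx => hmax hx⟩

lemma IsTest.exists_tsupport_le {θ : ℝ → ℂ} (h : IsTest θ) : ∃ a, tsupport θ ⊆ Iic a := by
  obtain ⟨a, ha⟩ := h.2.isCompact.bddAbove
  exact ⟨a, fun x hx => ha hx⟩

end Laplace

section Contour

variable {E : Type*} [NormedAddCommGroup E] [NormedSpace ℂ E]

/-- The right half plane. -/
abbrev halfPlane : Set ℂ := {s | 0 < s.re}

lemma isOpen_halfPlane : IsOpen halfPlane := isOpen_lt continuous_const Complex.continuous_re

/-! ### Integrals along vertical lines -/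

/-- Turns decay like `|s|⁻²` on a vertical line into an integrable majorant. The maximum covers
small `σ`: it is a `K` with `1 + y² ≤ K (σ² + y²)`. -/
lemma le_inv_one_add_sq {σ y C a : ℝ} (hσ : 0 < σ) (ha : 0 ≤ a)
    (h : a * ‖(σ + y * Complex.I : ℂ)‖ ^ 2 ≤ C) :
    a ≤ C * max 1 (σ ^ 2)⁻¹ * (1 + y ^ 2)⁻¹ := by
  have h1 : ‖(σ + y * Complex.I : ℂ)‖ ^ 2 = σ ^ 2 + y ^ 2 := by
    rw [← Complex.normSq_eq_norm_sq, Complex.normSq_add_mul_I]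
  rw [h1] at h
  set K := max 1 (σ ^ 2)⁻¹ with hK
  have hK1 : 1 ≤ K := le_max_left _ _
  have hK2 : (σ ^ 2)⁻¹ ≤ K := le_max_right _ _
  have h3 : 1 ≤ K * σ ^ 2 := by
    rw [← inv_mul_cancel₀ (pow_pos hσ 2).ne']
    gcongr
  have h2 : 1 + y ^ 2 ≤ K * (σ ^ 2 + y ^ 2) := by nlinarith [sq_nonneg y]
  rw [← div_eq_mul_inv, le_div_iff₀ (by positivity)]
  calc a * (1 + y ^ 2) ≤ a * (K * (σ ^ 2 + y ^ 2)) := by gcongr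
    _ = (a * (σ ^ 2 + y ^ 2)) * K := by ring
    _ ≤ C * K := by gcongr

lemma integrable_line {F : Type*} [NormedAddCommGroup F] {h : ℂ → F}
    (hd : ContinuousOn h halfPlane) {σ C : ℝ} (hσ : 0 < σ)
    (hb : ∀ s : ℂ, s.re = σ → ‖h s‖ * ‖s‖ ^ 2 ≤ C) :
    Integrable fun y : ℝ => h (σ + y * Complex.I) := by
  have hcont : Continuous fun y : ℝ => h (σ + y * Complex.I) :=
    hd.comp_continuous (by fun_prop) (fun y => by simpa [halfPlane] using hσ)
  refine Integrable.mono' (integrable_inv_one_add_sq.const_mul (C * max 1 (σ ^ 2)⁻¹))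
    hcont.aestronglyMeasurable (ae_of_all _ fun y => ?_)
  exact le_inv_one_add_sq hσ (norm_nonneg _) (hb _ (by simp))

lemma vline_eq (σ ξ : ℝ) : vline σ ξ = σ + ((2 * Real.pi * ξ : ℝ) : ℂ) * Complex.I := by
  simp [vline]

lemma integral_vline_eq (h : ℂ → E) (σ : ℝ) : ∫ ξ : ℝ, h (vline σ ξ)
    = (2 * Real.pi)⁻¹ • ∫ y : ℝ, h (σ + y * Complex.I) := by
  simp only [vline_eq]
  have := Measure.integral_comp_mul_left (fun y : ℝ => h (σ + y * Complex.I)) (2 * Real.pi)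
  rw [this, abs_of_pos (by positivity)]

lemma integrable_vline {F : Type*} [NormedAddCommGroup F] {h : ℂ → F}
    (hd : ContinuousOn h halfPlane) {σ C : ℝ} (hσ : 0 < σ)
    (hb : ∀ s : ℂ, s.re = σ → ‖h s‖ * ‖s‖ ^ 2 ≤ C) :
    Integrable fun ξ : ℝ => h (vline σ ξ) := by
  simp only [vline_eq]
  exact (integrable_line hd hσ hb).comp_mul_left' (by positivity)

/-- Shift of the path of integration. -/
lemma integral_vline_shift {h : ℂ → E} (hd : DifferentiableOn ℂ h halfPlane) {σ₁ σ₂ C : ℝ}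
    (h1 : 0 < σ₁) (h12 : σ₁ ≤ σ₂)
    (hb : ∀ s : ℂ, σ₁ ≤ s.re → s.re ≤ σ₂ → ‖h s‖ * ‖s‖ ^ 2 ≤ C) :
    ∫ ξ : ℝ, h (vline σ₁ ξ) = ∫ ξ : ℝ, h (vline σ₂ ξ) := by
  -- Without completeness both Bochner integrals are zero by convention.
  by_cases hE : CompleteSpace E
  swap
  · simp [integral, hE]
  rw [integral_vline_eq, integral_vline_eq]
  congr 1
  have i1 := integrable_line hd.continuousOn h1 (C := C) fun s hs => hb s hs.ge (hs.le.trans h12)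
  have i2 := integrable_line hd.continuousOn (h1.trans_le h12) (C := C)
    fun s hs => hb s (h12.trans hs.ge) hs.le
  have t1 := intervalIntegral_tendsto_integral i1 (tendsto_neg_atTop_atBot (G := ℝ)) tendsto_id
  have t2 := intervalIntegral_tendsto_integral i2 (tendsto_neg_atTop_atBot (G := ℝ)) tendsto_id
  -- The horizontal sides of the rectangle at heights `±R` contribute `O(R⁻²)`; `e = ±1` selects the
  -- side.
  have hor : ∀ e : ℝ, |e| = 1 →
      Tendsto (fun R : ℝ => ∫ x : ℝ in σ₁..σ₂, h (x + (e * R : ℝ) * Complex.I)) atTop (𝓝 0) := by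
    intro e he
    rw [tendsto_zero_iff_norm_tendsto_zero]
    have hlim : Tendsto (fun R : ℝ => C * (R ^ 2)⁻¹ * |σ₂ - σ₁|) atTop (𝓝 0) := by
      have h0 : Tendsto (fun R : ℝ => (R ^ 2)⁻¹) atTop (𝓝 0) :=
        (tendsto_pow_atTop (by norm_num : (2 : ℕ) ≠ 0)).inv_tendsto_atTop
      simpa using (h0.const_mul C).mul_const |σ₂ - σ₁|
    refine squeeze_zero' (Eventually.of_forall fun R => norm_nonneg _) ?_ hlim
    filter_upwards [eventually_gt_atTop 0] with R hR
    refine intervalIntegral.norm_integral_le_of_norm_le_const fun x hx => ?_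
    rw [uIoc_of_le h12] at hx
    have hn := hb (x + (e * R : ℝ) * Complex.I) (by simpa using hx.1.le) (by simpa using hx.2)
    have hs : R ^ 2 ≤ ‖(x + (e * R : ℝ) * Complex.I : ℂ)‖ ^ 2 := by
      rw [← Complex.normSq_eq_norm_sq, Complex.normSq_add_mul_I, mul_pow, ← sq_abs e, he]
      nlinarith [sq_nonneg x]
    rw [← div_eq_mul_inv, le_div_iff₀ (by positivity)]
    exact (mul_le_mul_of_nonneg_left hs (norm_nonneg _)).trans hn
  have hm := hor (-1) (by simp)
  have hp := hor 1 (by simp)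
  have key : ∀ R : ℝ, (∫ x : ℝ in σ₁..σ₂, h (x + ((-1) * R : ℝ) * Complex.I))
      - (∫ x : ℝ in σ₁..σ₂, h (x + (1 * R : ℝ) * Complex.I))
      + Complex.I • (∫ y : ℝ in -R..R, h (σ₂ + y * Complex.I))
      - Complex.I • (∫ y : ℝ in -R..R, h (σ₁ + y * Complex.I)) = 0 := by
    intro R
    have := Complex.integral_boundary_rect_eq_zero_of_differentiableOn h
      (σ₁ + ((-1) * R : ℝ) * Complex.I) (σ₂ + (1 * R : ℝ) * Complex.I) (hd.mono ?_)
    · simpa using this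
    · intro s hs
      have := hs.1
      simp only [mem_preimage, Complex.add_re, Complex.ofReal_re, Complex.mul_re, Complex.I_re,
        Complex.ofReal_im, Complex.I_im, mul_zero, zero_mul, sub_zero, add_zero] at this
      rw [uIcc_of_le h12] at this
      exact h1.trans_le this.1
  have lim := ((hm.sub hp).add (t2.const_smul Complex.I)).sub (t1.const_smul Complex.I)
  have lim0 := (tendsto_congr (fun R => key R)).1 lim
  have := tendsto_nhds_unique lim0 tendsto_const_nhds
  rw [sub_zero, zero_add, ← smul_sub, smul_eq_zero] at this
  rcases this with h | h
  · simp at h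
  · exact (sub_eq_zero.1 h).symm

/-- The path of integration can be moved to infinity. -/
lemma integral_vline_eq_zero {h : ℂ → E} (hd : DifferentiableOn ℂ h halfPlane) {σ C : ℝ}
    (hσ : 0 < σ) (hb : ∀ s : ℂ, σ ≤ s.re → ‖h s‖ * ‖s‖ ^ 2 ≤ C) :
    ∫ ξ : ℝ, h (vline σ ξ) = 0 := by
  have hshift : ∀ n : ℕ, ∫ ξ : ℝ, h (vline (σ + n) ξ) = ∫ ξ : ℝ, h (vline σ ξ) := fun n =>
    (integral_vline_shift hd hσ (by simp) (fun s h1 _ => hb s h1)).symm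
  have hC : 0 ≤ C := le_trans (by positivity) (hb σ (by simp))
  -- The first bound gives pointwise convergence to zero as the line moves right, the second a
  -- majorant that does not depend on `n`.
  have key : ∀ (n : ℕ) (y : ℝ), ‖h ((σ + n : ℝ) + y * Complex.I)‖ * (σ + n) ^ 2 ≤ C ∧
      ‖h ((σ + n : ℝ) + y * Complex.I)‖ ≤ C * max 1 (σ ^ 2)⁻¹ * (1 + y ^ 2)⁻¹ := by
    intro n y
    have h2 := hb ((σ + n : ℝ) + y * Complex.I) (by simp)
    have h3 : ‖((σ + n : ℝ) + y * Complex.I : ℂ)‖ ^ 2 = (σ + n) ^ 2 + y ^ 2 := by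
      rw [← Complex.normSq_eq_norm_sq, Complex.normSq_add_mul_I]
    have h4 : ‖((σ : ℝ) + y * Complex.I : ℂ)‖ ^ 2 = σ ^ 2 + y ^ 2 := by
      rw [← Complex.normSq_eq_norm_sq, Complex.normSq_add_mul_I]
    constructor
    · refine le_trans ?_ h2
      rw [h3]; gcongr; nlinarith
    · refine le_inv_one_add_sq hσ (norm_nonneg _) (le_trans ?_ h2)
      rw [h3, h4]; gcongr; simp
  have hlim : Tendsto (fun n : ℕ => ∫ y : ℝ, h ((σ + n : ℝ) + y * Complex.I)) atTop
      (𝓝 (∫ _ : ℝ, (0 : E))) := by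
    refine tendsto_integral_of_dominated_convergence
      (fun y => C * max 1 (σ ^ 2)⁻¹ * (1 + y ^ 2)⁻¹) (fun n => ?_)
      (integrable_inv_one_add_sq.const_mul _) (fun n => ae_of_all _ fun y => (key n y).2)
      (ae_of_all _ fun y => ?_)
    · exact (hd.continuousOn.comp_continuous (by fun_prop)
        (fun y => by simp [halfPlane]; positivity)).aestronglyMeasurable
    · rw [tendsto_zero_iff_norm_tendsto_zero]
      have h0 : Tendsto (fun n : ℕ => C * ((σ + n) ^ 2)⁻¹) atTop (𝓝 0) := by
        have : Tendsto (fun n : ℕ => (σ + n) ^ 2) atTop atTop :=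
          (tendsto_pow_atTop (by norm_num : (2 : ℕ) ≠ 0)).comp
            (tendsto_atTop_add_const_left _ σ tendsto_natCast_atTop_atTop)
        simpa using this.inv_tendsto_atTop.const_mul C
      refine squeeze_zero (fun _ => norm_nonneg _) (fun n => ?_) h0
      rw [← div_eq_mul_inv, le_div_iff₀ (by positivity)]
      exact (key n y).1
  rw [integral_zero] at hlim
  have h2 : Tendsto (fun n : ℕ => ∫ ξ : ℝ, h (vline (σ + n) ξ)) atTop (𝓝 0) := by
    simp only [integral_vline_eq]
    simpa using hlim.const_smul (2 * Real.pi)⁻¹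
  simp only [hshift] at h2
  exact tendsto_nhds_unique tendsto_const_nhds h2

/-! ### Analyticity of the Laplace transform -/

lemma hasDerivAt_exp_neg_mul (s : ℂ) (t : ℝ) :
    HasDerivAt (fun s : ℂ => Complex.exp (-(s * t))) (-(t : ℂ) * Complex.exp (-(s * t))) s := by
  have h1 : HasDerivAt (fun s : ℂ => -(s * (t : ℂ))) (-(1 * (t : ℂ))) s :=
    ((hasDerivAt_id s).mul_const _).neg
  have h2 := h1.cexp
  rwa [show Complex.exp (-(s * t)) * -(1 * (t : ℂ)) = -(t : ℂ) * Complex.exp (-(s * t)) by ring]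
    at h2

/-- Differentiation under the integral. The factor `t` and the variation of `Re s` near `s₀` are
absorbed by the weights at `s₀.re ± 2δ`, which are available because `J` is open. -/
lemma differentiableOn_lap {g : ℝ → E} {J : Set ℝ} (hJ : IsOpen J) (hg : ∀ σ ∈ J, WInt σ g) :
    DifferentiableOn ℂ (fun s => lap s g) {s | s.re ∈ J} := by
  intro s₀ hs₀
  obtain ⟨ε, hε, hball⟩ := Metric.isOpen_iff.1 hJ _ hs₀
  set δ := ε / 3 with hδ
  have hδ0 : 0 < δ := by positivity
  have w1 := hg (s₀.re - 2 * δ) (hball (by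
    rw [Metric.mem_ball, Real.dist_eq, show s₀.re - 2 * δ - s₀.re = -(2 * δ) by ring, abs_neg,
      abs_of_pos (by positivity)]; linarith))
  have w2 := hg (s₀.re + 2 * δ) (hball (by
    rw [Metric.mem_ball, Real.dist_eq, show s₀.re + 2 * δ - s₀.re = 2 * δ by ring,
      abs_of_pos (by positivity)]; linarith))
  have w0 := (hg s₀.re hs₀).integrable
  have hgm : AEStronglyMeasurable g := by
    have hc : Continuous fun t : ℝ => Complex.exp (s₀ * t) := by fun_prop
    refine (hc.aestronglyMeasurable.smul w0.aestronglyMeasurable).congr (ae_of_all _ fun t => ?_)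
    simp only [smul_smul, Pi.smul_apply', ← Complex.exp_add]
    simp
  refine (hasDerivAt_integral_of_dominated_loc_of_deriv_le
    (F := fun s t => Complex.exp (-(s * t)) • g t)
    (F' := fun s (t : ℝ) => (-(t : ℂ) * Complex.exp (-(s * t))) • g t)
    (bound := fun t => δ⁻¹ * (Real.exp (-(s₀.re - 2 * δ) * t) * ‖g t‖
      + Real.exp (-(s₀.re + 2 * δ) * t) * ‖g t‖))
    (Metric.ball_mem_nhds s₀ hδ0) (Eventually.of_forall fun s => ?_) w0 ?_
    (ae_of_all _ fun t s hs => ?_)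
    ((w1.norm_integrable.add w2.norm_integrable).const_mul _)
    (ae_of_all _ fun t s _ => ?_)).2.differentiableAt.differentiableWithinAt
  · exact (Continuous.aestronglyMeasurable (by fun_prop)).smul hgm
  · exact (Continuous.aestronglyMeasurable (by fun_prop)).smul hgm
  · rw [norm_smul, norm_mul, norm_exp_neg_mul, norm_neg, Complex.norm_real, Real.norm_eq_abs,
      ← add_mul, ← mul_assoc]
    refine mul_le_mul_of_nonneg_right ?_ (norm_nonneg _)
    have hre : |s.re - s₀.re| < δ := by
      have := Complex.abs_re_le_norm (s - s₀)
      rw [Complex.sub_re] at this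
      rw [Metric.mem_ball, dist_eq_norm] at hs
      linarith
    have hq : |t| ≤ δ⁻¹ * Real.exp (δ * |t|) := by
      have := Real.add_one_le_exp (δ * |t|)
      rw [inv_mul_eq_div, le_div_iff₀ hδ0]
      linarith
    have hr : Real.exp (-s.re * t) ≤ Real.exp (-s₀.re * t + δ * |t|) := by
      refine Real.exp_le_exp.2 ?_
      have : -(s.re - s₀.re) * t ≤ δ * |t| := by
        refine (le_abs_self _).trans ?_
        rw [abs_mul, abs_neg]
        gcongr
      linarith
    calc |t| * Real.exp (-s.re * t)
        ≤ (δ⁻¹ * Real.exp (δ * |t|)) * Real.exp (-s₀.re * t + δ * |t|) := by gcongr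
      _ = δ⁻¹ * Real.exp (-s₀.re * t + 2 * δ * |t|) := by
          rw [mul_assoc, ← Real.exp_add]; congr 2; ring
      _ ≤ _ := by
          gcongr
          rcases abs_cases t with ⟨h, _⟩ | ⟨h, _⟩
          · refine le_trans (le_of_eq ?_) (le_add_of_nonneg_right (Real.exp_pos _).le)
            rw [h]; congr 1; ring
          · refine le_trans (le_of_eq ?_) (le_add_of_nonneg_left (Real.exp_pos _).le)
            rw [h]; congr 1; ring
  · exact (hasDerivAt_exp_neg_mul s t).smul_const _

lemma IsTest.differentiable_lap {θ : ℝ → ℂ} (h : IsTest θ) : Differentiable ℂ fun s => lap s θ := by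
  have := differentiableOn_lap isOpen_univ (g := θ) fun σ _ => h.wInt σ
  simpa [differentiableOn_univ] using this

lemma IsTest.differentiable_lap_neg {θ : ℝ → ℂ} (h : IsTest θ) :
    Differentiable ℂ fun s => lap (-s) θ :=
  h.differentiable_lap.comp differentiable_neg

lemma differentiableOn_lap_halfPlane {g : ℝ → E} (hg : ∀ σ : ℝ, 0 < σ → WInt σ g) :
    DifferentiableOn ℂ (fun s => lap s g) halfPlane :=
  differentiableOn_lap isOpen_Ioi hg

end Contour

/-! ### Parseval's formula and the Fourier transform on `L²` -/

section Parseval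

variable {E : Type*} [NormedAddCommGroup E] [NormedSpace ℂ E] [CompleteSpace E]

lemma integral_fourier_smul_eq_flip {f : ℝ → ℂ} {g : ℝ → E} (hf : Integrable f)
    (hg : Integrable g) : ∫ ξ, 𝓕 f ξ • g ξ = ∫ x, f x • 𝓕 g x := by
  have := VectorFourier.integral_fourierIntegral_smul_eq_flip (L := innerₗ ℝ) (μ := volume)
    (ν := volume) Real.continuous_fourierChar continuous_inner hf hg
  rw [flip_innerₗ] at this
  exact this

lemma IsTest.fourierInv_integrable {θ : ℝ → ℂ} (h : IsTest θ) : Integrable (𝓕⁻ θ) := by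
  have := (𝓕⁻ (h.2.toSchwartzMap h.1)).integrable (μ := volume)
  rwa [SchwartzMap.fourierInv_coe] at this

lemma IsTest.fourier_fourierInv {θ : ℝ → ℂ} (h : IsTest θ) : 𝓕 (𝓕⁻ θ) = θ := by
  refine h.1.continuous.fourier_fourierInv_eq h.integrable ?_
  have := (𝓕 (h.2.toSchwartzMap h.1)).integrable (μ := volume)
  rwa [SchwartzMap.fourier_coe] at this

lemma IsTest.rexp_mul {θ : ℝ → ℂ} (h : IsTest θ) (σ : ℝ) :
    IsTest fun t : ℝ => (Real.exp (σ * t) : ℂ) • θ t :=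
  h.smooth_mul (contDiff_rexp_mul σ)

/-- Parseval's formula on `Re s = σ`: the weights `e^{σt}` on `θ` and `e^{-σt}` on `g` cancel. -/
lemma IsTest.integral_smul_eq {θ : ℝ → ℂ} (h : IsTest θ) {g : ℝ → E} {σ : ℝ} (hg : WInt σ g) :
    ∫ t, θ t • g t = ∫ ξ : ℝ, lap (-vline σ ξ) θ • lap (vline σ ξ) g := by
  simp only [lap_neg_vline, lap_vline]
  rw [← integral_fourier_smul_eq_flip (h.rexp_mul σ).fourierInv_integrable hg,
    (h.rexp_mul σ).fourier_fourierInv]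
  refine integral_congr_ae (ae_of_all _ fun t => ?_)
  simp only [smul_smul, smul_eq_mul]
  congr 1
  rw [mul_right_comm, ← Complex.ofReal_mul, ← Real.exp_add]
  simp

variable {V : Type*} [NormedAddCommGroup V] [InnerProductSpace ℂ V] [CompleteSpace V]

/-- The `L²` transform is compatible with that of tempered distributions, so it can be moved onto
the test function although `u` need not be integrable. -/
lemma integral_smul_fourierInv_eq (u : Lp V 2 (volume : Measure ℝ)) {θ : ℝ → ℂ} (h : IsTest θ) :
    ∫ t, θ t • (𝓕⁻ u : Lp V 2 (volume : Measure ℝ)) t = ∫ ξ, 𝓕⁻ θ ξ • u ξ := by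
  have h1 := congrArg (fun D : 𝓢'(ℝ, V) => D (h.2.toSchwartzMap h.1))
    (Lp.fourierInv_toTemperedDistribution_eq u)
  simp only [TemperedDistribution.fourierInv_apply, Lp.toTemperedDistribution_apply,
    SchwartzMap.fourierInv_coe] at h1
  exact h1.symm

lemma integral_smul_fourier_eq (u : Lp V 2 (volume : Measure ℝ)) {θ : ℝ → ℂ} (h : IsTest θ) :
    ∫ t, θ t • (𝓕 u : Lp V 2 (volume : Measure ℝ)) t = ∫ ξ, 𝓕 θ ξ • u ξ := by
  have h1 := congrArg (fun D : 𝓢'(ℝ, V) => D (h.2.toSchwartzMap h.1))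
    (Lp.fourier_toTemperedDistribution_eq u)
  simp only [TemperedDistribution.fourier_apply, Lp.toTemperedDistribution_apply,
    SchwartzMap.fourier_coe] at h1
  exact h1.symm

lemma isTest_ofReal {g : ℝ → ℝ} (h1 : ContDiff ℝ ∞ g) (h2 : HasCompactSupport g) :
    IsTest (fun t => (g t : ℂ)) :=
  ⟨Complex.ofRealCLM.contDiff.comp h1, h2.comp_left (g := fun x : ℝ => (x : ℂ)) (by simp)⟩

lemma tsupport_ofReal (g : ℝ → ℝ) : tsupport (fun t => (g t : ℂ)) = tsupport g := by
  simp [tsupport, Function.support]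

/-- A locally integrable function that vanishes against all test functions with support in the
open set `U` vanishes on `U`. -/
lemma ae_eq_zero_of_test {g : ℝ → V} {U : Set ℝ} (hU : IsOpen U) (hg : LocallyIntegrableOn g U)
    (h : ∀ θ : ℝ → ℂ, IsTest θ → tsupport θ ⊆ U → ∫ t, θ t • g t = 0) :
    ∀ᵐ t : ℝ, t ∈ U → g t = 0 := by
  refine hU.ae_eq_zero_of_integral_contDiff_smul_eq_zero hg fun θ h1 h2 h3 => ?_
  rw [← h _ (isTest_ofReal h1 h2) (by rwa [tsupport_ofReal])]
  simp

/-- Both functions have the same pairing with every test function: one by duality of tempered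
distributions, the other by Fubini. -/
lemma fourier_toLp_ae_eq {f : ℝ → V} (h2 : MemLp f 2) (h1 : Integrable f) :
    (𝓕 (h2.toLp f) : Lp V 2 (volume : Measure ℝ)) =ᵐ[volume] 𝓕 f := by
  have hloc : LocallyIntegrable (𝓕 (h2.toLp f) : Lp V 2 (volume : Measure ℝ)) :=
    (Lp.memLp _).locallyIntegrable (by norm_num)
  have hc : Continuous (𝓕 f) :=
    VectorFourier.fourierIntegral_continuous Real.continuous_fourierChar
      (by exact continuous_inner) h1
  have := ae_eq_zero_of_test isOpen_univ
    (g := fun ξ => (𝓕 (h2.toLp f) : Lp V 2 (volume : Measure ℝ)) ξ - 𝓕 f ξ)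
    ((hloc.sub hc.locallyIntegrable).locallyIntegrableOn _) fun θ hθ _ => ?_
  · filter_upwards [this] with ξ hξ using sub_eq_zero.1 (hξ trivial)
  · simp only [smul_sub]
    rw [integral_sub, integral_smul_fourier_eq _ hθ, ← integral_fourier_smul_eq_flip hθ.integrable h1,
      sub_eq_zero]
    · refine integral_congr_ae ?_
      filter_upwards [h2.coeFn_toLp] with t ht
      rw [ht]
    · exact hloc.integrable_smul_left_of_hasCompactSupport hθ.1.continuous hθ.2
    · exact hc.locallyIntegrable.integrable_smul_left_of_hasCompactSupport hθ.1.continuous hθ.2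

end Parseval

/-! ### Antisymmetry of `∂ₓ` on `H¹ₚ(S)` -/

lemma exists_cutoff (R : ℝ) (hR : 0 < R) : ∃ χ : ℝ → ℝ, ContDiff ℝ ∞ χ ∧ HasCompactSupport χ ∧
    (∀ t, |t| ≤ R → χ t = 1) ∧ tsupport χ ⊆ Icc (-(R + 1)) (R + 1) := by
  let f : ContDiffBump (0 : ℝ) := ⟨R, R + 1, hR, by linarith⟩
  refine ⟨f, f.contDiff, f.hasCompactSupport, fun t ht => ?_, ?_⟩
  · exact f.one_of_mem_closedBall (by simpa [Real.dist_eq] using ht)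
  · rw [f.tsupport_eq, Real.closedBall_eq_Icc]
    simp [f]

section Skew

variable {L : ℝ}

/-- The mode `e^{2πikx/L} ψ(z)`, cut off in `x` by `χ`. -/
def mode (L : ℝ) (χ : ℝ → ℝ) (k : ℤ) (ψ : ℝ → ℂ) (p : ℝ × ℝ) : ℂ :=
  χ p.1 * Complex.exp (2 * Real.pi * Complex.I * k * p.1 / L) * ψ p.2

/-- The eigenvalue of `∂ₓ` at the modes with index `k`. -/
def modeEig (L : ℝ) (k : ℤ) : ℂ := 2 * Real.pi * Complex.I * k / L

lemma conj_modeEig (k : ℤ) : conj (modeEig L k) = -modeEig L k := by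
  simp [modeEig, neg_div, map_ofNat]

lemma modeEig_neg (k : ℤ) : modeEig L (-k) = -modeEig L k := by
  simp [modeEig, neg_div]

/-- A cutoff function in `x` that equals one near the strip. -/
structure IsCut (L : ℝ) (χ : ℝ → ℝ) : Prop where
  smooth : ContDiff ℝ ∞ χ
  compact : HasCompactSupport χ
  one : ∀ t, |t| ≤ L + 1 → χ t = 1

variable {χ : ℝ → ℝ}

lemma IsCut.isTest_mode (h : IsCut L χ) (k : ℤ) {ψ : ℝ → ℂ} (hψ : IsTest ψ) :
    IsTest (mode L χ k ψ) := by
  constructor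
  · have h1 : ContDiff ℝ ∞ fun p : ℝ × ℝ => (χ p.1 : ℂ) :=
      Complex.ofRealCLM.contDiff.comp (h.smooth.comp contDiff_fst)
    have h2 : ContDiff ℝ ∞ fun p : ℝ × ℝ => ((p.1 : ℝ) : ℂ) :=
      Complex.ofRealCLM.contDiff.comp contDiff_fst
    exact (h1.mul ((contDiff_const.mul h2).div_const _).cexp).mul (hψ.1.comp contDiff_snd)
  · refine HasCompactSupport.intro (h.compact.isCompact.prod hψ.2.isCompact) fun p hp => ?_
    simp only [mem_prod, not_and_or] at hp
    rcases hp with hp | hp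
    · simp [mode, image_eq_zero_of_notMem_tsupport hp]
    · simp [mode, image_eq_zero_of_notMem_tsupport hp]

lemma conj_mode (k : ℤ) (ψ : ℝ → ℂ) (p : ℝ × ℝ) :
    conj (mode L χ k ψ p) = mode L χ (-k) (fun z => conj (ψ z)) p := by
  simp only [mode, map_mul, Complex.conj_ofReal, ← Complex.exp_conj]
  congr 3
  simp [map_ofNat]

lemma IsTest.conj {ψ : ℝ → ℂ} (h : IsTest ψ) : IsTest fun z => conj (ψ z) :=
  ⟨Complex.conjCLE.contDiff.comp h.1, h.2.comp_left (g := fun w : ℂ => conj w) (by simp)⟩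

lemma IsCut.memLp_mode (h : IsCut L χ) (k : ℤ) {ψ : ℝ → ℂ} (hψ : IsTest ψ) :
    MemLp (mode L χ k ψ) 2 (volume.restrict (strip L)) :=
  (h.isTest_mode k hψ).1.continuous.memLp_of_hasCompactSupport (h.isTest_mode k hψ).2

/-- The mode as an element of `L²(S)`. -/
def IsCut.q (h : IsCut L χ) (k : ℤ) {ψ : ℝ → ℂ} (hψ : IsTest ψ) : L2S L :=
  (h.memLp_mode k hψ).toLp

lemma IsCut.inner_q (h : IsCut L χ) (k : ℤ) {ψ : ℝ → ℂ} (hψ : IsTest ψ) (u : L2S L) :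
    inner ℂ (h.q k hψ) u = ∫ p in strip L, u p * mode L χ (-k) (fun z => conj (ψ z)) p := by
  rw [L2.inner_def]
  refine integral_congr_ae ?_
  filter_upwards [(h.memLp_mode k hψ).coeFn_toLp] with p hp
  rw [IsCut.q, hp, ← conj_mode]
  simp

lemma IsCut.dx_mode (h : IsCut L χ) (k : ℤ) {ψ : ℝ → ℂ} (hψ : IsTest ψ) {p : ℝ × ℝ}
    (hp : p ∈ strip L) : dx (mode L χ k ψ) p = modeEig L k * mode L χ k ψ p := by
  have hd : DifferentiableAt ℝ (mode L χ k ψ) p :=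
    (h.isTest_mode k hψ).1.differentiable (by simp) p
  have hL : |p.1| < L + 1 := by
    have := hp.1
    rw [abs_lt]; constructor <;> linarith [this.1, this.2]
  rw [dx, ← hd.lineDeriv_eq_fderiv, lineDeriv]
  have h1 : (fun t : ℝ => mode L χ k ψ (p + t • (1, 0))) =ᶠ[𝓝 0]
      fun t : ℝ => Complex.exp (modeEig L k * ((p.1 + t : ℝ) : ℂ)) * ψ p.2 := by
    have hc : Continuous fun t : ℝ => |p.1 + t| := by fun_prop
    have : ∀ᶠ t : ℝ in 𝓝 0, |p.1 + t| < L + 1 :=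
      hc.continuousAt.eventually_lt continuousAt_const (by simpa using hL)
    filter_upwards [this] with t ht
    simp only [mode, Prod.fst_add, Prod.smul_mk, smul_eq_mul, mul_one, mul_zero, Prod.snd_add,
      add_zero]
    rw [h.one _ ht.le, Complex.ofReal_one, one_mul, modeEig]
    congr 2; ring
  rw [h1.deriv_eq]
  have h2 : HasDerivAt (fun t : ℝ => modeEig L k * ((p.1 + t : ℝ) : ℂ)) (modeEig L k * 1) 0 := by
    have : HasDerivAt (fun t : ℝ => ((p.1 + t : ℝ) : ℂ)) 1 0 := by
      have := ((hasDerivAt_id (0 : ℝ)).const_add p.1).ofReal_comp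
      simpa using this
    exact this.const_mul _
  rw [(h2.cexp.mul_const (ψ p.2)).deriv]
  simp only [mode, h.one _ hL.le, add_zero, mul_one, Complex.ofReal_one, one_mul]
  rw [show modeEig L k * (p.1 : ℂ) = 2 * Real.pi * Complex.I * k * p.1 / L by
    simp only [modeEig]; ring]
  ring

lemma measurableSet_strip : MeasurableSet (strip L) := measurableSet_Ioo.prod MeasurableSet.univ

/-- A mode takes equal values at `x = 0` and `x = L`, so its conjugate is admissible in
`HasPeriodicTrace`. Conjugation replaces `k` by `-k`, which cancels the sign from integration by
parts. -/
lemma IsCut.inner_q_of_periodic (h : IsCut L χ) (hL : 0 < L) (k : ℤ) {ψ : ℝ → ℂ} (hψ : IsTest ψ)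
    {u ux : L2S L} (hu : HasPeriodicTrace L u ux) :
    inner ℂ (h.q k hψ) ux = modeEig L k * inner ℂ (h.q k hψ) u := by
  have h1 := hu (mode L χ (-k) fun z => conj (ψ z)) (h.isTest_mode (-k) hψ.conj) (fun z => by
    have e : Complex.exp (2 * Real.pi * Complex.I * ((-k : ℤ) : ℂ) * (L : ℂ) / L) = 1 := by
      rw [Complex.exp_eq_one_iff]
      refine ⟨-k, ?_⟩
      have : (L : ℂ) ≠ 0 := by exact_mod_cast hL.ne'
      field_simp
    simp only [mode, e]
    rw [h.one 0 (by simp; linarith), h.one L (by rw [abs_of_pos hL]; linarith)]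
    simp)
  rw [IsCut.inner_q, IsCut.inner_q]
  have h2 : (∫ p in strip L, u p * dx (mode L χ (-k) fun z => conj (ψ z)) p)
      = modeEig L (-k) * ∫ p in strip L, u p * mode L χ (-k) (fun z => conj (ψ z)) p := by
    rw [← integral_const_mul]
    refine setIntegral_congr_fun measurableSet_strip fun p hp => ?_
    simp only [h.dx_mode (-k) hψ.conj hp]
    ring
  rw [h2, modeEig_neg] at h1
  linear_combination h1

lemma volume_restrict_strip : (volume.restrict (strip L) : Measure (ℝ × ℝ))
    = (volume.restrict (Ioo 0 L)).prod volume := by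
  rw [strip, Measure.volume_eq_prod, ← Measure.prod_restrict, Measure.restrict_univ]

/-! ### Orthogonality and completeness of the modes. -/

lemma integral_exp_mode (hL : 0 < L) {n : ℤ} (hn : n ≠ 0) :
    ∫ x in Ioo 0 L, Complex.exp (2 * Real.pi * Complex.I * n * x / L) = 0 := by
  rw [← integral_Ioc_eq_integral_Ioo, ← intervalIntegral.integral_of_le hL.le]
  have hL' : (L : ℂ) ≠ 0 := by exact_mod_cast hL.ne'
  have hc : (2 * Real.pi * Complex.I * n / L : ℂ) ≠ 0 := by
    simp [hn, hL', Real.pi_ne_zero]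
  have := integral_exp_mul_complex (a := 0) (b := L) hc
  rw [show (∫ x in (0 : ℝ)..L, Complex.exp (2 * Real.pi * Complex.I * n * x / L))
    = ∫ x in (0 : ℝ)..L, Complex.exp (2 * Real.pi * Complex.I * n / L * x) by
      congr 1; ext x; congr 1; ring, this]
  have e : Complex.exp (2 * Real.pi * Complex.I * n / L * (L : ℂ)) = 1 := by
    rw [Complex.exp_eq_one_iff]
    exact ⟨n, by field_simp⟩
  simp [e]

lemma IsCut.inner_q_q (h : IsCut L χ) (hL : 0 < L) {k l : ℤ} (hkl : k ≠ l) {ψ υ : ℝ → ℂ}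
    (hψ : IsTest ψ) (hυ : IsTest υ) : inner ℂ (h.q k hψ) (h.q l hυ) = 0 := by
  rw [IsCut.inner_q]
  have h1 : (∫ p in strip L, (h.q l hυ : L2S L) p * mode L χ (-k) (fun z => conj (ψ z)) p)
      = ∫ p in strip L, Complex.exp (2 * Real.pi * Complex.I * ((l - k : ℤ) : ℂ) * p.1 / L)
        * (υ p.2 * conj (ψ p.2)) := by
    refine integral_congr_ae ?_
    filter_upwards [(h.memLp_mode l hυ).coeFn_toLp, ae_restrict_mem measurableSet_strip]
      with p hp hs
    rw [IsCut.q, hp]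
    simp only [mode]
    rw [h.one p.1 (by
      have := hs.1
      rw [abs_le]; constructor <;> linarith [this.1, this.2])]
    rw [show (2 * Real.pi * Complex.I * ((l - k : ℤ) : ℂ) * p.1 / L : ℂ)
      = 2 * Real.pi * Complex.I * l * p.1 / L
        + 2 * Real.pi * Complex.I * ((-k : ℤ) : ℂ) * p.1 / L by push_cast; ring, Complex.exp_add]
    simp only [Complex.ofReal_one]
    ring
  rw [h1, volume_restrict_strip, integral_prod_mul
    (fun x : ℝ => Complex.exp (2 * Real.pi * Complex.I * ((l - k : ℤ) : ℂ) * x / L))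
    (fun z : ℝ => υ z * conj (ψ z)),
    integral_exp_mode hL (sub_ne_zero.2 hkl.symm), zero_mul]

/-- A square integrable function on `(0, L)` with vanishing Fourier coefficients is zero. -/
lemma ae_eq_zero_of_fourier (hL : 0 < L) {f : ℝ → ℂ} (hf : MemLp f 2 (volume.restrict (Ioo 0 L)))
    (h : ∀ k : ℤ, ∫ x in Ioo 0 L, f x * Complex.exp (2 * Real.pi * Complex.I * k * x / L) = 0) :
    f =ᵐ[volume.restrict (Ioo 0 L)] 0 := by
  have hf' : MemLp f 2 (volume.restrict (Ioc 0 L)) := by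
    rwa [← restrict_Ioo_eq_restrict_Ioc]
  have h1 := hasSum_sq_fourierCoeffOn hL hf'
  have h0 : ∀ n : ℤ, fourierCoeffOn hL f n = 0 := by
    intro n
    rw [fourierCoeffOn_eq_integral, intervalIntegral.integral_of_le hL.le,
      integral_Ioc_eq_integral_Ioo]
    have h2 := h (-n)
    rw [show (∫ x in Ioo 0 L, fourier (-n) (x : AddCircle (L - 0)) • f x)
      = ∫ x in Ioo 0 L, f x * Complex.exp (2 * Real.pi * Complex.I * ((-n : ℤ) : ℂ) * x / L) by
        refine integral_congr_ae (ae_of_all _ fun x => ?_)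
        simp only [fourier_coe_apply, smul_eq_mul, sub_zero]
        ring, h2, smul_zero]
  simp only [h0, norm_zero, ne_eq, OfNat.ofNat_ne_zero, not_false_eq_true, zero_pow] at h1
  have h3 := h1.unique hasSum_zero
  rw [sub_zero, smul_eq_mul, mul_eq_zero, intervalIntegral.integral_of_le hL.le,
    integral_Ioc_eq_integral_Ioo] at h3
  have h4 := h3.resolve_left (inv_ne_zero hL.ne')
  rw [integral_eq_zero_iff_of_nonneg (fun x => by positivity) hf.norm.integrable_sq] at h4
  filter_upwards [h4] with x hx
  simpa using hx

/-- As `ψ` is arbitrary, each Fourier coefficient of `f(·, z)` vanishes for almost every `z`. There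
are countably many, so almost every slice is zero by Parseval on `(0, L)`, and `f = 0` by Tonelli.
-/
lemma IsCut.eq_zero_of_inner_q (h : IsCut L χ) (hL : 0 < L) {f : L2S L}
    (hf : ∀ (k : ℤ) (ψ : ℝ → ℂ) (hψ : IsTest ψ), inner ℂ (h.q k hψ) f = 0) : f = 0 := by
  set μ : Measure ℝ := volume.restrict (Ioo 0 L) with hμ
  have hfin : IsFiniteMeasure μ := ⟨by simp [hμ]⟩
  have hf2 : MemLp f 2 (μ.prod volume) := by
    have := Lp.memLp f
    generalize (f : ℝ × ℝ → ℂ) = g at this ⊢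
    rwa [volume_restrict_strip] at this
  let e : ℤ → ℝ → ℂ := fun k x => Complex.exp (2 * Real.pi * Complex.I * k * x / L)
  have he : ∀ k, Continuous (e k) := fun k => by fun_prop
  have hen : ∀ k x, ‖e k x‖ = 1 := fun k x => by
    simp only [e]
    rw [show (2 * Real.pi * Complex.I * k * x / L : ℂ)
      = ((2 * Real.pi * k * x / L : ℝ) : ℂ) * Complex.I by push_cast; ring]
    exact Complex.norm_exp_ofReal_mul_I _
  -- `f` is only square integrable on an unbounded strip, so integrability is available only for `z`
  -- in compact sets.
  have hloc : ∀ (k : ℤ) (K : Set ℝ), IsCompact K →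
      Integrable (fun p : ℝ × ℝ => f p * e k p.1) (μ.prod (volume.restrict K)) := by
    intro k K hK
    have : IsFiniteMeasure (volume.restrict K : Measure ℝ) := ⟨by simpa using hK.measure_lt_top⟩
    have h1 : MemLp f 2 (μ.prod (volume.restrict K)) :=
      hf2.mono_measure (Measure.prod_mono le_rfl Measure.restrict_le_self)
    have h2 := (h1.integrable (by norm_num))
    have h3 := h2.bdd_mul (c := 1) (f := fun p : ℝ × ℝ => e k p.1)
      ((he k).comp continuous_fst).aestronglyMeasurable (ae_of_all _ fun p => (hen k p.1).le)
    exact h3.congr (ae_of_all _ fun p => mul_comm _ _)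
  have hzero : ∀ k : ℤ, ∀ᵐ z : ℝ, ∫ x, f (x, z) * e k x ∂μ = 0 := by
    intro k
    have hl : LocallyIntegrable (fun z : ℝ => ∫ x, f (x, z) * e k x ∂μ) := by
      rw [locallyIntegrable_iff]
      intro K hK
      exact (hloc k K hK).integral_prod_right
    have := ae_eq_zero_of_test isOpen_univ (hl.locallyIntegrableOn _) fun θ hθ _ => ?_
    · filter_upwards [this] with z hz using hz trivial
    · have h1 := hf (-k) (fun z => conj (θ z)) hθ.conj
      rw [IsCut.inner_q] at h1
      simp only [neg_neg, Complex.conj_conj] at h1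
      have hint : Integrable (fun p : ℝ × ℝ => θ p.2 * (f p * e k p.1)) (μ.prod volume) := by
        have hK := hloc k _ hθ.2.isCompact
        have h2 : IntegrableOn (fun p : ℝ × ℝ => f p * e k p.1) (univ ×ˢ tsupport θ)
            (μ.prod volume) := by
          rw [IntegrableOn, ← Measure.prod_restrict, Measure.restrict_univ]
          exact hK
        obtain ⟨C, hC⟩ := hθ.2.exists_bound_of_continuous hθ.1.continuous
        have h3 : IntegrableOn (fun p : ℝ × ℝ => θ p.2 * (f p * e k p.1)) (univ ×ˢ tsupport θ)
            (μ.prod volume) :=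
          Integrable.bdd_mul (c := C) h2 (hθ.1.continuous.comp continuous_snd).aestronglyMeasurable
            (ae_of_all _ fun p => hC _)
        refine (integrableOn_iff_integrable_of_support_subset fun p hp => ?_).1 h3
        refine ⟨trivial, subset_tsupport _ fun h0 => hp ?_⟩
        simp [h0]
      have h4 : (∫ p in strip L, f p * mode L χ k θ p)
          = ∫ p, θ p.2 * (f p * e k p.1) ∂(μ.prod volume) := by
        rw [← volume_restrict_strip]
        refine setIntegral_congr_fun measurableSet_strip fun p hp => ?_
        simp only [mode]
        rw [h.one p.1 (by
          have := hp.1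
          rw [abs_le]; constructor <;> linarith [this.1, this.2])]
        simp only [Complex.ofReal_one, e]
        ring
      rw [h4, integral_prod_symm _ hint] at h1
      simp only [integral_const_mul] at h1
      simpa using h1
  have hae : ∀ᵐ z : ℝ, (fun x => f (x, z)) =ᵐ[μ] 0 := by
    have h1 : ∀ᵐ z : ℝ, ∀ k : ℤ, ∫ x, f (x, z) * e k x ∂μ = 0 := ae_all_iff.2 hzero
    have h2 : ∀ᵐ z : ℝ, Integrable (fun x => ‖f (x, z)‖ ^ 2) μ :=
      hf2.norm.integrable_sq.prod_left_ae
    have h3 : ∀ᵐ z : ℝ, AEStronglyMeasurable (fun x => f (x, z)) μ :=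
      hf2.1.prodMk_right
    filter_upwards [h1, h2, h3] with z a1 a2 a3
    refine ae_eq_zero_of_fourier hL ?_ a1
    rw [← memLp_norm_iff a3]
    exact (memLp_two_iff_integrable_sq a3.norm).2 a2
  rw [Lp.eq_zero_iff_ae_eq_zero]
  suffices h6 : (f : ℝ × ℝ → ℂ) =ᵐ[μ.prod volume] 0 by
    generalize (f : ℝ × ℝ → ℂ) = g at h6 ⊢
    rwa [volume_restrict_strip]
  have hm : AEStronglyMeasurable f (μ.prod volume) := hf2.1
  have h5 : ∫⁻ p, ‖f p‖ₑ ∂(μ.prod volume) = 0 := by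
    rw [lintegral_prod_symm _ hm.enorm]
    refine (lintegral_congr_ae ?_).trans lintegral_zero
    filter_upwards [hae] with z hz
    refine (lintegral_congr_ae ?_).trans lintegral_zero
    filter_upwards [hz] with x hx
    simp only [Pi.zero_apply] at hx
    simp [hx]
  rw [lintegral_eq_zero_iff' hm.enorm] at h5
  filter_upwards [h5] with p hp
  simpa using hp

/-- The product `L²(S) × L²(S)` with its Hilbert space norm. -/
abbrev GraphSpace (L : ℝ) : Type := WithLp 2 (L2S L × L2S L)

/-- Integration by parts in `x` for periodic functions. -/
lemma inner_add_inner_of_periodic (hL : 0 < L) {u ux v vx : L2S L}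
    (hu : HasPeriodicTrace L u ux) (hv : HasPeriodicTrace L v vx) :
    inner ℂ v ux + inner ℂ vx u = 0 := by
  obtain ⟨χ, h1, h2, h3, -⟩ := exists_cutoff (L + 1) (by linarith)
  have hχ : IsCut L χ := ⟨h1, h2, h3⟩
  -- `HasPeriodicTrace` tests with smooth functions only, so two periodic functions cannot be paired
  -- directly. `T` collects the pairs that satisfy the derivative relation against all modes; it
  -- will equal the closed span `G` of the graphs of the modes.
  let T : Submodule ℂ (GraphSpace L) :=
    { carrier := {P | ∀ (k : ℤ) (ψ : ℝ → ℂ) (hψ : IsTest ψ),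
        inner ℂ (hχ.q k hψ) P.snd = modeEig L k * inner ℂ (hχ.q k hψ) P.fst}
      zero_mem' := fun k ψ hψ => by simp
      add_mem' := fun {P Q} hP hQ k ψ hψ => by
        simp only [WithLp.add_snd, WithLp.add_fst, inner_add_right, hP k ψ hψ, hQ k ψ hψ]; ring
      smul_mem' := fun a P hP k ψ hψ => by
        simp only [WithLp.smul_snd, WithLp.smul_fst, inner_smul_right, hP k ψ hψ]; ring }
  have hTc : IsClosed (T : Set (GraphSpace L)) := by
    have : (T : Set (GraphSpace L)) = ⋂ (k : ℤ) (ψ : ℝ → ℂ) (hψ : IsTest ψ),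
        {P : GraphSpace L | inner ℂ (hχ.q k hψ) P.snd = modeEig L k * inner ℂ (hχ.q k hψ) P.fst} := by
      ext P; simp [T]
    rw [this]
    refine isClosed_iInter fun k => isClosed_iInter fun ψ => isClosed_iInter fun hψ => ?_
    have c1 : Continuous fun P : GraphSpace L => P.fst := WithLp.continuous_fst 2 _ _
    have c2 : Continuous fun P : GraphSpace L => P.snd := WithLp.continuous_snd 2 _ _
    exact isClosed_eq (continuous_const.inner c2) (continuous_const.mul (continuous_const.inner c1))
  let S : Set (GraphSpace L) := {P | ∃ (k : ℤ) (ψ : ℝ → ℂ) (hψ : IsTest ψ),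
    P = WithLp.toLp 2 (hχ.q k hψ, modeEig L k • hχ.q k hψ)}
  have hST : S ⊆ T := by
    rintro P ⟨k, ψ, hψ, rfl⟩ l υ hυ
    by_cases hkl : l = k
    · subst hkl
      simp [inner_smul_right]
    · simp [inner_smul_right, hχ.inner_q_q hL hkl hυ hψ]
  let G : Submodule ℂ (GraphSpace L) := (Submodule.span ℂ S).topologicalClosure
  have hGT : G ≤ T := Submodule.topologicalClosure_minimal _ (Submodule.span_le.2 hST) hTc
  have : CompleteSpace G := (Submodule.isClosed_topologicalClosure _).completeSpace_coe
  -- The part `B` of an element of `T` that is orthogonal to `G` satisfies `(1 + |λ|²) (q, B.fst) =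
  -- 0` for each mode `q` with eigenvalue `λ`, so `B = 0` by completeness of the modes.
  have hTG : T ≤ G := by
    intro P hP
    obtain ⟨A, hA, B, hB, rfl⟩ := G.exists_add_mem_mem_orthogonal P
    have hBT : B ∈ T := by
      have := T.sub_mem hP (hGT hA)
      simpa using this
    have hB0 : ∀ (k : ℤ) (ψ : ℝ → ℂ) (hψ : IsTest ψ),
        inner ℂ (hχ.q k hψ) B.fst = 0 ∧ inner ℂ (hχ.q k hψ) B.snd = 0 := by
      intro k ψ hψ
      have e1 : inner ℂ (hχ.q k hψ) B.ofLp.2 = modeEig L k * inner ℂ (hχ.q k hψ) B.ofLp.1 :=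
        hBT k ψ hψ
      have e2 := hB (WithLp.toLp 2 (hχ.q k hψ, modeEig L k • hχ.q k hψ))
        (Submodule.le_topologicalClosure _ (Submodule.subset_span ⟨k, ψ, hψ, rfl⟩))
      rw [WithLp.prod_inner_apply] at e2
      simp only [inner_smul_left] at e2
      rw [e1, ← mul_assoc, ← Complex.normSq_eq_conj_mul_self, ← one_add_mul] at e2
      have hne : (1 + (Complex.normSq (modeEig L k) : ℂ)) ≠ 0 := by
        have : (0 : ℝ) < 1 + Complex.normSq (modeEig L k) := by
          linarith [Complex.normSq_nonneg (modeEig L k)]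
        exact_mod_cast this.ne'
      have e3 := (mul_eq_zero.1 e2).resolve_left hne
      exact ⟨e3, e1.trans (by rw [e3, mul_zero])⟩
    have b1 := hχ.eq_zero_of_inner_q hL fun k ψ hψ => (hB0 k ψ hψ).1
    have b2 := hχ.eq_zero_of_inner_q hL fun k ψ hψ => (hB0 k ψ hψ).2
    have : B = 0 := by
      apply WithLp.ofLp_injective
      exact Prod.ext b1 b2
    rw [this, add_zero]
    exact hA
  have hmem : ∀ {a b : L2S L}, HasPeriodicTrace L a b → (WithLp.toLp 2 (a, b) : GraphSpace L) ∈ T :=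
    fun hab k ψ hψ => hχ.inner_q_of_periodic hL k hψ hab
  -- On a mode the identity is the relation for `u` together with `conj λ = -λ`; it extends to `G`
  -- by linearity and continuity.
  have horth : (WithLp.toLp 2 (ux, u) : GraphSpace L) ∈ Gᗮ := by
    rw [Submodule.orthogonal_closure]
    rw [Submodule.mem_orthogonal]
    intro P hP
    induction hP using Submodule.span_induction with
    | mem P hP =>
      obtain ⟨k, ψ, hψ, rfl⟩ := hP
      rw [WithLp.prod_inner_apply]
      simp only [inner_smul_left, conj_modeEig]
      rw [hχ.inner_q_of_periodic hL k hψ hu]; ring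
    | zero => simp
    | add P Q _ _ hP hQ => rw [inner_add_left, hP, hQ, add_zero]
    | smul a P _ hP => rw [inner_smul_left, hP, mul_zero]
  have := horth _ (hTG (hmem hv))
  rwa [WithLp.prod_inner_apply] at this

end Skew

/-! ### The coefficient as an analytic family in `L^∞(S)` -/

/-- Second order Taylor estimate for bounded analytic functions. -/
lemma norm_sub_sub_deriv_le {f : ℂ → ℂ} {s₀ : ℂ} {δ M : ℝ} (hδ : 0 < δ)
    (hf : DifferentiableOn ℂ f (Metric.ball s₀ (3 * δ)))
    (hM : ∀ z ∈ Metric.ball s₀ (3 * δ), ‖f z‖ ≤ M) :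
    ‖deriv f s₀‖ ≤ M / δ ∧ ∀ z ∈ Metric.ball s₀ δ,
      ‖f z - f s₀ - (z - s₀) * deriv f s₀‖ ≤ M / δ / δ * ‖z - s₀‖ ^ 2 := by
  have hsub : ∀ z ∈ Metric.ball s₀ (2 * δ), Metric.closedBall z δ ⊆ Metric.ball s₀ (3 * δ) := by
    intro z hz
    refine Metric.closedBall_subset_ball' ?_
    rw [Metric.mem_ball] at hz; linarith
  -- Each Cauchy estimate uses up a margin `δ` of the ball of radius `3δ`: first derivatives are
  -- bounded on radius `2δ`, second derivatives on radius `δ`.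
  have hd1 : ∀ z ∈ Metric.ball s₀ (2 * δ), ‖deriv f z‖ ≤ M / δ := fun z hz =>
    Complex.norm_deriv_le_of_forall_mem_sphere_norm_le hδ
      ((hf.mono (hsub z hz)).diffContOnCl_ball subset_rfl)
      fun w hw => hM w (hsub z hz (Metric.sphere_subset_closedBall hw))
  have hfd : DifferentiableOn ℂ (deriv f) (Metric.ball s₀ (3 * δ)) :=
    hf.deriv Metric.isOpen_ball
  have hd2 : ∀ z ∈ Metric.ball s₀ δ, ‖deriv (deriv f) z‖ ≤ M / δ / δ := by
    intro z hz
    rw [Metric.mem_ball] at hz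
    have h2 : z ∈ Metric.ball s₀ (2 * δ) := by rw [Metric.mem_ball]; linarith
    refine Complex.norm_deriv_le_of_forall_mem_sphere_norm_le hδ
      ((hfd.mono (hsub z h2)).diffContOnCl_ball subset_rfl) fun w hw => hd1 w ?_
    rw [Metric.mem_sphere] at hw
    rw [Metric.mem_ball]
    linarith [dist_triangle w z s₀]
  refine ⟨hd1 s₀ (Metric.mem_ball_self (by linarith)), fun z hz => ?_⟩
  rw [Metric.mem_ball, dist_eq_norm] at hz
  set r := ‖z - s₀‖ with hr
  have hball : ∀ w ∈ Metric.closedBall s₀ r, w ∈ Metric.ball s₀ δ := fun w hw =>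
    Metric.closedBall_subset_ball hz hw
  have hdat : ∀ w ∈ Metric.closedBall s₀ r, DifferentiableAt ℂ f w ∧
      DifferentiableAt ℂ (deriv f) w := by
    intro w hw
    have : w ∈ Metric.ball s₀ (3 * δ) := Metric.ball_subset_ball (by linarith) (hball w hw)
    exact ⟨hf.differentiableAt (Metric.isOpen_ball.mem_nhds this),
      hfd.differentiableAt (Metric.isOpen_ball.mem_nhds this)⟩
  have hs0 : s₀ ∈ Metric.closedBall s₀ r := Metric.mem_closedBall_self (norm_nonneg _)
  have hzr : z ∈ Metric.closedBall s₀ r := by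
    rw [Metric.mem_closedBall, dist_eq_norm]
  have hg : ∀ w ∈ Metric.closedBall s₀ r, ‖deriv f w - deriv f s₀‖ ≤ M / δ / δ * r := by
    intro w hw
    refine ((convex_closedBall s₀ r).norm_image_sub_le_of_norm_deriv_le
      (fun y hy => (hdat y hy).2) (fun y hy => hd2 y (hball y hy)) hs0 hw).trans ?_
    rw [Metric.mem_closedBall, dist_eq_norm] at hw
    have : 0 ≤ M / δ / δ := (norm_nonneg _).trans (hd2 s₀ (hball s₀ hs0))
    gcongr
  have := (convex_closedBall s₀ r).norm_image_sub_le_of_norm_hasDerivWithin_le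
    (f := fun w => f w - (w - s₀) * deriv f s₀) (f' := fun w => deriv f w - deriv f s₀)
    (C := M / δ / δ * r) (fun w hw => by
      have h1 := (hdat w hw).1.hasDerivAt
      have h2 : HasDerivAt (fun w => (w - s₀) * deriv f s₀) (1 * deriv f s₀) w :=
        ((hasDerivAt_id w).sub_const s₀).mul_const _
      rw [one_mul] at h2
      exact (h1.sub h2).hasDerivWithinAt) hg hs0 hzr
  simp only [sub_self, zero_mul, sub_zero] at this
  calc ‖f z - f s₀ - (z - s₀) * deriv f s₀‖ = ‖f z - (z - s₀) * deriv f s₀ - f s₀‖ := by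
        congr 1; ring
    _ ≤ _ := this
    _ = _ := by rw [hr]; ring

section Coefficient

variable {L H c d₁ : ℝ} {bhat : ℝ × ℝ → ℂ → ℂ}

/-- `L^∞(S)`. -/
abbrev LinfS (L : ℝ) : Type := Lp ℂ ⊤ (volume.restrict (strip L))

open Classical in
/-- The coefficient `b̂(·, s)` as an element of `L^∞(S)`. -/
def coeffLp (L : ℝ) (bhat : ℝ × ℝ → ℂ → ℂ) (s : ℂ) : LinfS L :=
  if h : MemLp (fun x => bhat x s) ⊤ (volume.restrict (strip L)) then h.toLp else 0

lemma linf_norm_le {f : LinfS L} {C : ℝ} (hC : 0 ≤ C)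
    (h : ∀ᵐ x ∂(volume.restrict (strip L)), ‖f x‖ ≤ C) : ‖f‖ ≤ C := by
  rw [Lp.norm_def, eLpNorm_exponent_top]
  exact ENNReal.toReal_le_of_le_ofReal hC (eLpNormEssSup_le_of_ae_bound h)

lemma CoeffAssumption.memLp (hb : CoeffAssumption L H d₁ bhat) {s : ℂ} (hs : 0 < s.re) :
    MemLp (fun x => bhat x s) ⊤ (volume.restrict (strip L)) := by
  obtain ⟨M, hM⟩ := hb.bounded (s.re / 2) (by positivity)
  refine memLp_top_of_bound (hb.measurable s hs) M ?_
  filter_upwards [hM] with x hx using hx s (by linarith)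

lemma CoeffAssumption.coeFn_coeffLp (hb : CoeffAssumption L H d₁ bhat) {s : ℂ} (hs : 0 < s.re) :
    coeffLp L bhat s =ᵐ[volume.restrict (strip L)] fun x => bhat x s := by
  rw [coeffLp, dif_pos (hb.memLp hs)]
  exact (hb.memLp hs).coeFn_toLp

lemma CoeffAssumption.exists_norm_coeffLp_le (hb : CoeffAssumption L H d₁ bhat) {σ : ℝ}
    (hσ : 0 < σ) : ∃ M : ℝ, 0 ≤ M ∧ ∀ s : ℂ, σ < s.re → ‖coeffLp L bhat s‖ ≤ M := by
  obtain ⟨M, hM⟩ := hb.bounded σ hσ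
  refine ⟨max M 0, le_max_right _ _, fun s hs => linf_norm_le (le_max_right _ _) ?_⟩
  filter_upwards [hM, hb.coeFn_coeffLp (hσ.trans hs)] with x hx h2
  rw [h2]
  exact (hx s hs).trans (le_max_left _ _)

/-- The bound on `b̂` is uniform in space, so Cauchy's estimates give a Taylor remainder `O(|z -
s₀|²)` uniform in `x`. This upgrades pointwise analyticity to differentiability in the norm of
`L^∞(S)`. -/
lemma CoeffAssumption.differentiableOn_coeffLp (hb : CoeffAssumption L H d₁ bhat) :
    DifferentiableOn ℂ (coeffLp L bhat) halfPlane := by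
  intro s₀ hs₀
  have hs0 : 0 < s₀.re := hs₀
  set δ := s₀.re / 4 with hδ
  have hδ0 : 0 < δ := by positivity
  obtain ⟨M, hM⟩ := hb.bounded δ hδ0
  set K := max M 0
  have hball : ∀ z ∈ Metric.ball s₀ (3 * δ), δ < z.re := by
    intro z hz
    rw [Metric.mem_ball, dist_eq_norm] at hz
    have := (abs_lt.1 ((Complex.abs_re_le_norm _).trans_lt hz)).1
    rw [Complex.sub_re] at this
    linarith
  have hgood : ∀ᵐ x ∂(volume.restrict (strip L)), DifferentiableOn ℂ (bhat x) halfPlane ∧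
      ‖deriv (bhat x) s₀‖ ≤ K / δ ∧ ∀ z ∈ Metric.ball s₀ δ,
      ‖bhat x z - bhat x s₀ - (z - s₀) * deriv (bhat x) s₀‖ ≤ K / δ / δ * ‖z - s₀‖ ^ 2 := by
    filter_upwards [hM, hb.analytic] with x h1 h2
    refine ⟨h2.differentiableOn, norm_sub_sub_deriv_le hδ0 (h2.differentiableOn.mono ?_) ?_⟩
    · exact fun z hz => hδ0.trans (hball z hz)
    · exact fun z hz => (h1 z (hball z hz)).trans (le_max_left _ _)
  -- Measurability in `x` is assumed for `b̂` only; the derivative inherits it as a limit of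
  -- difference quotients along a sequence.
  have hmeas : AEStronglyMeasurable (fun x => deriv (bhat x) s₀) (volume.restrict (strip L)) := by
    let h : ℕ → ℂ := fun n => s₀ + ((1 / ((n : ℝ) + 1) : ℝ) : ℂ)
    have hh : Tendsto h atTop (𝓝[≠] s₀) := by
      refine tendsto_nhdsWithin_iff.2 ⟨?_, Eventually.of_forall fun n => ?_⟩
      · have := (Complex.continuous_ofReal.tendsto 0).comp
          (tendsto_one_div_add_atTop_nhds_zero_nat (𝕜 := ℝ))
        simpa [h] using this.const_add s₀
      · have : ((1 / ((n : ℝ) + 1) : ℝ) : ℂ) ≠ 0 := by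
          rw [Complex.ofReal_ne_zero]; positivity
        simpa [h] using this
    refine aestronglyMeasurable_of_tendsto_ae atTop
      (f := fun n x => slope (bhat x) s₀ (h n)) (fun n => ?_) ?_
    · have h1 : 0 < (h n).re := by
        simp only [h, Complex.add_re, Complex.ofReal_re]; positivity
      simp only [slope_def_module]
      exact ((hb.measurable _ h1).sub (hb.measurable _ hs0)).const_smul ((h n - s₀)⁻¹)
    · filter_upwards [hgood] with x hx
      exact (hasDerivAt_iff_tendsto_slope.1
        (hx.1.differentiableAt (isOpen_halfPlane.mem_nhds hs₀)).hasDerivAt).comp hh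
  have hD : MemLp (fun x => deriv (bhat x) s₀) ⊤ (volume.restrict (strip L)) := by
    refine memLp_top_of_bound hmeas (K / δ) ?_
    filter_upwards [hgood] with x hx using hx.2.1
  have hder : HasDerivAt (coeffLp L bhat) (hD.toLp _) s₀ := by
    rw [hasDerivAt_iff_isLittleO]
    refine Asymptotics.IsBigO.trans_isLittleO ?_
      (Asymptotics.isLittleO_pow_sub_sub s₀ (one_lt_two))
    refine Asymptotics.IsBigO.of_bound (K / δ / δ) ?_
    filter_upwards [Metric.ball_mem_nhds s₀ hδ0] with z hz
    have hz0 : 0 < z.re := hδ0.trans (hball z (Metric.ball_subset_ball (by linarith) hz))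
    simp only [norm_pow, norm_norm]
    refine linf_norm_le (by positivity) ?_
    filter_upwards [hgood, hb.coeFn_coeffLp hz0, hb.coeFn_coeffLp hs0, hD.coeFn_toLp,
      Lp.coeFn_sub (coeffLp L bhat z - coeffLp L bhat s₀) ((z - s₀) • hD.toLp _),
      Lp.coeFn_sub (coeffLp L bhat z) (coeffLp L bhat s₀),
      Lp.coeFn_smul (z - s₀) (hD.toLp _)] with x h1 h2 h3 h4 h5 h6 h7
    rw [h5, Pi.sub_apply, h6, Pi.sub_apply, h7, Pi.smul_apply, h2, h3, h4, smul_eq_mul]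
    exact h1.2.2 z hz
  exact hder.differentiableAt.differentiableWithinAt

/-- Multiplication of `L²(S)` functions by `L^∞(S)` functions. -/
def mulL (L : ℝ) : LinfS L →L[ℂ] L2S L →L[ℂ] L2S L :=
  (ContinuousLinearMap.mul ℂ ℂ).holderL (volume.restrict (strip L)) ⊤ 2 2

lemma coeFn_mulL (f : LinfS L) (g : L2S L) :
    mulL L f g =ᵐ[volume.restrict (strip L)] fun x => f x * g x := by
  have := (ContinuousLinearMap.mul ℂ ℂ).coeFn_holder (r := 2) f g
  simpa [mulL] using this

/-! ### The operator pencil -/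

/-- The embedding `H¹ₚ(S) → L²(S)`. -/
def embL (L : ℝ) : H1p L →L[ℂ] L2S L :=
  (PiLp.proj 2 (fun _ : Fin 3 => L2S L) 0 : _ →L[ℂ] _) ∘L (H1p L).subtypeL

/-- `∂ₓ : H¹ₚ(S) → L²(S)`. -/
def gradX (L : ℝ) : H1p L →L[ℂ] L2S L :=
  (PiLp.proj 2 (fun _ : Fin 3 => L2S L) 1 : _ →L[ℂ] _) ∘L (H1p L).subtypeL

/-- `∂_z : H¹ₚ(S) → L²(S)`. -/
def gradZ (L : ℝ) : H1p L →L[ℂ] L2S L :=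
  (PiLp.proj 2 (fun _ : Fin 3 => L2S L) 2 : _ →L[ℂ] _) ∘L (H1p L).subtypeL

@[simp] lemma embL_apply (u : H1p L) : embL L u = H1p.fn u := rfl
@[simp] lemma gradX_apply (u : H1p L) : gradX L u = H1p.gx u := rfl
@[simp] lemma gradZ_apply (u : H1p L) : gradZ L u = H1p.gz u := rfl

lemma norm_sq_H1p (u : H1p L) : ‖u‖ ^ 2 = ‖H1p.fn u‖ ^ 2 + ‖H1p.gx u‖ ^ 2 + ‖H1p.gz u‖ ^ 2 := by
  rw [← Submodule.norm_coe, PiLp.norm_sq_eq_of_L2, Fin.sum_univ_three]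
  rfl

open ContinuousLinearMap (adjoint)

section Pencil

variable {V X : Type*} [NormedAddCommGroup V] [InnerProductSpace ℂ V] [CompleteSpace V]
  [NormedAddCommGroup X] [InnerProductSpace ℂ X] [CompleteSpace X]

/-- The operator of the form `α (M ι u, ι v) + (D u, D v) + (G u, G v) + β (D u, ι v)`. -/
def pencil (ι D G : V →L[ℂ] X) (M : X →L[ℂ] X) (α β : ℂ) : V →L[ℂ] V :=
  α • (adjoint ι ∘L (M ∘L ι)) + (adjoint D ∘L D + adjoint G ∘L G) + β • (adjoint ι ∘L D)

lemma inner_pencil (ι D G : V →L[ℂ] X) (M : X →L[ℂ] X) (α β : ℂ) (v u : V) :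
    inner ℂ v (pencil ι D G M α β u) = α * inner ℂ (ι v) (M (ι u))
      + (inner ℂ (D v) (D u) + inner ℂ (G v) (G u)) + β * inner ℂ (ι v) (D u) := by
  simp only [pencil, add_apply, smul_apply, ContinuousLinearMap.comp_apply, inner_add_right,
    inner_smul_right, ContinuousLinearMap.adjoint_inner_right]

lemma exists_norm_pencil_le (ι D G : V →L[ℂ] X) : ∃ p q r : ℝ, 0 ≤ p ∧ 0 ≤ q ∧ 0 ≤ r ∧
    ∀ (M : X →L[ℂ] X) (α β : ℂ), ‖pencil ι D G M α β‖ ≤ p * ‖α‖ * ‖M‖ + q + r * ‖β‖ := by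
  refine ⟨‖adjoint ι‖ * ‖ι‖, ‖adjoint D ∘L D + adjoint G ∘L G‖, ‖adjoint ι ∘L D‖, by positivity,
    norm_nonneg _, norm_nonneg _, fun M α β => ?_⟩
  refine (norm_add_le _ _).trans (add_le_add ((norm_add_le _ _).trans (add_le_add ?_ le_rfl)) ?_)
  · rw [norm_smul]
    calc _ ≤ ‖α‖ * (‖adjoint ι‖ * (‖M‖ * ‖ι‖)) := by
          gcongr
          refine (ContinuousLinearMap.opNorm_comp_le _ _).trans ?_
          gcongr
          exact ContinuousLinearMap.opNorm_comp_le _ _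
      _ = _ := by ring
  · rw [norm_smul, mul_comm]

lemma differentiableOn_pencil (ι D G : V →L[ℂ] X) {M : ℂ → X →L[ℂ] X} {α β : ℂ → ℂ} {U : Set ℂ}
    (hM : DifferentiableOn ℂ M U) (hα : DifferentiableOn ℂ α U) (hβ : DifferentiableOn ℂ β U) :
    DifferentiableOn ℂ (fun s => pencil ι D G (M s) (α s) (β s)) U := by
  have h2 : DifferentiableOn ℂ (fun s => M s ∘L ι) U := hM.clm_comp (differentiableOn_const _)
  have h3 : DifferentiableOn ℂ (fun s => adjoint ι ∘L (M s ∘L ι)) U :=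
    (differentiableOn_const _).clm_comp h2
  exact ((hα.smul h3).add_const _).add (hβ.smul_const _)

lemma differentiableOn_inverse_comp {V X : Type*} [NormedAddCommGroup V] [NormedSpace ℂ V]
    [CompleteSpace V] [NormedAddCommGroup X] [NormedSpace ℂ X] {A : ℂ → V →L[ℂ] V} {U : Set ℂ} (hA : DifferentiableOn ℂ A U)
    (hu : ∀ s ∈ U, IsUnit (A s)) (B : X →L[ℂ] V) :
    DifferentiableOn ℂ (fun s => (Ring.inverse (A s)) ∘L B) U := by
  intro s hs
  have h1 : DifferentiableWithinAt ℂ (Ring.inverse ∘ A) U s :=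
    (differentiableAt_inverse (𝕜 := ℂ) (hu s hs)).comp_differentiableWithinAt s (hA s hs)
  exact DifferentiableWithinAt.clm_comp h1 (differentiableWithinAt_const _)

lemma norm_le_of_le_inner {V : Type*} [NormedAddCommGroup V] [InnerProductSpace ℂ V] {A : V →L[ℂ] V} {k r : ℝ} (hk : 0 < k) (u : V) (hr : 0 ≤ r)
    (h : k * ‖u‖ ^ 2 ≤ r * ‖inner ℂ u (A u)‖) : ‖u‖ ≤ k⁻¹ * r * ‖A u‖ := by
  rcases (norm_nonneg u).eq_or_lt with hu | hu
  · rw [← hu]; positivity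
  have h4 : (k * ‖u‖) * ‖u‖ ≤ (r * ‖A u‖) * ‖u‖ := by
    calc (k * ‖u‖) * ‖u‖ = k * ‖u‖ ^ 2 := by ring
      _ ≤ _ := h
      _ ≤ r * (‖u‖ * ‖A u‖) := by gcongr; exact norm_inner_le_norm _ _
      _ = _ := by ring
  have h5 := le_of_mul_le_mul_right h4 hu
  rw [mul_assoc, inv_mul_eq_div, le_div_iff₀ hk]
  linarith

end Pencil

/-- The operator of the sesquilinear form
`s² c⁻² ((b̂ - d₁²) u, ξ) + (∇u, ∇ξ) + 2 d₁ s c⁻¹ (∂ₓu, ξ)` on `H¹ₚ(S)`. -/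
def opA (L c d₁ : ℝ) (bhat : ℝ × ℝ → ℂ → ℂ) (s : ℂ) : H1p L →L[ℂ] H1p L :=
  pencil (embL L) (gradX L) (gradZ L)
    (mulL L (coeffLp L bhat s) - ((d₁ : ℂ) ^ 2) • ContinuousLinearMap.id ℂ (L2S L))
    (((c : ℂ) ^ 2)⁻¹ * s ^ 2) (2 * ((d₁ : ℂ) / c) * s)

lemma inner_opA (s : ℂ) (ξ u : H1p L) : inner ℂ ξ (opA L c d₁ bhat s u)
    = ((c : ℂ) ^ 2)⁻¹ * s ^ 2 * (inner ℂ (H1p.fn ξ) (mulL L (coeffLp L bhat s) (H1p.fn u))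
        - (d₁ : ℂ) ^ 2 * inner ℂ (H1p.fn ξ) (H1p.fn u))
      + (inner ℂ (H1p.gx ξ) (H1p.gx u) + inner ℂ (H1p.gz ξ) (H1p.gz u))
      + 2 * ((d₁ : ℂ) / c) * s * inner ℂ (H1p.fn ξ) (H1p.gx u) := by
  rw [opA, inner_pencil]
  simp only [embL_apply, gradX_apply, gradZ_apply, sub_apply, smul_apply,
    ContinuousLinearMap.id_apply, inner_sub_right, inner_smul_right]

/-! ### Coercivity, invertibility and growth of the pencil. -/

lemma CoeffAssumption.inner_mul_eq (hb : CoeffAssumption L H d₁ bhat) {s : ℂ} (hs : 0 < s.re)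
    (ξ u : L2S L) : inner ℂ ξ (mulL L (coeffLp L bhat s) u)
      = ∫ x in strip L, bhat x s * u x * conj (ξ x) := by
  rw [L2.inner_def]
  refine integral_congr_ae ?_
  filter_upwards [coeFn_mulL (coeffLp L bhat s) u, hb.coeFn_coeffLp hs] with x h1 h2
  rw [h1, h2]
  simp

/-- The pointwise positivity of `s (b̂ - d₁²)`, integrated against `|u|²`. -/
lemma CoeffAssumption.exists_le_re (hb : CoeffAssumption L H d₁ bhat) :
    ∃ γ : ℝ, 0 < γ ∧ ∀ (s : ℂ), 0 < s.re → ∀ u : L2S L, s.re * γ * ‖u‖ ^ 2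
      ≤ (s * (inner ℂ u (mulL L (coeffLp L bhat s) u) - (d₁ : ℂ) ^ 2 * inner ℂ u u)).re := by
  obtain ⟨γ, hγ, hpos⟩ := hb.positive
  refine ⟨γ, hγ, fun s hs u => ?_⟩
  have hi : ∀ v w : L2S L, Integrable (fun x => w x * conj (v x)) (volume.restrict (strip L)) := by
    intro v w
    refine (L2.integrable_inner (𝕜 := ℂ) v w).congr (ae_of_all _ fun x => ?_)
    simp
  have h1 : s * (inner ℂ u (mulL L (coeffLp L bhat s) u) - (d₁ : ℂ) ^ 2 * inner ℂ u u)
      = ∫ x in strip L, s * (mulL L (coeffLp L bhat s) u x * conj (u x)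
        - (d₁ : ℂ) ^ 2 * (u x * conj (u x))) := by
    rw [integral_const_mul, integral_sub (hi _ _) ((hi _ _).const_mul _), integral_const_mul,
      L2.inner_def, L2.inner_def]
    simp only [RCLike.inner_apply']
    simp only [mul_comm]
  have hint : Integrable (fun x => s * (mulL L (coeffLp L bhat s) u x * conj (u x)
        - (d₁ : ℂ) ^ 2 * (u x * conj (u x)))) (volume.restrict (strip L)) :=
    ((hi _ _).sub ((hi _ _).const_mul _)).const_mul _
  have hn : ‖u‖ ^ 2 = ∫ x in strip L, ‖u x‖ ^ 2 := by
    have h2 := L2.inner_def (𝕜 := ℂ) u u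
    rw [inner_self_eq_norm_sq_to_K] at h2
    have h3 : (∫ x in strip L, (inner ℂ (u x) (u x) : ℂ)) = ((∫ x in strip L, ‖u x‖ ^ 2 : ℝ) : ℂ) := by
      rw [← integral_complex_ofReal]
      refine integral_congr_ae (ae_of_all _ fun x => ?_)
      simp only [inner_self_eq_norm_sq_to_K]
      norm_cast
    rw [h3] at h2
    refine Complex.ofReal_injective (Eq.trans ?_ h2)
    push_cast; rfl
  have hsq : Integrable (fun x => ‖u x‖ ^ 2) (volume.restrict (strip L)) :=
    (Lp.memLp u).norm.integrable_sq
  have hre := Complex.reCLM.integral_comp_comm hint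
  rw [h1, hn, ← integral_const_mul]
  refine le_trans ?_ hre.le
  refine integral_mono_ae (hsq.const_mul _) (Complex.reCLM.integrable_comp hint) ?_
  filter_upwards [hpos, coeFn_mulL (coeffLp L bhat s) u, hb.coeFn_coeffLp hs] with x a1 a2 a3
  have a4 := (a1 s hs).le
  rw [Complex.reCLM_apply, a2, a3]
  have : s * (bhat x s * u x * conj (u x) - (d₁ : ℂ) ^ 2 * (u x * conj (u x)))
      = (s * (bhat x s - (d₁ : ℂ) ^ 2)) * ((‖u x‖ ^ 2 : ℝ) : ℂ) := by
    rw [mul_assoc, Complex.mul_conj, Complex.normSq_eq_norm_sq]; ring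
  rw [this, Complex.re_mul_ofReal]
  gcongr

/-- Coercivity of the form after multiplication by `conj s`. -/
lemma CoeffAssumption.exists_coercive (hb : CoeffAssumption L H d₁ bhat) (hL : 0 < L)
    (hc : 0 < c) : ∃ γ : ℝ, 0 < γ ∧ ∀ (s : ℂ), 0 < s.re → ∀ u : H1p L,
      s.re * (γ * (‖s‖ * ‖H1p.fn u‖) ^ 2 + (‖H1p.gx u‖ ^ 2 + ‖H1p.gz u‖ ^ 2))
        ≤ (conj s * inner ℂ u (opA L c d₁ bhat s u)).re := by
  obtain ⟨γ, hγ, h⟩ := hb.exists_le_re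
  refine ⟨γ / c ^ 2, by positivity, fun s hs u => ?_⟩
  have h1 := h s hs (H1p.fn u)
  -- Integration by parts without boundary terms makes `(∂ₓu, u)` purely imaginary. After
  -- multiplication by `conj s` its factor is real, so the mixed term drops out of the real part.
  have hskew : (inner ℂ (H1p.fn u) (H1p.gx u) : ℂ).re = 0 := by
    have h2 := inner_add_inner_of_periodic hL u.2.2 u.2.2
    have h3 : (inner ℂ (H1p.gx u) (H1p.fn u) : ℂ) = conj (inner ℂ (H1p.fn u) (H1p.gx u) : ℂ) :=
      (inner_conj_symm _ _).symm
    have h4 : (inner ℂ (H1p.fn u) (H1p.gx u) : ℂ) + conj (inner ℂ (H1p.fn u) (H1p.gx u) : ℂ) = 0 := by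
      rw [← h3]; exact h2
    rw [Complex.add_conj] at h4
    have : 2 * (inner ℂ (H1p.fn u) (H1p.gx u) : ℂ).re = 0 := by exact_mod_cast h4
    linarith
  rw [inner_opA]
  set I := (inner ℂ (H1p.fn u) (mulL L (coeffLp L bhat s) (H1p.fn u)) - (d₁ : ℂ) ^ 2 * inner ℂ (H1p.fn u) (H1p.fn u))
  set J := (inner ℂ (H1p.fn u) (H1p.gx u) : ℂ)
  have hss : conj s * s = ((‖s‖ ^ 2 : ℝ) : ℂ) := by
    rw [mul_comm, Complex.mul_conj, Complex.normSq_eq_norm_sq]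
  -- Since `conj s * s² = |s|² s`, the coefficient appears as `s (b̂ - d₁²)`, the quantity with
  -- positive real part.
  have e : conj s * (((c : ℂ) ^ 2)⁻¹ * s ^ 2 * I + (inner ℂ (H1p.gx u) (H1p.gx u) + inner ℂ (H1p.gz u) (H1p.gz u))
      + 2 * ((d₁ : ℂ) / c) * s * J)
      = (((c ^ 2)⁻¹ * ‖s‖ ^ 2 : ℝ) : ℂ) * (s * I)
        + ((‖H1p.gx u‖ ^ 2 + ‖H1p.gz u‖ ^ 2 : ℝ) : ℂ) * conj s
        + ((2 * (d₁ / c) * ‖s‖ ^ 2 : ℝ) : ℂ) * J := by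
    have i1 : (inner ℂ (H1p.gx u) (H1p.gx u) : ℂ) = ((‖H1p.gx u‖ ^ 2 : ℝ) : ℂ) := by
      rw [inner_self_eq_norm_sq_to_K]; norm_cast
    have i2 : (inner ℂ (H1p.gz u) (H1p.gz u) : ℂ) = ((‖H1p.gz u‖ ^ 2 : ℝ) : ℂ) := by
      rw [inner_self_eq_norm_sq_to_K]; norm_cast
    rw [i1, i2]
    push_cast at hss ⊢
    linear_combination (((c : ℂ) ^ 2)⁻¹ * s * I + 2 * ((d₁ : ℂ) / c) * J) * hss
  rw [e, Complex.add_re, Complex.add_re, Complex.re_ofReal_mul, Complex.re_ofReal_mul,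
    Complex.re_ofReal_mul, hskew, Complex.conj_re]
  have h5 := mul_le_mul_of_nonneg_left h1 (by positivity : 0 ≤ (c ^ 2)⁻¹ * ‖s‖ ^ 2)
  calc _ = (c ^ 2)⁻¹ * ‖s‖ ^ 2 * (s.re * γ * ‖H1p.fn u‖ ^ 2)
        + (‖H1p.gx u‖ ^ 2 + ‖H1p.gz u‖ ^ 2) * s.re := by ring
    _ ≤ _ := by linarith

/-- The form is bounded below. -/
lemma CoeffAssumption.exists_norm_le_opA (hb : CoeffAssumption L H d₁ bhat) (hL : 0 < L)
    (hc : 0 < c) : ∃ γ : ℝ, 0 < γ ∧ ∀ (s : ℂ), 0 < s.re → ∀ u : H1p L,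
      s.re * min (γ * s.re ^ 2) 1 * ‖u‖ ^ 2 ≤ ‖s‖ * ‖(inner ℂ u (opA L c d₁ bhat s u) : ℂ)‖ := by
  obtain ⟨γ, hγ, h⟩ := hb.exists_coercive hL hc
  refine ⟨γ, hγ, fun s hs u => ?_⟩
  have h1 := (h s hs u).trans (Complex.re_le_norm _)
  rw [norm_mul, RCLike.norm_conj] at h1
  refine le_trans ?_ h1
  rw [norm_sq_H1p, mul_assoc]
  refine mul_le_mul_of_nonneg_left ?_ hs.le
  have h2 : s.re ≤ ‖s‖ := Complex.re_le_norm s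
  have h3 : min (γ * s.re ^ 2) 1 ≤ γ * ‖s‖ ^ 2 :=
    (min_le_left _ _).trans (by gcongr)
  have h4 : min (γ * s.re ^ 2) 1 ≤ 1 := min_le_right _ _
  nlinarith [mul_le_mul_of_nonneg_right h3 (sq_nonneg ‖H1p.fn u‖),
    mul_le_mul_of_nonneg_right h4 (sq_nonneg ‖H1p.gx u‖),
    mul_le_mul_of_nonneg_right h4 (sq_nonneg ‖H1p.gz u‖)]

/-- Lax–Milgram for fixed `s`; the constant may degenerate as `s` varies. -/
lemma CoeffAssumption.isUnit_opA (hb : CoeffAssumption L H d₁ bhat) (hL : 0 < L) (hc : 0 < c)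
    {s : ℂ} (hs : 0 < s.re) : IsUnit (opA L c d₁ bhat s) := by
  obtain ⟨γ, hγ, h⟩ := hb.exists_norm_le_opA hL hc
  have hs0 : 0 < ‖s‖ := hs.trans_le (Complex.re_le_norm s)
  have hk : 0 < s.re * min (γ * s.re ^ 2) 1 / ‖s‖ := by
    have : 0 < min (γ * s.re ^ 2) 1 := lt_min (by positivity) one_pos
    positivity
  refine ContinuousLinearMap.isUnit_of_forall_le_norm_inner_map _
    (c := ⟨s.re * min (γ * s.re ^ 2) 1 / ‖s‖, hk.le⟩) hk fun u => ?_
  rw [norm_inner_symm]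
  have h1 := h s hs u
  change ‖u‖ ^ 2 * (s.re * min (γ * s.re ^ 2) 1 / ‖s‖) ≤ _
  rw [mul_div_assoc', div_le_iff₀ hs0]
  linarith

/-- A lower bound for the operator on `Re s ≥ 1`. -/
lemma CoeffAssumption.exists_norm_le_norm_opA (hb : CoeffAssumption L H d₁ bhat) (hL : 0 < L)
    (hc : 0 < c) : ∃ C : ℝ, 0 ≤ C ∧ ∀ (s : ℂ), 1 ≤ s.re → ∀ u : H1p L,
      ‖u‖ ≤ C * ‖s‖ * ‖opA L c d₁ bhat s u‖ := by
  obtain ⟨γ, hγ, h⟩ := hb.exists_norm_le_opA hL hc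
  have hm : 0 < min γ 1 := lt_min hγ one_pos
  refine ⟨(min γ 1)⁻¹, by positivity, fun s hs u => ?_⟩
  have h1 := h s (by linarith) u
  have h2 : min γ 1 ≤ s.re * min (γ * s.re ^ 2) 1 := by
    have h3 : min γ 1 ≤ min (γ * s.re ^ 2) 1 := by
      refine min_le_min_right _ ?_
      nlinarith [mul_le_mul hs hs (by norm_num) (by linarith)]
    nlinarith
  refine norm_le_of_le_inner hm u (norm_nonneg s) (le_trans ?_ h1)
  gcongr

/-- Growth of the pencil. -/
lemma CoeffAssumption.exists_opA_le (hb : CoeffAssumption L H d₁ bhat) {σ : ℝ} (hσ : 0 < σ) :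
    ∃ K : ℝ, 0 ≤ K ∧ ∀ (s : ℂ), σ < s.re → ‖opA L c d₁ bhat s‖ ≤ K * ‖s‖ ^ 2 := by
  obtain ⟨M, hM0, hM⟩ := hb.exists_norm_coeffLp_le hσ
  obtain ⟨p, q, r, hp, hq, hr, hpen⟩ := exists_norm_pencil_le (embL L) (gradX L) (gradZ L)
  obtain ⟨N, hN, hNM⟩ : ∃ N : ℝ, 0 ≤ N ∧ ∀ s : ℂ, σ < s.re → ‖mulL L (coeffLp L bhat s)
      - ((d₁ : ℂ) ^ 2) • ContinuousLinearMap.id ℂ (L2S L)‖ ≤ N := by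
    refine ⟨‖mulL L‖ * M + ‖((d₁ : ℂ) ^ 2) • ContinuousLinearMap.id ℂ (L2S L)‖, by positivity,
      fun s hs => (norm_sub_le _ _).trans (add_le_add ?_ le_rfl)⟩
    exact ((mulL L).le_opNorm _).trans (by gcongr; exact hM s hs)
  obtain ⟨a, ha, ha'⟩ : ∃ a : ℝ, 0 ≤ a ∧ a = p * ‖((c : ℂ) ^ 2)⁻¹‖ * N := ⟨_, by positivity, rfl⟩
  obtain ⟨e, he, he'⟩ : ∃ e : ℝ, 0 ≤ e ∧ e = r * ‖2 * ((d₁ : ℂ) / c)‖ := ⟨_, by positivity, rfl⟩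
  refine ⟨a + q * (σ ^ 2)⁻¹ + e * σ⁻¹, by positivity, fun s hs => ?_⟩
  have hsn : σ ≤ ‖s‖ := hs.le.trans (Complex.re_le_norm s)
  have h2 : ‖opA L c d₁ bhat s‖ ≤ a * ‖s‖ ^ 2 + q + e * ‖s‖ := by
    refine (hpen _ _ _).trans (add_le_add (add_le_add ?_ le_rfl) ?_)
    · rw [norm_mul, norm_pow]
      calc _ ≤ p * (‖((c : ℂ) ^ 2)⁻¹‖ * ‖s‖ ^ 2) * N := by gcongr; exact hNM s hs
        _ = _ := by rw [ha']; ring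
    · rw [norm_mul _ s, he', mul_assoc]
  refine h2.trans ?_
  -- Away from the imaginary axis the terms of order zero and one in `s` are absorbed into `|s|²`.
  have h3 : 1 ≤ σ⁻¹ * ‖s‖ := by
    rw [inv_mul_eq_div, le_div_iff₀ hσ]; linarith
  have h4 : q * 1 ≤ q * ((σ⁻¹ * ‖s‖) ^ 2) := by gcongr; exact one_le_pow₀ h3
  have h5 : e * ‖s‖ * 1 ≤ e * ‖s‖ * (σ⁻¹ * ‖s‖) := by gcongr
  rw [← inv_pow]
  nlinarith

lemma CoeffAssumption.differentiableOn_opA (hb : CoeffAssumption L H d₁ bhat) :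
    DifferentiableOn ℂ (opA L c d₁ bhat) halfPlane := by
  have h1 : DifferentiableOn ℂ (fun s => mulL L (coeffLp L bhat s)
      - ((d₁ : ℂ) ^ 2) • ContinuousLinearMap.id ℂ (L2S L)) halfPlane :=
    ((mulL L).differentiable.comp_differentiableOn hb.differentiableOn_coeffLp).sub_const _
  exact differentiableOn_pencil _ _ _ h1 (by fun_prop) (by fun_prop)

/-- The solution operator `L²(S) → H¹ₚ(S)` at frequency `s`. -/
def resolv (L c d₁ : ℝ) (bhat : ℝ × ℝ → ℂ → ℂ) (s : ℂ) : L2S L →L[ℂ] H1p L :=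
  (Ring.inverse (opA L c d₁ bhat s)) ∘L adjoint (embL L)

lemma CoeffAssumption.opA_resolv (hb : CoeffAssumption L H d₁ bhat) (hL : 0 < L) (hc : 0 < c)
    {s : ℂ} (hs : 0 < s.re) (f : L2S L) :
    opA L c d₁ bhat s (resolv L c d₁ bhat s f) = adjoint (embL L) f := by
  have := Ring.mul_inverse_cancel _ (hb.isUnit_opA hL hc hs)
  exact congrArg (fun T : H1p L →L[ℂ] H1p L => T (adjoint (embL L) f)) this

lemma CoeffAssumption.differentiableOn_resolv (hb : CoeffAssumption L H d₁ bhat) (hL : 0 < L)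
    (hc : 0 < c) : DifferentiableOn ℂ (resolv L c d₁ bhat) halfPlane :=
  differentiableOn_inverse_comp hb.differentiableOn_opA (fun _ hs => hb.isUnit_opA hL hc hs) _

/-- The solution operators are bounded uniformly in right half planes. -/
lemma CoeffAssumption.exists_resolv_le (hb : CoeffAssumption L H d₁ bhat) (hL : 0 < L)
    (hc : 0 < c) {σ₀ : ℝ} (hσ₀ : 0 < σ₀) : ∃ C : NNReal, ∀ s : ℂ, σ₀ < s.re → ∀ f : L2S L,
      ‖resolv L c d₁ bhat s f‖ ≤ C * ‖f‖ := by
  obtain ⟨γ, hγ, h⟩ := hb.exists_coercive hL hc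
  set a := (σ₀ * γ)⁻¹ with ha
  set K := (a / σ₀) ^ 2 + a / σ₀ with hK
  have ha0 : 0 < a := by positivity
  have hK0 : 0 ≤ K := by positivity
  refine ⟨⟨Real.sqrt K, Real.sqrt_nonneg _⟩, fun s hs f => ?_⟩
  have hs0 : 0 < s.re := hσ₀.trans hs
  set u := resolv L c d₁ bhat s f with hu
  have h1 := h s hs0 u
  rw [hu, hb.opA_resolv hL hc hs0, ← hu, ContinuousLinearMap.adjoint_inner_right, embL_apply] at h1
  have hsn : σ₀ ≤ ‖s‖ := hs.le.trans (Complex.re_le_norm s)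
  -- The factor `conj s` costs `|s|` on the right, but there it meets `‖u‖_{L²}`. The product `X`
  -- appears squared on the left, so `X` and the gradient are bounded by `‖f‖` without any power of
  -- `|s|`.
  set X := ‖s‖ * ‖H1p.fn u‖ with hX
  have hX0 : 0 ≤ X := by positivity
  set Y := ‖H1p.gx u‖ ^ 2 + ‖H1p.gz u‖ ^ 2 with hY
  have hY0 : 0 ≤ Y := by positivity
  have h2 : s.re * (γ * X ^ 2 + Y) ≤ X * ‖f‖ := by
    refine h1.trans ((Complex.re_le_norm _).trans ?_)
    rw [norm_mul, RCLike.norm_conj, hX, mul_assoc]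
    gcongr
    exact norm_inner_le_norm _ _
  have h3 : σ₀ * (γ * X ^ 2 + Y) ≤ X * ‖f‖ := le_trans (by gcongr) h2
  have h4 : X ≤ a * ‖f‖ := by
    rcases hX0.eq_or_lt with h0 | h0
    · rw [← h0]; positivity
    · have : (σ₀ * γ * X) * X ≤ ‖f‖ * X := by nlinarith
      have := le_of_mul_le_mul_right this h0
      rw [ha, inv_mul_eq_div, le_div_iff₀ (by positivity)]
      linarith
  have h5 : Y ≤ a / σ₀ * ‖f‖ ^ 2 := by
    have : σ₀ * Y ≤ a * ‖f‖ ^ 2 := by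
      have e1 : 0 ≤ σ₀ * (γ * X ^ 2) := by positivity
      have e2 : X * ‖f‖ ≤ a * ‖f‖ * ‖f‖ := by gcongr
      nlinarith
    rw [div_mul_eq_mul_div, le_div_iff₀ hσ₀]
    linarith
  have h6 : ‖H1p.fn u‖ ≤ a / σ₀ * ‖f‖ := by
    rw [div_mul_eq_mul_div, le_div_iff₀ hσ₀]
    have : ‖H1p.fn u‖ * σ₀ ≤ X := by rw [hX, mul_comm]; gcongr
    linarith
  have h7 : ‖u‖ ^ 2 ≤ K * ‖f‖ ^ 2 := by
    rw [norm_sq_H1p, add_assoc, ← hY, hK, add_mul, ← mul_pow]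
    gcongr
  change ‖u‖ ≤ Real.sqrt K * ‖f‖
  rw [← Real.sqrt_sq (norm_nonneg f), ← Real.sqrt_mul hK0]
  exact Real.le_sqrt_of_sq_le h7

end Coefficient

/-! ### Pairings with test functions in the frequency domain -/

section Pairing

variable {E : Type*} [NormedAddCommGroup E] [NormedSpace ℂ E]

/-- Using `n + 2` derivatives of `φ` beats the growth `|s|ⁿ` and leaves the decay `|s|⁻²` that the
contour lemmas require. The exponent `a - b` compares the end of the support of `φ` with the decay
of `v`. -/
lemma lap_smul_bound {φ : ℝ → ℂ} (hφ : IsTest φ) {a : ℝ} (ha : tsupport φ ⊆ Iic a) (n : ℕ) {K b : ℝ}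
    (hK : 0 ≤ K) :
    ∃ C : ℝ, 0 ≤ C ∧ ∀ (s : ℂ) (v : E), 0 ≤ s.re → ‖v‖ ≤ K * ‖s‖ ^ n * Real.exp (-b * s.re) →
      ‖lap (-s) φ • v‖ * ‖s‖ ^ 2 ≤ C * Real.exp ((a - b) * s.re) := by
  obtain ⟨C, hC, h⟩ := exists_norm_lap_test_le hφ ha (n + 2)
  refine ⟨C * K, by positivity, fun s v hs hv => ?_⟩
  rw [norm_smul]
  calc ‖lap (-s) φ‖ * ‖v‖ * ‖s‖ ^ 2
      ≤ ‖lap (-s) φ‖ * (K * ‖s‖ ^ n * Real.exp (-b * s.re)) * ‖s‖ ^ 2 := by gcongr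
    _ = (‖lap (-s) φ‖ * ‖s‖ ^ (n + 2)) * K * Real.exp (-b * s.re) := by ring
    _ ≤ (C * Real.exp (a * s.re)) * K * Real.exp (-b * s.re) :=
        mul_le_mul_of_nonneg_right (mul_le_mul_of_nonneg_right (h s hs) hK) (Real.exp_pos _).le
    _ = C * K * (Real.exp (a * s.re) * Real.exp (-b * s.re)) := by ring
    _ = _ := by rw [← Real.exp_add]; congr 2; ring

lemma integrable_lap_smul {φ : ℝ → ℂ} (hφ : IsTest φ) {p : ℂ → E} (hp : ContinuousOn p halfPlane)
    {σ K : ℝ} (hσ : 0 < σ) (hK : 0 ≤ K) (n : ℕ) (hb : ∀ s : ℂ, s.re = σ → ‖p s‖ ≤ K * ‖s‖ ^ n) :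
    Integrable fun ξ : ℝ => lap (-vline σ ξ) φ • p (vline σ ξ) := by
  obtain ⟨a, ha⟩ := hφ.exists_tsupport_le
  obtain ⟨C, hC, h⟩ := lap_smul_bound (E := E) hφ ha n (b := 0) hK
  refine integrable_vline (h := fun s => lap (-s) φ • p s)
    (hφ.differentiable_lap_neg.continuous.continuousOn.smul hp) hσ
    (C := C * Real.exp ((a - 0) * σ)) fun s hs => ?_
  have := h s (p s) (by linarith) (by simpa using hb s hs)
  rwa [hs] at this

lemma integral_lap_smul_shift {φ : ℝ → ℂ} (hφ : IsTest φ) {p : ℂ → E}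
    (hp : DifferentiableOn ℂ p halfPlane) {σ₁ σ₂ K : ℝ} (h1 : 0 < σ₁) (h12 : σ₁ ≤ σ₂)
    (hK : 0 ≤ K) (n : ℕ) (hb : ∀ s : ℂ, σ₁ ≤ s.re → s.re ≤ σ₂ → ‖p s‖ ≤ K * ‖s‖ ^ n) :
    ∫ ξ : ℝ, lap (-vline σ₁ ξ) φ • p (vline σ₁ ξ)
      = ∫ ξ : ℝ, lap (-vline σ₂ ξ) φ • p (vline σ₂ ξ) := by
  obtain ⟨a, ha⟩ := hφ.exists_tsupport_le
  obtain ⟨C, hC, h⟩ := lap_smul_bound (E := E) hφ ha n (b := 0) hK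
  refine integral_vline_shift (h := fun s => lap (-s) φ • p s)
    (hφ.differentiable_lap_neg.differentiableOn.smul hp) h1 h12
    (C := C * Real.exp (|a| * σ₂)) fun s hs hs2 => ?_
  refine (h s (p s) (by linarith) (by simpa using hb s hs hs2)).trans ?_
  rw [sub_zero]
  have : a * s.re ≤ |a| * σ₂ :=
    (mul_le_mul_of_nonneg_right (le_abs_self a) (by linarith)).trans (by gcongr)
  gcongr

/-- Causality: a transform that decays like `e^{-a Re s}` vanishes against test functions with
support in `(-∞, a]`. -/
lemma integral_lap_smul_eq_zero {φ : ℝ → ℂ} (hφ : IsTest φ) {a : ℝ} (ha : tsupport φ ⊆ Iic a)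
    {p : ℂ → E} (hp : DifferentiableOn ℂ p halfPlane) {σ K : ℝ} (hσ : 0 < σ) (hK : 0 ≤ K) (n : ℕ)
    (hb : ∀ s : ℂ, σ ≤ s.re → ‖p s‖ ≤ K * ‖s‖ ^ n * Real.exp (-a * s.re)) :
    ∫ ξ : ℝ, lap (-vline σ ξ) φ • p (vline σ ξ) = 0 := by
  obtain ⟨C, hC, h⟩ := lap_smul_bound (E := E) hφ ha n (b := a) hK
  refine integral_vline_eq_zero (h := fun s => lap (-s) φ • p s)
    (hφ.differentiable_lap_neg.differentiableOn.smul hp) hσ (C := C) fun s hs => ?_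
  simpa using h s (p s) (by linarith) (hb s hs)

/-- Decay of the transform of a function with support in `[a, ∞)`. -/
lemma norm_lap_le_of_support {g : ℝ → E} {a σ : ℝ} (hg : WInt σ g)
    (h0 : ∀ᵐ t : ℝ, t < a → g t = 0) {s : ℂ} (hs : σ ≤ s.re) :
    ‖lap s g‖ ≤ Real.exp (-(s.re - σ) * a) * ∫ t : ℝ, Real.exp (-σ * t) * ‖g t‖ := by
  refine (norm_lap_le s).trans ?_
  rw [← integral_const_mul]
  refine integral_mono_of_nonneg (ae_of_all _ fun t => by positivity)
    (hg.norm_integrable.const_mul _) ?_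
  filter_upwards [h0] with t ht
  rcases lt_or_ge t a with hta | hta
  · simp [ht hta]
  · rw [← mul_assoc, ← Real.exp_add]
    refine mul_le_mul_of_nonneg_right (Real.exp_le_exp.2 ?_) (norm_nonneg _)
    nlinarith

/-! ### Square integrable functions with support in `[0, R]` -/

/-- `g ∈ L²(ℝ, E)` vanishes outside `[0, R]`. -/
structure CompL2 {E : Type*} [NormedAddCommGroup E] (R : ℝ) (g : ℝ → E) : Prop where
  memLp : MemLp g 2 volume
  zero : ∀ᵐ t : ℝ, t ∉ Icc 0 R → g t = 0

lemma CompL2.zero_neg {E : Type*} [NormedAddCommGroup E] {R : ℝ} {g : ℝ → E}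
    (h : CompL2 R g) : ∀ᵐ t : ℝ, t < 0 → g t = 0 := by
  filter_upwards [h.zero] with t ht h0 using ht fun hm => absurd hm.1 (not_le.2 h0)

lemma CompL2.smul {R : ℝ} {g : ℝ → E} (h : CompL2 R g) {a : ℝ → ℂ} (ha : Continuous a) :
    CompL2 R (fun t => a t • g t) := by
  obtain ⟨C, hC⟩ := isCompact_Icc (a := (0 : ℝ)) (b := R) |>.exists_bound_of_continuousOn
    ha.continuousOn
  refine ⟨MemLp.of_le_mul (c := C) h.memLp (ha.aestronglyMeasurable.smul h.memLp.1) ?_, ?_⟩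
  · filter_upwards [h.zero] with t ht
    by_cases hm : t ∈ Icc 0 R
    · rw [norm_smul]; gcongr; exact hC t hm
    · simp [ht hm]
  · filter_upwards [h.zero] with t ht hm
    simp [ht hm]

lemma CompL2.integrable {E : Type*} [NormedAddCommGroup E] {R : ℝ} {g : ℝ → E}
    (h : CompL2 R g) : Integrable g := by
  have h1 : IntegrableOn g (Icc 0 R) := by
    have : IsFiniteMeasure (volume.restrict (Icc 0 R) : Measure ℝ) := ⟨by simp⟩
    exact (h.memLp.restrict _).integrable (by norm_num)
  have h2 : g =ᵐ[volume] (Icc 0 R).indicator g := by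
    filter_upwards [h.zero] with t ht
    by_cases hm : t ∈ Icc 0 R
    · rw [indicator_of_mem hm]
    · rw [indicator_of_notMem hm, ht hm]
  exact ((integrable_indicator_iff measurableSet_Icc).2 h1).congr h2.symm

lemma CompL2.wInt {R : ℝ} {g : ℝ → E} (h : CompL2 R g) (σ : ℝ) : WInt σ g :=
  (h.smul (a := fun t => (Real.exp (-σ * t) : ℂ)) (by fun_prop)).integrable

lemma CompL2.differentiableOn_lap {R : ℝ} {g : ℝ → E} (h : CompL2 R g) :
    DifferentiableOn ℂ (fun s => lap s g) halfPlane :=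
  differentiableOn_lap_halfPlane fun σ _ => h.wInt σ

lemma CompL2.exists_norm_lap_le {R : ℝ} {g : ℝ → E} (h : CompL2 R g) {a : ℝ}
    (h0 : ∀ᵐ t : ℝ, t < a → g t = 0) : ∃ C : ℝ, 0 ≤ C ∧ ∀ s : ℂ, 0 ≤ s.re →
      ‖lap s g‖ ≤ C * Real.exp (-a * s.re) := by
  refine ⟨∫ t : ℝ, Real.exp (-0 * t) * ‖g t‖, integral_nonneg fun t => by positivity,
    fun s hs => ?_⟩
  refine (norm_lap_le_of_support (h.wInt 0) h0 hs).trans (le_of_eq ?_)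
  rw [mul_comm]; congr 2; ring

lemma CompL2.exists_norm_lap_le' {R : ℝ} {g : ℝ → E} (h : CompL2 R g) : ∃ C : ℝ, 0 ≤ C ∧
    ∀ s : ℂ, 0 ≤ s.re → ‖lap s g‖ ≤ C := by
  obtain ⟨C, hC, h1⟩ := h.exists_norm_lap_le h.zero_neg
  exact ⟨C, hC, fun s hs => by simpa using h1 s hs⟩

/-- Extension by zero from `(0, T)`. -/
def zext (T : ℝ) {E : Type*} [Zero E] (g : ℝ → E) : ℝ → E := (Ioo 0 T).indicator g

lemma compL2_zext {E : Type*} [NormedAddCommGroup E] {T : ℝ} {g : ℝ → E}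
    (hg : MemLp g 2 (volume.restrict (Ioo 0 T))) :
    CompL2 T (zext T g) := by
  refine ⟨(memLp_indicator_iff_restrict measurableSet_Ioo).2 hg, ae_of_all _ fun t ht => ?_⟩
  exact indicator_of_notMem (fun h => ht (Ioo_subset_Icc_self h)) _

lemma compL2_zext_Lp {E : Type*} [NormedAddCommGroup E] {T : ℝ} (g : L2t (Ioo 0 T) E) :
    CompL2 T (zext T (g : ℝ → E)) :=
  compL2_zext (Lp.memLp g)

variable [CompleteSpace E]

/-- Transform of the correlation of a test function and a function. -/
lemma integral_exp_correlation {θ : ℝ → ℂ} (hθ : IsTest θ) {v : ℝ → E} {s : ℂ}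
    (hv : WInt s.re v) (hvm : AEStronglyMeasurable v) :
    ∫ τ : ℝ, Complex.exp (s * τ) • ∫ t, θ (t + τ) • v t = lap (-s) θ • lap s v := by
  let f : ℝ → ℝ → E := fun τ t => (Complex.exp (s * τ) * θ (t + τ)) • v t
  have hθc := hθ.1.continuous
  have hshift : ∀ t : ℝ, (fun τ : ℝ => Complex.exp (s * τ) * θ (t + τ))
      = fun τ : ℝ => Complex.exp (-(s * t)) * ((fun r : ℝ => Complex.exp (-(-s * r)) • θ r) (t + τ)) := by
    intro t; ext τ
    simp only [smul_eq_mul, ← mul_assoc, ← Complex.exp_add]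
    congr 2
    push_cast; ring
  have hI : Integrable fun r : ℝ => Complex.exp (-(-s * r)) • θ r := (hθ.wInt _).integrable
  have hint : Integrable (Function.uncurry f) (volume.prod volume) := by
    have hmeas : AEStronglyMeasurable (Function.uncurry f) (volume.prod volume) := by
      refine AEStronglyMeasurable.smul (Continuous.aestronglyMeasurable (by fun_prop)) ?_
      exact hvm.comp_snd
    rw [integrable_prod_iff' hmeas]
    constructor
    · refine ae_of_all _ fun t => ?_
      refine Integrable.smul_const ?_ (v t)
      simp only [hshift t]
      exact (hI.comp_add_left t).const_mul _
    · have h1 : ∀ t : ℝ, ∫ τ, ‖Function.uncurry f (τ, t)‖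
          = (∫ r : ℝ, ‖Complex.exp (-(-s * r)) • θ r‖) * (Real.exp (-s.re * t) * ‖v t‖) := by
        intro t
        simp only [f, Function.uncurry_apply_pair, norm_smul]
        rw [integral_mul_const]
        have : ∀ τ : ℝ, ‖Complex.exp (s * τ) * θ (t + τ)‖ = Real.exp (-s.re * t) *
            ((fun r : ℝ => ‖Complex.exp (-(-s * r)) • θ r‖) (t + τ)) := by
          intro τ
          have := congrFun (hshift t) τ
          simp only at this
          rw [this, norm_mul, norm_exp_neg_mul]
        simp only [this]
        rw [integral_const_mul, integral_add_left_eq_self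
          (fun r : ℝ => ‖Complex.exp (-(-s * r)) • θ r‖) t]
        simp only [norm_smul]
        ring
      simp only [h1]
      exact hv.norm_integrable.const_mul _
  have e1 : ∀ τ : ℝ, Complex.exp (s * τ) • ∫ t, θ (t + τ) • v t = ∫ t, f τ t := by
    intro τ
    rw [← integral_smul]
    simp only [f, mul_smul]
  simp only [e1]
  rw [integral_integral_swap hint]
  have e2 : ∀ t : ℝ, ∫ τ, f τ t = lap (-s) θ • (Complex.exp (-(s * t)) • v t) := by
    intro t
    simp only [f]
    rw [integral_smul_const, smul_smul]
    congr 1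
    rw [hshift t, integral_const_mul, integral_add_left_eq_self
      (fun r : ℝ => Complex.exp (-(-s * r)) • θ r) t, mul_comm]
    rfl
  simp only [e2]
  rw [integral_smul]
  rfl

end Pairing

/-! ### The weak formulation in the frequency domain -/

section WeakForm

variable {L H c d₁ T : ℝ} {bhat : ℝ × ℝ → ℂ → ℂ}

open ContinuousLinearMap (adjoint)

/-- The residual of the equation in the frequency domain. -/
def residual (L c d₁ : ℝ) (bhat : ℝ × ℝ → ℂ → ℂ) (F : ℝ → L2S L) (w : ℝ → H1p L) (s : ℂ) : H1p L :=
  opA L c d₁ bhat s (lap s w) - adjoint (embL L) (lap s F)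

lemma inner_smul_residual (F : ℝ → L2S L) (w : ℝ → H1p L) (s z : ℂ) (ξ : H1p L) :
    inner ℂ ξ (z • residual L c d₁ bhat F w s)
      = z * (((c : ℂ) ^ 2)⁻¹ * s ^ 2 * (inner ℂ (H1p.fn ξ) (mulL L (coeffLp L bhat s)
          (H1p.fn (lap s w))) - (d₁ : ℂ) ^ 2 * inner ℂ (H1p.fn ξ) (H1p.fn (lap s w)))
        + (inner ℂ (H1p.gx ξ) (H1p.gx (lap s w)) + inner ℂ (H1p.gz ξ) (H1p.gz (lap s w)))
        + 2 * ((d₁ : ℂ) / c) * s * inner ℂ (H1p.fn ξ) (H1p.gx (lap s w))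
        - inner ℂ (H1p.fn ξ) (lap s F)) := by
  refine (inner_smul_right ξ _ z).trans (congrArg (z * ·) ?_)
  refine (inner_sub_right ξ _ _).trans (congrArg₂ (· - ·) (inner_opA s ξ _) ?_)
  exact ContinuousLinearMap.adjoint_inner_right (embL L) ξ _

lemma integral_combine {f₁ f₂ f₃ f₄ f₅ : ℝ → ℂ} (h₁ : Integrable f₁) (h₂ : Integrable f₂)
    (h₃ : Integrable f₃) (h₄ : Integrable f₄) (h₅ : Integrable f₅) {α β δ : ℂ} :
    α * ((∫ y, f₁ y) - δ * ∫ y, f₂ y) + (∫ y, f₃ y) + β * (∫ y, f₄ y) - ∫ y, f₅ y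
      = ∫ y, (α * (f₁ y - δ * f₂ y) + f₃ y + β * f₄ y - f₅ y) := by
  have k1 : Integrable fun y => α * (f₁ y - δ * f₂ y) := (h₁.sub (h₂.const_mul δ)).const_mul α
  have k2 : Integrable fun y => α * (f₁ y - δ * f₂ y) + f₃ y := k1.add h₃
  have k3 : Integrable fun y => α * (f₁ y - δ * f₂ y) + f₃ y + β * f₄ y :=
    k2.add (h₄.const_mul β)
  rw [integral_sub k3 h₅, integral_add k2 (h₄.const_mul β), integral_add k1 h₃,
    integral_const_mul, integral_const_mul, integral_sub h₁ (h₂.const_mul δ), integral_const_mul]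

lemma CoeffAssumption.differentiableOn_residual (hb : CoeffAssumption L H d₁ bhat)
    {F : ℝ → L2S L} {w : ℝ → H1p L} (hF : ∀ σ : ℝ, 0 < σ → WInt σ F)
    (hw : ∀ σ : ℝ, 0 < σ → WInt σ w) :
    DifferentiableOn ℂ (residual L c d₁ bhat F w) halfPlane :=
  (hb.differentiableOn_opA.clm_apply (differentiableOn_lap_halfPlane hw)).sub
    ((adjoint (embL L)).differentiable.comp_differentiableOn (differentiableOn_lap_halfPlane hF))

lemma CoeffAssumption.exists_residual_le (hb : CoeffAssumption L H d₁ bhat) {σ : ℝ}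
    (hσ : 0 < σ) : ∃ K : ℝ, 0 ≤ K ∧ ∀ (F : ℝ → L2S L) (w : ℝ → H1p L) (s : ℂ) (D : ℝ), σ < s.re →
      ‖lap s F‖ ≤ D → ‖lap s w‖ ≤ D → ‖residual L c d₁ bhat F w s‖ ≤ K * ‖s‖ ^ 2 * D := by
  obtain ⟨K, hK, h⟩ := hb.exists_opA_le (c := c) hσ
  obtain ⟨N, hN, hN'⟩ : ∃ N : ℝ, 0 ≤ N ∧ ∀ f, ‖adjoint (embL L) f‖ ≤ N * ‖f‖ :=
    ⟨‖adjoint (embL L)‖, by positivity, (adjoint (embL L)).le_opNorm⟩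
  refine ⟨K + N * (σ ^ 2)⁻¹, by positivity, fun F w s D hs h1 h2 => ?_⟩
  have hD : 0 ≤ D := (norm_nonneg _).trans h1
  have hsn : σ ≤ ‖s‖ := hs.le.trans (Complex.re_le_norm s)
  have h3 : 1 ≤ (σ ^ 2)⁻¹ * ‖s‖ ^ 2 := by
    rw [inv_mul_eq_div, le_div_iff₀ (by positivity), one_mul]; gcongr
  have h4 : ‖opA L c d₁ bhat s (lap s w)‖ ≤ K * ‖s‖ ^ 2 * D :=
    ((opA L c d₁ bhat s).le_opNorm _).trans (mul_le_mul (h s hs) h2 (norm_nonneg _) (by positivity))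
  have h5 : ‖adjoint (embL L) (lap s F)‖ ≤ N * D :=
    (hN' _).trans (mul_le_mul_of_nonneg_left h1 hN)
  have h6 : N * D * 1 ≤ N * D * ((σ ^ 2)⁻¹ * ‖s‖ ^ 2) := by gcongr
  refine (norm_sub_le _ _).trans ?_
  calc _ ≤ K * ‖s‖ ^ 2 * D + N * D * ((σ ^ 2)⁻¹ * ‖s‖ ^ 2) := by linarith
    _ = _ := by ring

lemma setIntegral_eq_zext {E : Type*} [NormedAddCommGroup E] [NormedSpace ℂ E] (k : E →L[ℂ] ℂ)
    (φ : ℝ → ℂ) (w : ℝ → E) : ∫ t in Ioo 0 T, φ t * k (w t) = ∫ t, φ t • k (zext T w t) := by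
  rw [← integral_indicator measurableSet_Ioo]
  refine integral_congr_ae (ae_of_all _ fun t => ?_)
  by_cases ht : t ∈ Ioo 0 T
  · simp [zext, ht]
  · simp [zext, ht]

/-- Parseval's formula for functionals of a function on `(0, T)`. -/
lemma setIntegral_eq_integral_lap {E : Type*} [NormedAddCommGroup E] [NormedSpace ℂ E]
    [CompleteSpace E] (k : E →L[ℂ] ℂ) {φ : ℝ → ℂ} (hφ : IsTest φ) (w : L2t (Ioo 0 T) E) :
    ∫ t in Ioo 0 T, φ t * k (w t)
      = ∫ ξ : ℝ, lap (-vline 1 ξ) φ * k (lap (vline 1 ξ) (zext T w)) := by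
  have h := compL2_zext_Lp w
  have hk : WInt 1 (fun t => k (zext T w t)) := by
    refine (k.integrable_comp (h.wInt 1)).congr (ae_of_all _ fun t => ?_)
    simp
  rw [setIntegral_eq_zext, hφ.integral_smul_eq hk]
  refine integral_congr_ae (ae_of_all _ fun ξ => ?_)
  have := lap_clm (s := vline 1 ξ) k (g := zext T w) (by simpa using h.wInt 1)
  simp only [this, smul_eq_mul]

/-- The transform of the correlation of `θ` and `w` factors as `lap (-s) θ` times `lap s w`. The
prefactor `(2π)⁻¹` is the Jacobian between the frequency in `coeffPairing` and that in `vline`. -/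
lemma CoeffAssumption.convPairing_eq (hb : CoeffAssumption L H d₁ bhat) {θ : ℝ → ℂ}
    (hθ : IsTest θ) (w : L2t (Ioo 0 T) (H1p L)) (ξ : L2S L) :
    convPairing L T bhat (fun t => H1p.fn (w t)) θ ξ
      = ∫ y : ℝ, lap (-vline 1 y) θ * inner ℂ ξ (mulL L (coeffLp L bhat (vline 1 y))
          (H1p.fn (lap (vline 1 y) (zext T w)))) := by
  have hw := compL2_zext_Lp w
  have hv : CompL2 T (fun t => embL L (zext T w t)) :=
    ⟨(embL L).comp_memLp' hw.memLp, by
      filter_upwards [hw.zero] with t ht hm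
      rw [ht hm, map_zero]⟩
  rw [convPairing, coeffPairing, integral_vline_eq (fun s => lap (-s) θ * inner ℂ ξ
    (mulL L (coeffLp L bhat s) (H1p.fn (lap s (zext T w))))) 1]
  rw [← Complex.coe_smul, smul_eq_mul]
  push_cast
  congr 1
  refine integral_congr_ae (ae_of_all _ fun y => ?_)
  simp only
  have hs : (1 + y * Complex.I : ℂ).re = 1 := by simp
  have h1 : (∫ τ : ℝ, Complex.exp ((1 + y * Complex.I) * τ) •
      ∫ t in Ioo 0 T, θ (t + τ) • H1p.fn ((w : ℝ → H1p L) t))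
      = lap (-(1 + y * Complex.I)) θ • H1p.fn (lap (1 + y * Complex.I) (zext T w)) := by
    rw [← embL_apply, ← lap_clm (embL L) (by rw [hs]; exact hw.wInt 1),
      ← integral_exp_correlation hθ (by rw [hs]; exact hv.wInt 1) hv.memLp.1]
    refine integral_congr_ae (ae_of_all _ fun τ => ?_)
    simp only
    congr 1
    rw [← integral_indicator measurableSet_Ioo]
    refine integral_congr_ae (ae_of_all _ fun t => ?_)
    by_cases ht : t ∈ Ioo 0 T
    · simp [zext, ht]
    · simp only [zext, indicator_of_notMem ht, map_zero, smul_zero]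
  rw [h1, ← hb.inner_mul_eq (by rw [hs]; exact one_pos), map_smul, inner_smul_right]

/-- The weak formulation in the frequency domain. -/
lemma CoeffAssumption.isWeakSolution_iff (hb : CoeffAssumption L H d₁ bhat)
    (F : L2t (Ioo 0 T) (L2S L)) (w : L2t (Ioo 0 T) (H1p L)) :
    IsWeakSolution L c d₁ T bhat F w ↔ ∀ φ : ℝ → ℂ, IsTest φ → tsupport φ ⊆ Iio T →
      ∫ y : ℝ, lap (-vline 1 y) φ • residual L c d₁ bhat (zext T F) (zext T w) (vline 1 y) = 0 := by
  have hw := compL2_zext_Lp w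
  have hF := compL2_zext_Lp F
  obtain ⟨D, hD, hwD⟩ := hw.exists_norm_lap_le'
  obtain ⟨D', hD', hFD⟩ := hF.exists_norm_lap_le'
  have hcont : ∀ {E' : Type} [NormedAddCommGroup E'] [NormedSpace ℂ E'] (k : H1p L →L[ℂ] E'),
      ContinuousOn (fun s => k (lap s (zext T w))) halfPlane := fun k =>
    k.continuous.comp_continuousOn hw.differentiableOn_lap.continuousOn
  -- Parseval on `Re s = 1`, term by term. Afterwards `ξ` enters only through the inner product, so
  -- testing with all `ξ` gives an identity in `H1p`.
  have key : ∀ (φ : ℝ → ℂ) (ξ : H1p L), IsTest φ →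
      ((c : ℂ) ^ 2)⁻¹ *
        (convPairing L T bhat (fun t => H1p.fn (w t)) (iteratedDeriv 2 φ) (H1p.fn ξ)
          - (d₁ : ℂ) ^ 2 * ∫ t in Ioo 0 T, iteratedDeriv 2 φ t * inner ℂ (H1p.fn ξ) (H1p.fn (w t)))
      + (∫ t in Ioo 0 T, φ t * (inner ℂ (H1p.gx ξ) (H1p.gx (w t))
          + inner ℂ (H1p.gz ξ) (H1p.gz (w t))))
      - 2 * ((d₁ : ℂ) / c) * (∫ t in Ioo 0 T, deriv φ t * inner ℂ (H1p.fn ξ) (H1p.gx (w t)))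
      - ∫ t in Ioo 0 T, φ t * inner ℂ (H1p.fn ξ) (F t)
      = inner ℂ ξ (∫ y : ℝ, lap (-vline 1 y) φ •
          residual L c d₁ bhat (zext T F) (zext T w) (vline 1 y)) := by
    intro φ ξ hφ
    have b1 := hb.convPairing_eq (hφ.iteratedDeriv 2) w (H1p.fn ξ)
    have b2 := setIntegral_eq_integral_lap ((innerSL ℂ (H1p.fn ξ)) ∘L embL L)
      (hφ.iteratedDeriv 2) w
    have b3 := setIntegral_eq_integral_lap ((innerSL ℂ (H1p.gx ξ)) ∘L gradX L
      + (innerSL ℂ (H1p.gz ξ)) ∘L gradZ L) hφ w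
    have b4 := setIntegral_eq_integral_lap ((innerSL ℂ (H1p.fn ξ)) ∘L gradX L) hφ.deriv w
    have b5 := setIntegral_eq_integral_lap (innerSL ℂ (H1p.fn ξ)) hφ F
    simp only [ContinuousLinearMap.comp_apply, innerSL_apply_apply, add_apply, embL_apply,
      gradX_apply, gradZ_apply] at b2 b3 b4 b5
    rw [b1, b2, b3, b4, b5]
    have hmul : ContinuousOn (fun s : ℂ => s ^ 2 * inner ℂ (H1p.fn ξ) (mulL L (coeffLp L bhat s)
        (H1p.fn (lap s (zext T w))))) halfPlane := by
      refine (by fun_prop : ContinuousOn (fun s : ℂ => s ^ 2) halfPlane).mul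
        (continuousOn_const.inner (ContinuousOn.clm_apply ?_ (hcont (embL L))))
      exact (mulL L).continuous.comp_continuousOn hb.differentiableOn_coeffLp.continuousOn
    obtain ⟨M, hM0, hM⟩ := hb.exists_norm_coeffLp_le (σ := 1 / 2) (by norm_num)
    obtain ⟨N, hN, hN'⟩ : ∃ N : ℝ, 0 ≤ N ∧ ∀ s : ℂ, s.re = 1 →
        ‖(inner ℂ (H1p.fn ξ) (mulL L (coeffLp L bhat s) (H1p.fn (lap s (zext T w)))) : ℂ)‖ ≤ N := by
      refine ⟨‖H1p.fn ξ‖ * (‖mulL L‖ * M * (‖embL L‖ * D)), by positivity, fun s hs => ?_⟩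
      refine (norm_inner_le_norm _ _).trans ?_
      gcongr
      refine ((mulL L).le_opNorm₂ _ _).trans ?_
      gcongr
      · exact hM s (by rw [hs]; norm_num)
      · exact ((embL L).le_opNorm _).trans (by gcongr; exact hwD s (by rw [hs]; norm_num))
    have hbdd : ∀ (k : H1p L →L[ℂ] ℂ), ∀ s : ℂ, s.re = 1 → ‖k (lap s (zext T w))‖ ≤ ‖k‖ * D :=
      fun k s hs => (k.le_opNorm _).trans (by gcongr; exact hwD s (by rw [hs]; norm_num))
    have i1 : Integrable fun y : ℝ => lap (-vline 1 y) φ * (vline 1 y ^ 2 * inner ℂ (H1p.fn ξ)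
        (mulL L (coeffLp L bhat (vline 1 y)) (H1p.fn (lap (vline 1 y) (zext T w))))) :=
      integrable_lap_smul hφ hmul one_pos hN 2 fun s hs => by
        rw [norm_mul, norm_pow, mul_comm]
        gcongr; exact hN' s hs
    have i2 : ∀ (k : H1p L →L[ℂ] ℂ) (n : ℕ), Integrable fun y : ℝ => lap (-vline 1 y) φ *
        (vline 1 y ^ n * k (lap (vline 1 y) (zext T w))) := fun k n =>
      integrable_lap_smul hφ (p := fun s => s ^ n * k (lap s (zext T w)))
        ((by fun_prop : ContinuousOn (fun s : ℂ => s ^ n) halfPlane).mul (hcont k)) one_pos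
        (K := ‖k‖ * D) (by positivity) n fun s hs => by
        rw [norm_mul, norm_pow, mul_comm]
        gcongr; exact hbdd k s hs
    have i5 : Integrable fun y : ℝ => lap (-vline 1 y) φ *
        inner ℂ (H1p.fn ξ) (lap (vline 1 y) (zext T F)) :=
      integrable_lap_smul hφ (p := fun s => inner ℂ (H1p.fn ξ) (lap s (zext T F)))
        (continuousOn_const.inner hF.differentiableOn_lap.continuousOn) one_pos
        (K := ‖H1p.fn ξ‖ * D') (by positivity) 0 fun s hs => by
        rw [pow_zero, mul_one]
        refine (norm_inner_le_norm _ _).trans ?_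
        gcongr; exact hFD s (by rw [hs]; norm_num)
    have i2' := i2 ((innerSL ℂ (H1p.fn ξ)) ∘L embL L) 2
    have i3' := i2 ((innerSL ℂ (H1p.gx ξ)) ∘L gradX L + (innerSL ℂ (H1p.gz ξ)) ∘L gradZ L) 0
    have i4' := i2 ((innerSL ℂ (H1p.fn ξ)) ∘L gradX L) 1
    simp only [ContinuousLinearMap.comp_apply, innerSL_apply_apply, add_apply, embL_apply,
      gradX_apply, gradZ_apply, pow_zero, one_mul, pow_one] at i2' i3' i4'
    obtain ⟨K, hK, hres⟩ := hb.exists_residual_le (c := c) (σ := 1 / 2) (by norm_num)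
    have i6 : Integrable fun y : ℝ => lap (-vline 1 y) φ •
        residual L c d₁ bhat (zext T F) (zext T w) (vline 1 y) :=
      integrable_lap_smul hφ (p := residual L c d₁ bhat (zext T F) (zext T w))
        (hb.differentiableOn_residual (fun σ _ => hF.wInt σ)
          (fun σ _ => hw.wInt σ)).continuousOn one_pos
        (K := K * max D D') (by positivity) 2 fun s hs => by
        rw [mul_right_comm]
        exact hres _ _ s (max D D') (by rw [hs]; norm_num)
          ((hFD s (by rw [hs]; norm_num)).trans (le_max_right _ _))
          ((hwD s (by rw [hs]; norm_num)).trans (le_max_left _ _))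
    rw [← innerSL_apply_apply ℂ ξ, ← (innerSL ℂ ξ).integral_comp_comm i6]
    have j1 : ∀ y : ℝ, lap (-vline 1 y) (iteratedDeriv 2 φ) * inner ℂ (H1p.fn ξ)
        (mulL L (coeffLp L bhat (vline 1 y)) (H1p.fn (lap (vline 1 y) (zext T w))))
      = lap (-vline 1 y) φ * (vline 1 y ^ 2 * inner ℂ (H1p.fn ξ)
        (mulL L (coeffLp L bhat (vline 1 y)) (H1p.fn (lap (vline 1 y) (zext T w))))) :=
      fun y => by rw [lap_iteratedDeriv hφ]; ring
    have j2 : ∀ y : ℝ, lap (-vline 1 y) (iteratedDeriv 2 φ) * inner ℂ (H1p.fn ξ)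
        (H1p.fn (lap (vline 1 y) (zext T w)))
      = lap (-vline 1 y) φ * (vline 1 y ^ 2 * inner ℂ (H1p.fn ξ)
        (H1p.fn (lap (vline 1 y) (zext T w)))) := fun y => by rw [lap_iteratedDeriv hφ]; ring
    -- One derivative of `φ` gives `-s`, which turns the minus sign of the mixed term into the plus
    -- sign in `opA`.
    have j4 : ∀ y : ℝ, lap (-vline 1 y) (deriv φ) * inner ℂ (H1p.fn ξ)
        (H1p.gx (lap (vline 1 y) (zext T w)))
      = -(lap (-vline 1 y) φ * (vline 1 y * inner ℂ (H1p.fn ξ)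
        (H1p.gx (lap (vline 1 y) (zext T w))))) := fun y => by rw [lap_deriv hφ]; ring
    simp only [j1, j2, j4]
    rw [integral_neg, mul_neg, sub_neg_eq_add, integral_combine i1 i2' i3' i4' i5]
    refine integral_congr_ae (ae_of_all _ fun y => ?_)
    refine Eq.trans ?_ (inner_smul_residual _ _ _ _ _).symm
    ring
  constructor
  · intro h φ hφ hs
    refine ext_inner_left ℂ fun ξ => ?_
    rw [← key φ ξ hφ, inner_zero_right, sub_eq_zero]
    exact h φ ξ hφ hs
  · intro h φ ξ hφ hs
    rw [← sub_eq_zero, key φ ξ hφ, h φ hφ hs, inner_zero_right]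

end WeakForm

/-! ### Functions that vanish before time `T` -/

section PaleyWiener

variable {E : Type*} [NormedAddCommGroup E] [NormedSpace ℂ E]

/-- The test function `τ ↦ ρ(t - τ)`. -/
def reflect (ρ : ℝ → ℂ) (t τ : ℝ) : ℂ := ρ (t - τ)

lemma IsTest.reflect {ρ : ℝ → ℂ} (h : IsTest ρ) (t : ℝ) : IsTest (reflect ρ t) := by
  refine ⟨h.1.comp (contDiff_const.sub contDiff_id), ?_⟩
  exact h.2.comp_homeomorph (Homeomorph.subLeft t)

lemma tsupport_reflect {ρ : ℝ → ℂ} (h0 : tsupport ρ ⊆ Ici 0) (t : ℝ) :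
    tsupport (reflect ρ t) ⊆ Iic t := by
  refine closure_minimal (fun τ hτ => ?_) isClosed_Iic
  have : t - τ ∈ Ici (0 : ℝ) := h0 (subset_tsupport _ hτ)
  simpa using this

lemma lap_reflect (ρ : ℝ → ℂ) (s : ℂ) (t : ℝ) :
    lap (-s) (reflect ρ t) = Complex.exp (s * t) * lap s ρ := by
  rw [lap, lap, ← integral_const_mul,
    ← integral_sub_left_eq_self (fun r : ℝ => Complex.exp (s * t) * (Complex.exp (-(s * r)) • ρ r))
      volume t]
  refine integral_congr_ae (ae_of_all _ fun τ => ?_)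
  simp only [reflect, smul_eq_mul, ← mul_assoc, ← Complex.exp_add]
  congr 2
  push_cast; ring

lemma exists_norm_lap_le_of_nonneg {ρ : ℝ → ℂ} (h : IsTest ρ) (h0 : tsupport ρ ⊆ Ici 0) (n : ℕ) :
    ∃ C : ℝ, 0 ≤ C ∧ ∀ s : ℂ, 0 ≤ s.re → ‖lap s ρ‖ * ‖s‖ ^ n ≤ C := by
  obtain ⟨C, hC, hb⟩ := exists_norm_lap_test_le (h.reflect 0) (tsupport_reflect h0 0) n
  refine ⟨C, hC, fun s hs => ?_⟩
  have := hb s hs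
  rw [lap_reflect] at this
  simpa using this

variable [CompleteSpace E]

/-- A transform that vanishes against test functions before time `T` decays like `e^{-T Re s}`,
after multiplication by the transform of a test function on `[0, ∞)`. -/
lemma exists_norm_lap_smul_le {r : ℂ → E} (hr : DifferentiableOn ℂ r halfPlane) {K T : ℝ} {n : ℕ}
    (hK : 0 ≤ K) (hb : ∀ s : ℂ, 1 ≤ s.re → ‖r s‖ ≤ K * ‖s‖ ^ n)
    (hz : ∀ φ : ℝ → ℂ, IsTest φ → tsupport φ ⊆ Iio T →
      ∫ y : ℝ, lap (-vline 1 y) φ • r (vline 1 y) = 0)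
    {ρ : ℝ → ℂ} (hρ : IsTest ρ) (h0 : tsupport ρ ⊆ Ici 0) :
    ∃ C : ℝ, 0 ≤ C ∧ ∀ s : ℂ, 2 ≤ s.re → ‖lap s ρ • r s‖ ≤ C * Real.exp (-T * s.re) := by
  obtain ⟨D, hD, hdec⟩ := exists_norm_lap_le_of_nonneg hρ h0 (n + 2)
  have hm : ∀ s : ℂ, 1 ≤ s.re → ‖lap s ρ • r s‖ * ‖s‖ ^ 2 ≤ D * K := by
    intro s hs
    rw [norm_smul]
    calc ‖lap s ρ‖ * ‖r s‖ * ‖s‖ ^ 2 ≤ ‖lap s ρ‖ * (K * ‖s‖ ^ n) * ‖s‖ ^ 2 := by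
          gcongr; exact hb s hs
      _ = (‖lap s ρ‖ * ‖s‖ ^ (n + 2)) * K := by ring
      _ ≤ D * K := mul_le_mul_of_nonneg_right (hdec s (by linarith)) hK
  have hmd : ContinuousOn (fun s => lap s ρ • r s) halfPlane :=
    hρ.differentiable_lap.continuous.continuousOn.smul hr.continuousOn
  have hint : ∀ σ : ℝ, 1 ≤ σ → Integrable fun y : ℝ => lap (vline σ y) ρ • r (vline σ y) :=
    fun σ hσ => integrable_vline hmd (by linarith) fun s hs => hm s (by rw [hs]; exact hσ)
  -- `Q` is the inverse Laplace transform of `lap s ρ • r s`. It vanishes for `t < T` by `hz`, and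
  -- the line `Re s = 1` shows that it is `O(e^t)`.
  let Q : ℝ → E := fun t => ∫ y : ℝ, lap (-vline 1 y) (reflect ρ t) • r (vline 1 y)
  set B := ∫ y : ℝ, ‖lap (vline 1 y) ρ • r (vline 1 y)‖ with hB
  have hB0 : 0 ≤ B := integral_nonneg fun _ => norm_nonneg _
  have hQ0 : ∀ t < T, Q t = 0 := fun t ht =>
    hz _ (hρ.reflect t) ((tsupport_reflect h0 t).trans fun x hx => lt_of_le_of_lt hx ht)
  have hQb : ∀ t, ‖Q t‖ ≤ Real.exp t * B := by
    intro t
    refine (norm_integral_le_integral_norm _).trans (le_of_eq ?_)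
    rw [hB, ← integral_const_mul]
    refine integral_congr_ae (ae_of_all _ fun y => ?_)
    simp only [lap_reflect, norm_smul, norm_mul]
    rw [Complex.norm_exp]
    simp [mul_assoc]
  refine ⟨B * Real.exp T, by positivity, fun s hs => ?_⟩
  set σ := s.re with hσ
  set f : ℝ → E := fun y => lap (vline σ y) ρ • r (vline σ y) with hf
  have hfc : Continuous f :=
    hmd.comp_continuous (continuous_vline σ) fun y => by simp [halfPlane]; linarith
  have hfi : Integrable f := hint σ (by linarith)
  -- Moving the line to `Re s = σ` shows that `e^{-σt} Q(t)` is an inverse Fourier transform. It is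
  -- `O(e^{-(σ-1)t})` on `[T, ∞)` and zero before, so Fourier inversion recovers `f` with the bound
  -- wanted.
  have hinv : ∀ t : ℝ, 𝓕⁻ f t = (Real.exp (-σ * t) : ℂ) • Q t := by
    intro t
    have hsh : Q t = ∫ y : ℝ, lap (-vline σ y) (reflect ρ t) • r (vline σ y) :=
      integral_lap_smul_shift (hρ.reflect t) hr one_pos (by linarith) hK n fun s h1 _ => hb s h1
    rw [hsh, ← integral_smul, Real.fourierInv_eq']
    refine integral_congr_ae (ae_of_all _ fun y => ?_)
    simp only [hf, lap_reflect, smul_smul]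
    congr 1
    rw [← mul_assoc, Complex.ofReal_exp, ← Complex.exp_add]
    congr 2
    simp [vline]; ring
  have hexp : IntegrableOn (fun t : ℝ => Real.exp (-(σ - 1) * t)) (Ioi T) :=
    integrableOn_exp_mul_Ioi (by linarith) T
  have hle : ∀ t : ℝ, ‖(𝓕⁻ f) t‖ ≤ B * (Ici T).indicator (fun t => Real.exp (-(σ - 1) * t)) t := by
    intro t
    rw [hinv]
    by_cases ht : t ∈ Ici T
    · rw [indicator_of_mem ht, norm_smul, Complex.norm_real, Real.norm_of_nonneg (Real.exp_pos _).le]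
      calc _ ≤ Real.exp (-σ * t) * (Real.exp t * B) := by gcongr; exact hQb t
        _ = B * (Real.exp (-σ * t) * Real.exp t) := by ring
        _ = _ := by rw [← Real.exp_add]; congr 2; ring
    · rw [indicator_of_notMem ht, hQ0 t (not_le.1 ht)]
      simp
  have hbound : Integrable fun t : ℝ =>
      B * (Ici T).indicator (fun t => Real.exp (-(σ - 1) * t)) t := by
    refine Integrable.const_mul ?_ B
    rw [integrable_indicator_iff measurableSet_Ici, integrableOn_Ici_iff_integrableOn_Ioi]
    exact hexp
  have hinvc : Continuous (𝓕⁻ f) := by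
    have h1 : 𝓕⁻ f = fun t => 𝓕 f (-t) := by
      ext t; exact Real.fourierInv_eq_fourier_neg f t
    rw [h1]
    exact (VectorFourier.fourierIntegral_continuous Real.continuous_fourierChar
      (by exact continuous_inner) hfi).comp continuous_neg
  have hinvi : Integrable (𝓕⁻ f) :=
    hbound.mono' hinvc.aestronglyMeasurable (ae_of_all _ hle)
  have hfi' : Integrable (𝓕 f) := by
    have h1 : 𝓕 f = fun t => 𝓕⁻ f (-t) := by
      ext t; rw [Real.fourierInv_eq_fourier_neg, neg_neg]
    rw [h1]
    exact hinvi.comp_neg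
  have hback := hfc.fourier_fourierInv_eq hfi hfi'
  have hsv : s = vline σ (s.im / (2 * Real.pi)) := by
    apply Complex.ext
    · simp [hσ]
    · rw [vline_eq, show 2 * Real.pi * (s.im / (2 * Real.pi)) = s.im by field_simp]
      simp
  have e1 : lap s ρ • r s = 𝓕 (𝓕⁻ f) (s.im / (2 * Real.pi)) := by
    rw [hback, hf]
    simp only
    rw [← hsv]
  rw [e1, Real.fourier_eq]
  refine (norm_integral_le_integral_norm _).trans ?_
  simp only [Circle.norm_smul]
  refine (integral_mono hinvi.norm hbound hle).trans ?_
  rw [integral_const_mul, integral_indicator measurableSet_Ici, integral_Ici_eq_integral_Ioi,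
    integral_exp_mul_Ioi (by linarith), mul_assoc]
  refine mul_le_mul_of_nonneg_left ?_ hB0
  rw [← Real.exp_add, neg_div_neg_eq,
    show T + -T * σ = -(σ - 1) * T by ring]
  -- The integral over `[T, ∞)` has the denominator `σ - 1`, which is at least one because `σ ≥ 2`.
  exact div_le_self (Real.exp_pos _).le (by linarith)

/-- Approximations of the identity that are supported in positive times. -/
lemma exists_approx_identity : ∃ ρ : ℕ → ℝ → ℂ, (∀ n, IsTest (ρ n)) ∧ (∀ n, tsupport (ρ n) ⊆ Ici 0) ∧
    (∀ n (s : ℂ), 0 ≤ s.re → ‖lap s (ρ n)‖ ≤ 1) ∧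
    ∀ s : ℂ, Tendsto (fun n => lap s (ρ n)) atTop (𝓝 1) := by
  have hpos : ∀ n : ℕ, (0 : ℝ) < 1 / ((n : ℝ) + 1) := fun n => by positivity
  -- The outer radius equals the centre, so the support is contained in `[0, 2/(n+1)]`.
  let b : (n : ℕ) → ContDiffBump (1 / ((n : ℝ) + 1) : ℝ) := fun n =>
    ⟨1 / ((n : ℝ) + 1) / 2, 1 / ((n : ℝ) + 1), by have := hpos n; positivity, by
      have := hpos n; linarith⟩
  let ρ : ℕ → ℝ → ℝ := fun n => (b n).normed volume
  have hsupp : ∀ n, tsupport (ρ n) ⊆ Icc 0 (2 * (1 / ((n : ℝ) + 1))) := by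
    intro n
    simp only [ρ]
    rw [(b n).tsupport_normed_eq, Real.closedBall_eq_Icc]
    refine Icc_subset_Icc (by simp [b]) (le_of_eq ?_)
    simp only [b]; ring
  have hnn : ∀ n t, 0 ≤ ρ n t := fun n t => (b n).nonneg_normed t
  have hint1 : ∀ n, ∫ t, ρ n t = 1 := fun n => (b n).integral_normed
  have hi : ∀ n, Integrable (ρ n) := fun n => (b n).integrable_normed
  have htest : ∀ n, IsTest (fun t => (ρ n t : ℂ)) := fun n =>
    isTest_ofReal (b n).contDiff_normed (b n).hasCompactSupport_normed
  refine ⟨fun n t => (ρ n t : ℂ), htest, fun n => ?_, fun n s hs => ?_, fun s => ?_⟩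
  · rw [tsupport_ofReal]
    exact (hsupp n).trans Icc_subset_Ici_self
  · refine (norm_lap_le s).trans ?_
    rw [← hint1 n]
    refine integral_mono_of_nonneg (ae_of_all _ fun t => by positivity) (hi n)
      (ae_of_all _ fun t => ?_)
    simp only [Complex.norm_real, Real.norm_of_nonneg (hnn n t)]
    by_cases ht : ρ n t = 0
    · simp [ht]
    · have h0 : 0 ≤ t := (hsupp n (subset_tsupport _ ht)).1
      refine mul_le_of_le_one_left (hnn n t) (Real.exp_le_one_iff.2 ?_)
      nlinarith
  · rw [Metric.tendsto_atTop]
    intro ε hε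
    have hc : ContinuousAt (fun t : ℝ => Complex.exp (-(s * t))) 0 := by fun_prop
    obtain ⟨δ, hδ, hcont⟩ := Metric.continuousAt_iff.1 hc (ε / 2) (by positivity)
    obtain ⟨N, hN⟩ := exists_nat_gt (2 / δ)
    refine ⟨N, fun n hn => ?_⟩
    have hn' : 2 * (1 / ((n : ℝ) + 1)) < δ := by
      have h1 : (N : ℝ) ≤ n := by exact_mod_cast hn
      rw [mul_one_div, div_lt_iff₀ (by positivity)]
      rw [div_lt_iff₀ hδ] at hN
      nlinarith
    have e1 : lap s (fun t => (ρ n t : ℂ)) - 1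
        = ∫ t : ℝ, (Complex.exp (-(s * t)) - 1) * (ρ n t : ℂ) := by
      simp only [sub_mul, one_mul]
      rw [integral_sub, lap]
      · rw [integral_complex_ofReal, hint1]
        simp
      · exact ((htest n).wInt _).integrable
      · exact (htest n).integrable
    rw [dist_eq_norm, e1]
    refine lt_of_le_of_lt (b := ε / 2) ?_ (by linarith)
    refine (norm_integral_le_integral_norm _).trans ?_
    rw [show ε / 2 = ∫ t, ε / 2 * ρ n t by rw [integral_const_mul, hint1, mul_one]]
    refine integral_mono_of_nonneg (ae_of_all _ fun t => by positivity) ((hi n).const_mul _)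
      (ae_of_all _ fun t => ?_)
    simp only [norm_mul, Complex.norm_real, Real.norm_of_nonneg (hnn n t)]
    by_cases ht : ρ n t = 0
    · simp [ht]
    · have h0 := hsupp n (subset_tsupport _ ht)
      refine mul_le_mul_of_nonneg_right ?_ (hnn n t)
      have := hcont (x := t) (by
        rw [Real.dist_eq, sub_zero, abs_of_nonneg h0.1]; exact h0.2.trans_lt hn')
      rw [dist_eq_norm] at this
      simpa using this.le

end PaleyWiener

/-! ### Uniqueness of weak solutions. -/

section Uniqueness

variable {L H c d₁ T : ℝ} {bhat : ℝ × ℝ → ℂ → ℂ}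

/-- If `A(s) ŵ(s)` is invisible before `T`, so is `w`. The Paley–Wiener estimate needs a mollifier
`ρ n` because `A(s) ŵ(s)` may grow like `|s|²`; mollifying commutes with `A(s)⁻¹`, and `ρ n` is
removed in the limit by dominated convergence. -/
lemma CoeffAssumption.integral_smul_eq_zero (hb : CoeffAssumption L H d₁ bhat) (hL : 0 < L)
    (hc : 0 < c) {R : ℝ} {w : ℝ → H1p L} (hw : CompL2 R w)
    (hz : ∀ φ : ℝ → ℂ, IsTest φ → tsupport φ ⊆ Iio T →
      ∫ y : ℝ, lap (-vline 1 y) φ • opA L c d₁ bhat (vline 1 y) (lap (vline 1 y) w) = 0)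
    {θ : ℝ → ℂ} (hθ : IsTest θ) (hT : tsupport θ ⊆ Iio T) : ∫ t, θ t • w t = 0 := by
  obtain ⟨a, haT, ha⟩ := hθ.exists_tsupport_subset hT
  obtain ⟨D, hD, hwD⟩ := hw.exists_norm_lap_le'
  obtain ⟨K, hK, hA⟩ := hb.exists_opA_le (c := c) (σ := 1 / 2) (by norm_num)
  obtain ⟨C₀, hC₀, hinv⟩ := hb.exists_norm_le_norm_opA hL hc
  obtain ⟨ρ, h1, h2, h3, h4⟩ := exists_approx_identity
  have hrd : DifferentiableOn ℂ (fun s => opA L c d₁ bhat s (lap s w)) halfPlane :=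
    hb.differentiableOn_opA.clm_apply hw.differentiableOn_lap
  have hrb : ∀ s : ℂ, 1 ≤ s.re → ‖opA L c d₁ bhat s (lap s w)‖ ≤ K * D * ‖s‖ ^ 2 := by
    intro s hs
    refine ((opA L c d₁ bhat s).le_opNorm _).trans ?_
    refine (mul_le_mul (hA s (by linarith)) (hwD s (by linarith)) (norm_nonneg _)
      (by positivity)).trans (le_of_eq (by ring))
  -- The line `Re s = 2` is used because the decay `e^{-T Re s}` is known from there on. Inverting
  -- `A(s)` adds one factor `|s|`, which `θ` absorbs.
  have hzero : ∀ n, ∫ y : ℝ, lap (-vline 2 y) θ • (lap (vline 2 y) (ρ n) • lap (vline 2 y) w) = 0 := by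
    intro n
    obtain ⟨C, hC, hdec⟩ := exists_norm_lap_smul_le hrd (by positivity) hrb hz (h1 n) (h2 n)
    refine integral_lap_smul_eq_zero hθ ha (p := fun s => lap s (ρ n) • lap s w)
      ((h1 n).differentiable_lap.differentiableOn.smul hw.differentiableOn_lap) two_pos
      (K := C₀ * C) (by positivity) 1 fun s hs => ?_
    have e := hinv s (by linarith) (lap s (ρ n) • lap s w)
    rw [map_smul] at e
    refine e.trans ?_
    calc C₀ * ‖s‖ * ‖lap s (ρ n) • opA L c d₁ bhat s (lap s w)‖
        ≤ C₀ * ‖s‖ * (C * Real.exp (-T * s.re)) := by gcongr; exact hdec s hs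
      _ ≤ C₀ * ‖s‖ * (C * Real.exp (-a * s.re)) := by
          have : -T * s.re ≤ -a * s.re := by nlinarith
          gcongr
      _ = _ := by ring
  refine (hθ.integral_smul_eq (hw.wInt 2)).trans ?_
  have hlim : Tendsto (fun n => ∫ y : ℝ, lap (-vline 2 y) θ •
      (lap (vline 2 y) (ρ n) • lap (vline 2 y) w)) atTop
      (𝓝 (∫ y : ℝ, lap (-vline 2 y) θ • lap (vline 2 y) w)) := by
    have hi : Integrable fun y : ℝ => lap (-vline 2 y) θ • lap (vline 2 y) w :=
      integrable_lap_smul hθ hw.differentiableOn_lap.continuousOn two_pos hD 0 fun s hs => by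
        simpa using hwD s (by rw [hs]; norm_num)
    refine tendsto_integral_of_dominated_convergence _ (fun n => ?_) hi.norm (fun n => ?_) ?_
    · have : Integrable fun y : ℝ => lap (-vline 2 y) θ •
          (lap (vline 2 y) (ρ n) • lap (vline 2 y) w) :=
        integrable_lap_smul hθ (p := fun s => lap s (ρ n) • lap s w)
          ((h1 n).differentiable_lap.continuous.continuousOn.smul
            hw.differentiableOn_lap.continuousOn) two_pos hD 0 fun s hs => by
          rw [norm_smul, pow_zero, mul_one]
          exact (mul_le_of_le_one_left (norm_nonneg _) (h3 n s (by rw [hs]; norm_num))).trans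
            (hwD s (by rw [hs]; norm_num))
      exact this.aestronglyMeasurable
    · refine ae_of_all _ fun y => ?_
      rw [norm_smul, norm_smul, norm_smul]
      gcongr
      exact mul_le_of_le_one_left (norm_nonneg _) (h3 n _ (by simp))
    · refine ae_of_all _ fun y => ?_
      have := ((h4 (vline 2 y)).smul_const (lap (vline 2 y) w)).const_smul (lap (-vline 2 y) θ)
      simpa using this
  simp only [hzero] at hlim
  exact tendsto_nhds_unique hlim tendsto_const_nhds

/-- Weak solutions are unique. -/
lemma CoeffAssumption.weakSolution_unique (hb : CoeffAssumption L H d₁ bhat) (hL : 0 < L)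
    (hc : 0 < c) {F : L2t (Ioo 0 T) (L2S L)} {w₁ w₂ : L2t (Ioo 0 T) (H1p L)}
    (h₁ : IsWeakSolution L c d₁ T bhat F w₁) (h₂ : IsWeakSolution L c d₁ T bhat F w₂) :
    w₁ = w₂ := by
  rw [hb.isWeakSolution_iff] at h₁ h₂
  have c₁ := compL2_zext_Lp w₁
  have c₂ := compL2_zext_Lp w₂
  have cF := compL2_zext_Lp F
  have hw : CompL2 T (fun t => zext T w₁ t - zext T w₂ t) := by
    refine ⟨c₁.memLp.sub c₂.memLp, ?_⟩
    filter_upwards [c₁.zero, c₂.zero] with t h1 h2 hm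
    rw [h1 hm, h2 hm, sub_zero]
  have hlap : ∀ s : ℂ, lap s (fun t => zext T w₁ t - zext T w₂ t)
      = lap s (zext T w₁) - lap s (zext T w₂) := by
    intro s
    simp only [lap, smul_sub]
    exact integral_sub (c₁.wInt _).integrable (c₂.wInt _).integrable
  obtain ⟨D₃, hD₃, b₃⟩ := cF.exists_norm_lap_le'
  obtain ⟨K, hK, hres⟩ := hb.exists_residual_le (c := c) (σ := 1 / 2) (by norm_num)
  have hint : ∀ (w : L2t (Ioo 0 T) (H1p L)) (φ : ℝ → ℂ), IsTest φ → Integrable fun y : ℝ =>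
      lap (-vline 1 y) φ • residual L c d₁ bhat (zext T F) (zext T w) (vline 1 y) := by
    intro w φ hφ
    obtain ⟨D, hD, b⟩ := (compL2_zext_Lp w).exists_norm_lap_le'
    refine integrable_lap_smul hφ (p := residual L c d₁ bhat (zext T F) (zext T w))
      (hb.differentiableOn_residual (fun σ _ => cF.wInt σ)
        (fun σ _ => (compL2_zext_Lp w).wInt σ)).continuousOn one_pos
      (K := K * max D D₃) (by positivity) 2 fun s hs => ?_
    rw [mul_right_comm]
    exact hres _ _ s (max D D₃) (by rw [hs]; norm_num)
      ((b₃ s (by rw [hs]; norm_num)).trans (le_max_right _ _))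
      ((b s (by rw [hs]; norm_num)).trans (le_max_left _ _))
  have hzero : ∀ {θ : ℝ → ℂ}, IsTest θ → tsupport θ ⊆ Iio T →
      ∫ t, θ t • (zext T w₁ t - zext T w₂ t) = 0 := by
    refine fun hθ hs => hb.integral_smul_eq_zero hL hc hw (fun φ hφ hs => ?_) hθ hs
    -- The source cancels in the difference of the residuals.
    have e := h₁ φ hφ hs
    rw [← sub_eq_zero.2 (e.trans (h₂ φ hφ hs).symm), ← integral_sub (hint w₁ φ hφ) (hint w₂ φ hφ)]
    refine integral_congr_ae (ae_of_all _ fun y => ?_)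
    simp only [residual, hlap, map_sub]
    rw [← smul_sub, sub_sub_sub_cancel_right]
  have hae := ae_eq_zero_of_test isOpen_Iio
    (hw.integrable.locallyIntegrable.locallyIntegrableOn _) fun θ hθ hs => hzero hθ hs
  refine Lp.ext ?_
  rw [EventuallyEq, ae_restrict_iff' measurableSet_Ioo]
  filter_upwards [hae] with t ht hm
  have := ht hm.2
  simp only [zext, indicator_of_mem hm] at this
  exact sub_eq_zero.1 this

end Uniqueness

/-! ### Causal Fourier multipliers -/

section Multiplier

lemma CompL2.mono {E : Type*} [NormedAddCommGroup E] {R R' : ℝ} {g : ℝ → E} (h : CompL2 R g)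
    (hR : R ≤ R') : CompL2 R' g := by
  refine ⟨h.memLp, ?_⟩
  filter_upwards [h.zero] with t ht hm using ht fun hm' => hm ⟨hm'.1, hm'.2.trans hR⟩

lemma CompL2.sub {E : Type*} [NormedAddCommGroup E] {R : ℝ} {g h : ℝ → E} (hg : CompL2 R g)
    (hh : CompL2 R h) : CompL2 R (fun t => g t - h t) := by
  refine ⟨hg.memLp.sub hh.memLp, ?_⟩
  filter_upwards [hg.zero, hh.zero] with t h1 h2 hm
  rw [h1 hm, h2 hm, sub_zero]

lemma compL2_zero {E : Type*} [NormedAddCommGroup E] (R : ℝ) : CompL2 R (fun _ => (0 : E)) :=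
  ⟨MemLp.zero, ae_of_all _ fun _ _ => rfl⟩

variable {E V : Type*} [NormedAddCommGroup E] [NormedSpace ℂ E]
  [NormedAddCommGroup V] [InnerProductSpace ℂ V]

/-- An analytic operator-valued symbol on the right half plane that is bounded away from the
imaginary axis. -/
structure IsMultiplier (Φ : ℂ → E →L[ℂ] V) : Prop where
  differentiableOn : DifferentiableOn ℂ Φ halfPlane
  bounded : ∀ σ₀ : ℝ, 0 < σ₀ → ∃ C : NNReal, ∀ s : ℂ, σ₀ < s.re → ∀ f, ‖Φ s f‖ ≤ C * ‖f‖

/-- `w` is the function whose Laplace transform is `Φ(s)` applied to the transform of `F`. -/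
structure IsSol (Φ : ℂ → E →L[ℂ] V) (F : ℝ → E) (w : ℝ → V) : Prop where
  locallyIntegrable : LocallyIntegrable w
  pairing : ∀ θ : ℝ → ℂ, IsTest θ → ∫ t, θ t • w t
    = ∫ ξ : ℝ, lap (-vline 1 ξ) θ • Φ (vline 1 ξ) (lap (vline 1 ξ) F)

variable {Φ : ℂ → E →L[ℂ] V} {R : ℝ} {F : ℝ → E}

lemma IsMultiplier.differentiableOn_apply (hΦ : IsMultiplier Φ) (hF : CompL2 R F) :
    DifferentiableOn ℂ (fun s => Φ s (lap s F)) halfPlane :=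
  hΦ.differentiableOn.clm_apply hF.differentiableOn_lap

lemma IsMultiplier.exists_apply_le (hΦ : IsMultiplier Φ) (hF : CompL2 R F) {a : ℝ}
    (h0 : ∀ᵐ t : ℝ, t < a → F t = 0) {σ₀ : ℝ} (hσ₀ : 0 < σ₀) :
    ∃ K : ℝ, 0 ≤ K ∧ ∀ s : ℂ, σ₀ < s.re → ‖Φ s (lap s F)‖ ≤ K * Real.exp (-a * s.re) := by
  obtain ⟨C, hC⟩ := hΦ.bounded σ₀ hσ₀
  obtain ⟨D, hD, h⟩ := hF.exists_norm_lap_le h0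
  refine ⟨C * D, by positivity, fun s hs => (hC s hs _).trans ?_⟩
  rw [mul_assoc]
  gcongr
  exact h s (by linarith)

lemma IsMultiplier.exists_apply_le' (hΦ : IsMultiplier Φ) (hF : CompL2 R F) {σ₀ : ℝ}
    (hσ₀ : 0 < σ₀) : ∃ K : ℝ, 0 ≤ K ∧ ∀ s : ℂ, σ₀ < s.re → ‖Φ s (lap s F)‖ ≤ K := by
  obtain ⟨K, hK, h⟩ := hΦ.exists_apply_le hF hF.zero_neg hσ₀
  exact ⟨K, hK, fun s hs => by simpa using h s hs⟩

lemma IsMultiplier.integrable_apply (hΦ : IsMultiplier Φ) (hF : CompL2 R F) {σ : ℝ} (hσ : 0 < σ)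
    {θ : ℝ → ℂ} (hθ : IsTest θ) :
    Integrable fun ξ : ℝ => lap (-vline σ ξ) θ • Φ (vline σ ξ) (lap (vline σ ξ) F) := by
  obtain ⟨K, hK, h⟩ := hΦ.exists_apply_le' hF (half_pos hσ)
  exact integrable_lap_smul hθ (hΦ.differentiableOn_apply hF).continuousOn hσ hK 0 fun s hs => by
    simpa using h s (by linarith)

/-- The abscissa `1` in `IsSol` is immaterial, so one solution inherits the Plancherel estimates of
all lines. -/
lemma IsMultiplier.integral_apply_eq (hΦ : IsMultiplier Φ) (hF : CompL2 R F) {σ τ : ℝ} (hσ : 0 < σ)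
    (hτ : 0 < τ) {θ : ℝ → ℂ} (hθ : IsTest θ) :
    ∫ ξ : ℝ, lap (-vline σ ξ) θ • Φ (vline σ ξ) (lap (vline σ ξ) F)
      = ∫ ξ : ℝ, lap (-vline τ ξ) θ • Φ (vline τ ξ) (lap (vline τ ξ) F) := by
  wlog h : σ ≤ τ generalizing σ τ
  · exact (this hτ hσ (not_le.1 h).le).symm
  obtain ⟨K, hK, hb⟩ := hΦ.exists_apply_le' hF (half_pos hσ)
  exact integral_lap_smul_shift hθ (hΦ.differentiableOn_apply hF) hσ h hK 0 fun s h1 _ => by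
    simpa using hb s (by linarith)

/-- The solution at times `t < a` depends on the source at these times only. -/
lemma IsSol.ae_eq [CompleteSpace V] (hΦ : IsMultiplier Φ) {F₁ F₂ : ℝ → E} {w₁ w₂ : ℝ → V}
    (h₁ : IsSol Φ F₁ w₁) (h₂ : IsSol Φ F₂ w₂) (hF₁ : CompL2 R F₁) (hF₂ : CompL2 R F₂) {a : ℝ}
    (h : ∀ᵐ t : ℝ, t < a → F₁ t = F₂ t) : ∀ᵐ t : ℝ, t < a → w₁ t = w₂ t := by
  have hF := hF₁.sub hF₂
  have h0 : ∀ᵐ t : ℝ, t < a → F₁ t - F₂ t = 0 := by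
    filter_upwards [h] with t ht hta
    rw [ht hta, sub_self]
  have hlap : ∀ s : ℂ, lap s (fun t => F₁ t - F₂ t) = lap s F₁ - lap s F₂ := by
    intro s
    simp only [lap, smul_sub]
    exact integral_sub (hF₁.wInt _).integrable (hF₂.wInt _).integrable
  have hz := ae_eq_zero_of_test (g := fun t => w₁ t - w₂ t) (isOpen_Iio (a := a))
    ((h₁.locallyIntegrable.sub h₂.locallyIntegrable).locallyIntegrableOn _) ?_
  · filter_upwards [hz] with t ht hta using sub_eq_zero.1 (ht hta)
  intro θ hθ hs
  have hi : ∀ {w : ℝ → V}, LocallyIntegrable w → Integrable fun t => θ t • w t := fun hw =>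
    hw.integrable_smul_left_of_hasCompactSupport hθ.1.continuous hθ.2
  obtain ⟨b, hba, hbs⟩ := hθ.exists_tsupport_subset hs
  obtain ⟨K, hK, hb⟩ := hΦ.exists_apply_le hF h0 (σ₀ := 1 / 2) (by norm_num)
  simp only [smul_sub]
  rw [integral_sub (hi h₁.locallyIntegrable) (hi h₂.locallyIntegrable), h₁.pairing θ hθ,
    h₂.pairing θ hθ, ← integral_sub (hΦ.integrable_apply hF₁ one_pos hθ)
      (hΦ.integrable_apply hF₂ one_pos hθ)]
  have key := integral_lap_smul_eq_zero hθ hbs (hΦ.differentiableOn_apply hF) one_pos hK 0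
    fun s hs => by
      refine (hb s (by linarith)).trans ?_
      rw [pow_zero, mul_one]
      have : -a * s.re ≤ -b * s.re := by nlinarith
      gcongr
  rw [← key]
  refine integral_congr_ae (ae_of_all _ fun ξ => ?_)
  simp only [hlap, map_sub, smul_sub]

lemma IsSol.zero (Φ : ℂ → E →L[ℂ] V) : IsSol Φ (fun _ => 0) (fun _ => 0) :=
  ⟨locallyIntegrable_zero, fun θ _ => by simp [lap]⟩

lemma IsSol.zero_neg [CompleteSpace V] (hΦ : IsMultiplier Φ) {w : ℝ → V} (h : IsSol Φ F w)
    (hF : CompL2 R F) : ∀ᵐ t : ℝ, t < 0 → w t = 0 :=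
  h.ae_eq hΦ (IsSol.zero Φ) hF (compL2_zero R) hF.zero_neg

lemma IsSol.ae_eq_all [CompleteSpace V] (hΦ : IsMultiplier Φ) {w₁ w₂ : ℝ → V} (h₁ : IsSol Φ F w₁)
    (h₂ : IsSol Φ F w₂) (hF : CompL2 R F) : w₁ =ᵐ[volume] w₂ := by
  have : ∀ᵐ t : ℝ, ∀ n : ℕ, t < n → w₁ t = w₂ t := ae_all_iff.2 fun n =>
    h₁.ae_eq hΦ h₂ hF hF (ae_of_all _ fun _ _ => rfl)
  filter_upwards [this] with t ht
  obtain ⟨n, hn⟩ := exists_nat_gt t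
  exact ht n hn

end Multiplier

/-! ### Existence by Plancherel and weighted estimates. -/

section Existence

variable {E V : Type*} [NormedAddCommGroup E] [InnerProductSpace ℂ E] [CompleteSpace E]
  [NormedAddCommGroup V] [InnerProductSpace ℂ V] [CompleteSpace V]
  {Φ : ℂ → E →L[ℂ] V} {R : ℝ} {F : ℝ → E}

lemma exp_smul_exp_neg_smul {W : Type*} [AddCommGroup W] [Module ℂ W] (σ t : ℝ) (v : W) :
    (Real.exp (-σ * t) : ℂ) • (Real.exp (σ * t) : ℂ) • v = v := by
  rw [smul_smul, ← Complex.ofReal_mul, ← Real.exp_add]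
  simp

/-- Existence by the Fourier transform on the line `Re s = σ`, with Plancherel's estimate. -/
lemma IsMultiplier.exists_isSol_line (hΦ : IsMultiplier Φ) (hF : CompL2 R F) {σ : ℝ} (hσ : 0 < σ)
    {C : NNReal} (hC : ∀ s : ℂ, s.re = σ → ∀ f, ‖Φ s f‖ ≤ C * ‖f‖) :
    ∃ w : ℝ → V, IsSol Φ F w ∧ MemLp (fun t => (Real.exp (-σ * t) : ℂ) • w t) 2 ∧
      eLpNorm (fun t => (Real.exp (-σ * t) : ℂ) • w t) 2 volume
        ≤ C * eLpNorm (fun t => (Real.exp (-σ * t) : ℂ) • F t) 2 volume ∧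
      (WInt σ w → ∀ᵐ ξ : ℝ, lap (vline σ ξ) w = Φ (vline σ ξ) (lap (vline σ ξ) F)) := by
  have hf := hF.smul (a := fun t => (Real.exp (-σ * t) : ℂ)) (by fun_prop)
  set f : ℝ → E := fun t => (Real.exp (-σ * t) : ℂ) • F t with hfdef
  have hff := fourier_toLp_ae_eq hf.memLp hf.integrable
  set v : ℝ → V := fun ξ => Φ (vline σ ξ) (lap (vline σ ξ) F) with hv
  have hvm : AEStronglyMeasurable v := by
    refine Continuous.aestronglyMeasurable ?_
    exact (hΦ.differentiableOn_apply hF).continuousOn.comp_continuous (continuous_vline σ)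
      fun ξ => by simpa [halfPlane] using hσ
  have hvle : ∀ᵐ ξ : ℝ, ‖v ξ‖ ≤ C * ‖(𝓕 (hf.memLp.toLp f) : Lp E 2 (volume : Measure ℝ)) ξ‖ := by
    filter_upwards [hff] with ξ hξ
    rw [hξ, ← lap_vline]
    exact hC _ (vline_re _ _) _
  have hv2 : MemLp v 2 := MemLp.of_le_mul (Lp.memLp _) hvm hvle
  have hvn : ‖hv2.toLp v‖ ≤ C * ‖hf.memLp.toLp f‖ := by
    rw [← Lp.norm_fourier_eq (hf.memLp.toLp f)]
    refine Lp.norm_le_mul_norm_of_ae_le_mul ?_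
    filter_upwards [hv2.coeFn_toLp, hvle] with ξ h1 h2
    rw [h1]; exact h2
  -- The solution is `e^{σt} u`, and Plancherel transfers the pointwise bound on `v` to `u` with the
  -- same constant. The identity of the transforms needs `WInt σ w`, which is not known yet and will
  -- follow from causality.
  set u : Lp V 2 (volume : Measure ℝ) := 𝓕⁻ (hv2.toLp v) with hu
  have hFu : 𝓕 u = hv2.toLp v := FourierTransform.fourier_fourierInv_eq _
  have hun : ‖u‖ ≤ C * ‖hf.memLp.toLp f‖ := by
    rw [← Lp.norm_fourier_eq u, hFu]; exact hvn
  have hcancel : (fun t : ℝ => (Real.exp (-σ * t) : ℂ) • (Real.exp (σ * t) : ℂ) • u t) = u := by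
    ext t; exact exp_smul_exp_neg_smul _ _ _
  refine ⟨fun t => (Real.exp (σ * t) : ℂ) • u t, ⟨?_, fun θ hθ => ?_⟩, ?_, ?_, fun hw => ?_⟩
  · have : LocallyIntegrable u := (Lp.memLp u).locallyIntegrable (by norm_num)
    exact this.continuous_smul (by fun_prop)
  · rw [hΦ.integral_apply_eq hF one_pos hσ hθ]
    have hθ' : IsTest (fun t => (Real.exp (σ * t) : ℂ) * θ t) :=
      hθ.smooth_mul (contDiff_rexp_mul σ)
    have h1 := integral_smul_fourierInv_eq (hv2.toLp v) hθ'
    have h2 : ∀ t : ℝ, θ t • (Real.exp (σ * t) : ℂ) • u t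
        = ((Real.exp (σ * t) : ℂ) * θ t) • u t := fun t => by rw [smul_smul, mul_comm]
    simp only [h2]
    rw [h1]
    refine integral_congr_ae ?_
    filter_upwards [hv2.coeFn_toLp] with ξ hξ
    rw [hξ, lap_neg_vline]
    rfl
  · rw [hcancel]; exact Lp.memLp u
  · rw [hcancel, ← eLpNorm_congr_ae hf.memLp.coeFn_toLp, ← Lp.enorm_def, ← Lp.enorm_def]
    rw [← ofReal_norm, ← ofReal_norm, ← ENNReal.ofReal_coe_nnreal, ← ENNReal.ofReal_mul C.coe_nonneg]
    exact ENNReal.ofReal_le_ofReal hun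
  · rw [WInt, hcancel] at hw
    have h3 := fourier_toLp_ae_eq (Lp.memLp u) hw
    rw [Lp.toLp_coeFn, hFu] at h3
    filter_upwards [h3, hv2.coeFn_toLp] with ξ h4 h5
    rw [lap_vline, hcancel, ← h4, h5]

/-- The solution exists and is bounded in all weighted spaces. -/
lemma IsMultiplier.exists_isSol (hΦ : IsMultiplier Φ) (hF : CompL2 R F) :
    ∃ w : ℝ → V, IsSol Φ F w := by
  obtain ⟨C, hC⟩ := hΦ.bounded (1 / 2) (by norm_num)
  obtain ⟨w, hw, -⟩ := hΦ.exists_isSol_line hF one_pos fun s hs => hC s (by rw [hs]; norm_num)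
  exact ⟨w, hw⟩

/-- The solutions built on different lines coincide, so `w` obeys Plancherel's estimate on every
line, each with the constant of that line. -/
lemma IsSol.memLp_and_le (hΦ : IsMultiplier Φ) {w : ℝ → V} (hw : IsSol Φ F w) (hF : CompL2 R F)
    {σ : ℝ} (hσ : 0 < σ) {C : NNReal} (hC : ∀ s : ℂ, s.re = σ → ∀ f, ‖Φ s f‖ ≤ C * ‖f‖) :
    MemLp (fun t => (Real.exp (-σ * t) : ℂ) • w t) 2 ∧
      eLpNorm (fun t => (Real.exp (-σ * t) : ℂ) • w t) 2 volume
        ≤ C * eLpNorm (fun t => (Real.exp (-σ * t) : ℂ) • F t) 2 volume := by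
  obtain ⟨w', hw', h1, h2, -⟩ := hΦ.exists_isSol_line hF hσ hC
  have he : (fun t => (Real.exp (-σ * t) : ℂ) • w' t) =ᵐ[volume]
      fun t => (Real.exp (-σ * t) : ℂ) • w t := by
    filter_upwards [hw'.ae_eq_all hΦ hw hF] with t ht
    rw [ht]
  exact ⟨h1.ae_eq he, by rwa [← eLpNorm_congr_ae he]⟩

lemma IsSol.memLp (hΦ : IsMultiplier Φ) {w : ℝ → V} (hw : IsSol Φ F w) (hF : CompL2 R F)
    {σ : ℝ} (hσ : 0 < σ) : MemLp (fun t => (Real.exp (-σ * t) : ℂ) • w t) 2 := by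
  obtain ⟨C, hC⟩ := hΦ.bounded (σ / 2) (by positivity)
  exact (hw.memLp_and_le hΦ hF hσ fun s hs => hC s (by rw [hs]; linarith)).1

/-- Cauchy–Schwarz: `w` vanishes for `t < 0` and `e^{-σt/2}` is square integrable on `(0, ∞)`, so
weighted `L²` at `σ/2` gives weighted `L¹` at `σ`. -/
lemma IsSol.wInt (hΦ : IsMultiplier Φ) {w : ℝ → V} (hw : IsSol Φ F w) (hF : CompL2 R F)
    {σ : ℝ} (hσ : 0 < σ) : WInt σ w := by
  have h1 := hw.memLp hΦ hF (half_pos hσ)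
  have h2 : MemLp ((Ioi 0).indicator fun t : ℝ => (Real.exp (-(σ / 2) * t) : ℂ)) 2 := by
    rw [memLp_indicator_iff_restrict measurableSet_Ioi, memLp_two_iff_integrable_sq_norm
      (Continuous.aestronglyMeasurable (by fun_prop))]
    refine (integrableOn_exp_mul_Ioi (a := -σ) (by linarith) 0).congr (ae_of_all _ fun t => ?_)
    simp only [Complex.norm_real, Real.norm_of_nonneg (Real.exp_pos _).le, ← Real.exp_nat_mul]
    congr 1
    push_cast; ring
  have h3 := memLp_one_iff_integrable.1 (h1.smul (r := 1) h2)
  refine h3.congr ?_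
  filter_upwards [hw.zero_neg hΦ hF, compl_mem_ae_iff.2 (measure_singleton (0 : ℝ))] with t ht h0
  rcases lt_or_gt_of_ne h0 with h | h
  · simp [ht h]
  · simp only [Pi.smul_apply', indicator_of_mem (mem_Ioi.2 h), smul_smul, ← Complex.ofReal_mul,
      ← Real.exp_add]
    congr 3
    ring

lemma IsSol.lap_eq (hΦ : IsMultiplier Φ) {w : ℝ → V} (hw : IsSol Φ F w) (hF : CompL2 R F) :
    ∀ᵐ ξ : ℝ, lap (vline 1 ξ) w = Φ (vline 1 ξ) (lap (vline 1 ξ) F) := by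
  obtain ⟨C, hC⟩ := hΦ.bounded (1 / 2) (by norm_num)
  obtain ⟨w', hw', -, -, h⟩ := hΦ.exists_isSol_line hF one_pos
    fun s hs => hC s (by rw [hs]; norm_num)
  filter_upwards [h (hw'.wInt hΦ hF one_pos)] with ξ hξ
  rw [← hξ, lap_congr (hw.ae_eq_all hΦ hw' hF)]

end Existence

/-! ### Weak derivatives in time -/

section WeakDeriv

variable {E : Type*} [NormedAddCommGroup E] [InnerProductSpace ℂ E]

lemma isWeakDeriv_univ_iff {j : ℕ} {g h : ℝ → E} : IsWeakDeriv univ j g h ↔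
    ∀ φ : ℝ → ℂ, IsTest φ → ∫ t, iteratedDeriv j φ t • g t = (-1 : ℂ) ^ j • ∫ t, φ t • h t := by
  simp [IsWeakDeriv]

lemma isWeakDeriv_one_iff {g h : ℝ → E} : IsWeakDeriv univ 1 g h ↔
    ∀ φ : ℝ → ℂ, IsTest φ → ∫ t, deriv φ t • g t = -∫ t, φ t • h t := by
  simp [isWeakDeriv_univ_iff]

lemma isWeakDeriv_zero (g : ℝ → E) : IsWeakDeriv univ 0 g g := by
  simp [isWeakDeriv_univ_iff]

lemma IsWeakDeriv.trans {j : ℕ} {g h k : ℝ → E} (h₁ : IsWeakDeriv univ 1 g h)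
    (h₂ : IsWeakDeriv univ j h k) : IsWeakDeriv univ (j + 1) g k := by
  rw [isWeakDeriv_one_iff] at h₁
  rw [isWeakDeriv_univ_iff] at h₂ ⊢
  intro φ hφ
  rw [iteratedDeriv_succ, h₁ _ (hφ.iteratedDeriv j), h₂ φ hφ, pow_succ]
  simp

lemma IsWeakDeriv.of_succ {j : ℕ} {g h k : ℝ → E} (h₁ : IsWeakDeriv univ 1 g h)
    (h₂ : IsWeakDeriv univ (j + 1) g k) : IsWeakDeriv univ j h k := by
  rw [isWeakDeriv_one_iff] at h₁
  rw [isWeakDeriv_univ_iff] at h₂ ⊢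
  intro φ hφ
  have e := h₂ φ hφ
  rw [iteratedDeriv_succ, h₁ _ (hφ.iteratedDeriv j), pow_succ] at e
  simpa using e

lemma setIntegral_smul_eq {I : Set ℝ} {θ : ℝ → ℂ} (hs : tsupport θ ⊆ I) (g : ℝ → E) :
    ∫ t in I, θ t • g t = ∫ t, θ t • g t :=
  setIntegral_eq_integral_of_forall_compl_eq_zero fun t ht => by
    rw [image_eq_zero_of_notMem_tsupport fun h => ht (hs h), zero_smul]

lemma IsWeakDeriv.restrict {I : Set ℝ} {j : ℕ} {g h : ℝ → E} (H : IsWeakDeriv univ j g h) :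
    IsWeakDeriv I j g h := by
  intro φ hφ hs
  rw [isWeakDeriv_univ_iff] at H
  rw [setIntegral_smul_eq hs, setIntegral_smul_eq ((tsupport_iteratedDeriv_subset' φ j).trans hs)]
  exact H φ hφ

lemma IsWeakDeriv.congr {I : Set ℝ} {j : ℕ} {g g' h h' : ℝ → E} (H : IsWeakDeriv I j g h)
    (hg : g =ᵐ[volume.restrict I] g') (hh : h =ᵐ[volume.restrict I] h') :
    IsWeakDeriv I j g' h' := by
  intro φ hφ hs
  have e1 : ∫ t in I, iteratedDeriv j φ t • g' t = ∫ t in I, iteratedDeriv j φ t • g t :=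
    integral_congr_ae (by filter_upwards [hg] with t ht; rw [ht])
  have e2 : ∫ t in I, φ t • h' t = ∫ t in I, φ t • h t :=
    integral_congr_ae (by filter_upwards [hh] with t ht; rw [ht])
  rw [e1, e2]
  exact H φ hφ hs

lemma locallyIntegrableOn_of_memLp {E : Type*} [NormedAddCommGroup E] {I : Set ℝ} {g : ℝ → E}
    (hg : MemLp g 2 (volume.restrict I)) : LocallyIntegrableOn g I := by
  intro x _
  refine ⟨I ∩ Metric.closedBall x 1, inter_mem_nhdsWithin _ (Metric.closedBall_mem_nhds x one_pos), ?_⟩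
  have hfin : IsFiniteMeasure ((volume.restrict I).restrict (Metric.closedBall x 1)) :=
    ⟨by
      rw [Measure.restrict_apply_univ]
      exact (Measure.restrict_apply_le I _).trans_lt
        (isCompact_closedBall x 1).measure_lt_top⟩
  have := (hg.restrict (Metric.closedBall x 1)).integrable (by norm_num)
  rwa [Measure.restrict_restrict Metric.isClosed_closedBall.measurableSet, inter_comm] at this

lemma IsWeakDeriv.unique [CompleteSpace E] {I : Set ℝ} (hI : IsOpen I) {j : ℕ} {g h k : ℝ → E}
    (h₁ : IsWeakDeriv I j g h) (h₂ : IsWeakDeriv I j g k) (hh : MemLp h 2 (volume.restrict I))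
    (hk : MemLp k 2 (volume.restrict I)) : h =ᵐ[volume.restrict I] k := by
  have hloc : ∀ {f : ℝ → E} {θ : ℝ → ℂ}, MemLp f 2 (volume.restrict I) → IsTest θ →
      IntegrableOn (fun t => θ t • f t) I := fun hf hθ => by
    have h2 : MemLp _ 2 (volume.restrict I) :=
      (hθ.1.continuous.memLp_of_hasCompactSupport hθ.2)
    exact memLp_one_iff_integrable.1 (hf.smul (r := 1) h2)
  have hz := ae_eq_zero_of_test (g := fun t => h t - k t) hI
    (locallyIntegrableOn_of_memLp (hh.sub hk)) fun θ hθ hs => by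
      rw [← setIntegral_smul_eq hs]
      simp only [smul_sub]
      rw [integral_sub (hloc hh hθ) (hloc hk hθ), sub_eq_zero]
      have e := (h₁ θ hθ hs).symm.trans (h₂ θ hθ hs)
      exact smul_right_injective _ (pow_ne_zero j (by norm_num : (-1 : ℂ) ≠ 0)) e
  rw [EventuallyEq, ae_restrict_iff' hI.measurableSet]
  filter_upwards [hz] with t ht hm using sub_eq_zero.1 (ht hm)

/-- `g ∈ L²(ℝ, E)` vanishes for `t < 0`. -/
structure CausalL2 {E : Type*} [NormedAddCommGroup E] (g : ℝ → E) : Prop where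
  memLp : MemLp g 2 volume
  zero_neg : ∀ᵐ t : ℝ, t < 0 → g t = 0

/-- `g` and its weak derivatives up to order `m` exist and have the property `P`. -/
def HasChain (P : (ℝ → E) → Prop) : ℕ → (ℝ → E) → Prop
  | 0, g => P g
  | m + 1, g => P g ∧ ∃ h, IsWeakDeriv univ 1 g h ∧ HasChain P m h

lemma HasChain.self {P : (ℝ → E) → Prop} {m : ℕ} {g : ℝ → E} (h : HasChain P m g) : P g := by
  cases m with
  | zero => exact h
  | succ m => exact h.1

lemma HasChain.of_succ {P : (ℝ → E) → Prop} {m : ℕ} {g : ℝ → E} (h : HasChain P (m + 1) g) :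
    HasChain P m g := by
  induction m generalizing g with
  | zero => exact h.1
  | succ m ih =>
    obtain ⟨hg, k, h1, h2⟩ := h
    exact ⟨hg, k, h1, ih h2⟩

lemma IsWeakDeriv.zero_neg [CompleteSpace E] {j : ℕ} {g h : ℝ → E} (H : IsWeakDeriv univ j g h)
    (hg : ∀ᵐ t : ℝ, t < 0 → g t = 0) (hh : LocallyIntegrable h) :
    ∀ᵐ t : ℝ, t < 0 → h t = 0 := by
  refine ae_eq_zero_of_test isOpen_Iio (hh.locallyIntegrableOn _) fun θ hθ hs => ?_
  rw [isWeakDeriv_univ_iff] at H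
  have e := H θ hθ
  rw [integral_eq_zero_of_ae, eq_comm, smul_eq_zero_iff_right (pow_ne_zero j (by norm_num))] at e
  · exact e
  · filter_upwards [hg] with t ht
    by_cases h0 : t < 0
    · simp [ht h0]
    · have : t ∉ tsupport (iteratedDeriv j θ) := fun hm =>
        h0 (hs (tsupport_iteratedDeriv_subset' θ j hm))
      rw [image_eq_zero_of_notMem_tsupport this, zero_smul]; rfl

/-- `MemH` gives the derivative of each order separately. The product rule and the solution operator
act on one derivative at a time, so they need successive first derivatives, which inherit the
vanishing for `t < 0`. -/
lemma MemH.hasChain [CompleteSpace E] {m : ℕ} {g : ℝ → E} (h : MemH m univ g)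
    (h0 : ∀ᵐ t : ℝ, t < 0 → g t = 0) : HasChain CausalL2 m g := by
  induction m generalizing g with
  | zero => exact ⟨by simpa using h.1, h0⟩
  | succ m ih =>
    refine ⟨⟨by simpa using h.1, h0⟩, ?_⟩
    obtain ⟨k, hk⟩ := h.2 1 (by omega)
    have hk2 : MemLp k 2 (volume.restrict univ) := Lp.memLp k
    have hk2' : MemLp k 2 volume := by simpa using hk2
    refine ⟨k, hk, ih ⟨hk2, fun j hj => ?_⟩
      (hk.zero_neg h0 (hk2'.locallyIntegrable (by norm_num)))⟩
    obtain ⟨l, hl⟩ := h.2 (j + 1) (by omega)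
    exact ⟨l, hk.of_succ hl⟩

lemma memH_of_exists {m : ℕ} {g : ℝ → E} (hg : MemLp g 2 volume)
    (h : ∀ j ≤ m, ∃ k, MemLp k 2 volume ∧ IsWeakDeriv univ j g k) : MemH m univ g := by
  refine ⟨by simpa using hg, fun j hj => ?_⟩
  obtain ⟨k, hk, hw⟩ := h j hj
  have hk' : MemLp k 2 (volume.restrict univ) := by simpa using hk
  exact ⟨hk'.toLp k, hw.congr (ae_eq_refl _) hk'.coeFn_toLp.symm⟩

lemma HasChain.exists_isWeakDeriv {P : (ℝ → E) → Prop} {m : ℕ} {g : ℝ → E} (h : HasChain P m g)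
    {j : ℕ} (hj : j ≤ m) : ∃ k, P k ∧ IsWeakDeriv univ j g k := by
  induction j generalizing m g with
  | zero => exact ⟨g, h.self, isWeakDeriv_zero g⟩
  | succ j ih =>
    obtain ⟨m, rfl⟩ : ∃ n, m = n + 1 := ⟨m - 1, by omega⟩
    obtain ⟨-, k, h1, h2⟩ := h
    obtain ⟨l, hl, hl'⟩ := ih h2 (by omega)
    exact ⟨l, hl, h1.trans hl'⟩

lemma integrable_test_smul {g : ℝ → E} (hg : LocallyIntegrable g) {θ : ℝ → ℂ} (hθ : IsTest θ) :
    Integrable fun t => θ t • g t :=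
  hg.integrable_smul_left_of_hasCompactSupport hθ.1.continuous hθ.2

lemma IsWeakDeriv.add {g h g' h' : ℝ → E} (hg : LocallyIntegrable g) (hh : LocallyIntegrable h)
    (hg' : LocallyIntegrable g') (hh' : LocallyIntegrable h') (H : IsWeakDeriv univ 1 g g')
    (H' : IsWeakDeriv univ 1 h h') :
    IsWeakDeriv univ 1 (fun t => g t + h t) (fun t => g' t + h' t) := by
  rw [isWeakDeriv_one_iff] at *
  intro φ hφ
  simp only [smul_add]
  rw [integral_add (integrable_test_smul hg hφ.deriv) (integrable_test_smul hh hφ.deriv),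
    integral_add (integrable_test_smul hg' hφ) (integrable_test_smul hh' hφ), H φ hφ, H' φ hφ]
  abel

lemma IsWeakDeriv.smul {g h : ℝ → E} {a : ℝ → ℂ} (ha : IsTest a) (hg : LocallyIntegrable g)
    (hh : LocallyIntegrable h) (H : IsWeakDeriv univ 1 g h) :
    IsWeakDeriv univ 1 (fun t => a t • g t) (fun t => deriv a t • g t + a t • h t) := by
  rw [isWeakDeriv_one_iff] at *
  intro φ hφ
  have e := H _ (hφ.smooth_mul ha.1)
  have hd : ∀ t, deriv (fun t => a t * φ t) t = deriv a t * φ t + a t * deriv φ t := fun t =>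
    deriv_fun_mul (ha.1.differentiable (by simp) t) (hφ.1.differentiable (by simp) t)
  simp only [hd, add_smul] at e
  have i1 : Integrable fun t => (deriv a t * φ t) • g t :=
    integrable_test_smul hg (hφ.smooth_mul ha.deriv.1)
  have i2 : Integrable fun t => (a t * deriv φ t) • g t :=
    integrable_test_smul hg (hφ.deriv.smooth_mul ha.1)
  have i3 : Integrable fun t => (a t * φ t) • h t :=
    integrable_test_smul hh (hφ.smooth_mul ha.1)
  rw [integral_add i1 i2] at e
  simp only [smul_add, smul_smul]
  simp only [mul_comm (φ _), mul_comm (deriv φ _)]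
  rw [integral_add i1 i3, eq_sub_of_add_eq' e]
  abel

lemma CompL2.add {E : Type*} [NormedAddCommGroup E] {R : ℝ} {g h : ℝ → E} (hg : CompL2 R g) (hh : CompL2 R h) :
    CompL2 R (fun t => g t + h t) := by
  refine ⟨hg.memLp.add hh.memLp, ?_⟩
  filter_upwards [hg.zero, hh.zero] with t h1 h2 hm
  rw [h1 hm, h2 hm, add_zero]

lemma HasChain.add {R : ℝ} {m : ℕ} {g h : ℝ → E} (hg : HasChain (CompL2 R) m g)
    (hh : HasChain (CompL2 R) m h) : HasChain (CompL2 R) m (fun t => g t + h t) := by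
  induction m generalizing g h with
  | zero => exact CompL2.add hg hh
  | succ m ih =>
    refine ⟨hg.1.add hh.1, ?_⟩
    obtain ⟨k, h1, h2⟩ := hg.2
    obtain ⟨l, h3, h4⟩ := hh.2
    exact ⟨_, IsWeakDeriv.add hg.1.integrable.locallyIntegrable hh.1.integrable.locallyIntegrable
      h2.self.integrable.locallyIntegrable h4.self.integrable.locallyIntegrable h1 h3, ih h2 h4⟩

lemma CausalL2.compL2_smul {R : ℝ} {g : ℝ → E} (hg : CausalL2 g) {a : ℝ → ℂ} (ha : IsTest a)
    (hs : tsupport a ⊆ Iic R) : CompL2 R (fun t => a t • g t) := by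
  obtain ⟨C, hC⟩ := ha.1.continuous.bounded_above_of_compact_support ha.2
  refine ⟨MemLp.of_le_mul (c := C) hg.memLp
    (ha.1.continuous.aestronglyMeasurable.smul hg.memLp.1) (ae_of_all _ fun t => ?_), ?_⟩
  · rw [norm_smul]; gcongr; exact hC t
  · filter_upwards [hg.zero_neg] with t ht hm
    rcases lt_or_ge t 0 with h | h
    · simp [ht h]
    · have : t ∉ tsupport a := fun h' => hm ⟨h, hs h'⟩
      simp [image_eq_zero_of_notMem_tsupport this]

lemma CausalL2.locallyIntegrable {E : Type*} [NormedAddCommGroup E] {g : ℝ → E} (hg : CausalL2 g) : LocallyIntegrable g :=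
  hg.memLp.locallyIntegrable (by norm_num)

/-- Multiplication by a test function. -/
lemma HasChain.smul {R : ℝ} {m : ℕ} {g : ℝ → E} (hg : HasChain CausalL2 m g) {a : ℝ → ℂ}
    (ha : IsTest a) (hs : tsupport a ⊆ Iic R) : HasChain (CompL2 R) m (fun t => a t • g t) := by
  induction m generalizing g a with
  | zero => exact CausalL2.compL2_smul hg ha hs
  | succ m ih =>
    obtain ⟨k, h1, h2⟩ := hg.2
    -- The product rule yields a term with `deriv a`, so the induction runs over all test functions
    -- `a`.
    exact ⟨hg.self.compL2_smul ha hs, _, h1.smul ha hg.self.locallyIntegrable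
      h2.self.locallyIntegrable, (ih hg.of_succ ha.deriv ((tsupport_deriv_subset' a).trans hs)).add
        (ih h2 ha hs)⟩

lemma lap_exp_smul (s : ℂ) (σ : ℝ) (g : ℝ → E) :
    lap s (fun t => (Real.exp (σ * t) : ℂ) • g t) = lap (s - σ) g := by
  refine integral_congr_ae (ae_of_all _ fun t => ?_)
  simp only [smul_smul]
  rw [Complex.ofReal_exp, ← Complex.exp_add]
  congr 2
  push_cast; ring

/-- The transform of a weak derivative. -/
lemma IsWeakDeriv.lap_eq {R : ℝ} {g h : ℝ → E} (H : IsWeakDeriv univ 1 g h) (hg : CompL2 R g)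
    (hh : CompL2 R h) (z : ℂ) : lap z h = z • lap z g := by
  -- `e^{-zt}` lacks compact support. A cutoff equal to one near `[0, R]` makes it a test function
  -- without changing the integrals.
  obtain ⟨χ, hχ, hχc, hχ1, -⟩ := exists_cutoff (|R| + 1) (by positivity)
  have ht : IsTest (fun t : ℝ => Complex.exp (-z * t) * (χ t : ℂ)) :=
    (isTest_ofReal hχ hχc).smooth_mul (contDiff_exp_mul (-z))
  have e := (isWeakDeriv_one_iff.1 H) _ ht
  have h1 : ∀ t ∈ Icc 0 R, (fun t : ℝ => Complex.exp (-z * t) * (χ t : ℂ)) =ᶠ[𝓝 t]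
      fun t : ℝ => Complex.exp (-z * t) := by
    intro t ht
    have : Iio (|R| + 1) ∩ Ioi (-1) ∈ 𝓝 t :=
      (isOpen_Iio.inter isOpen_Ioi).mem_nhds
        ⟨by have := le_abs_self R; simp only [mem_Iio]; linarith [ht.2], by
          simp only [mem_Ioi]; linarith [ht.1]⟩
    filter_upwards [this] with r hr
    rw [hχ1 r (abs_le.2 ⟨by have := abs_nonneg R; linarith [mem_Ioi.1 hr.2], (mem_Iio.1 hr.1).le⟩)]
    simp
  have hd : ∀ t : ℝ, deriv (fun t : ℝ => Complex.exp (-z * t)) t = -z * Complex.exp (-z * t) := by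
    intro t
    have := (((hasDerivAt_id (t : ℂ)).const_mul (-z)).cexp).comp_ofReal
    simpa [mul_comm] using this.deriv
  have e1 : ∫ t : ℝ, deriv (fun t : ℝ => Complex.exp (-z * t) * (χ t : ℂ)) t • g t
      = -z • lap z g := by
    rw [lap, ← integral_smul]
    refine integral_congr_ae ?_
    filter_upwards [hg.zero] with t h0
    by_cases hm : t ∈ Icc 0 R
    · rw [(h1 t hm).deriv_eq, hd, smul_smul, neg_mul z (t : ℂ)]
    · simp [h0 hm]
  have e2 : ∫ t : ℝ, (Complex.exp (-z * t) * (χ t : ℂ)) • h t = lap z h := by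
    refine integral_congr_ae ?_
    filter_upwards [hh.zero] with t h0
    by_cases hm : t ∈ Icc 0 R
    · have := (h1 t hm).self_of_nhds
      simp only at this
      rw [this, neg_mul]
    · simp [h0 hm]
  rw [e1, e2, neg_smul, neg_inj] at e
  exact e.symm

end WeakDeriv

/-! ### Regularity and estimates of the solution -/

section Regularity

variable {E V : Type*} [NormedAddCommGroup E] [InnerProductSpace ℂ E] [CompleteSpace E]
  [NormedAddCommGroup V] [InnerProductSpace ℂ V] [CompleteSpace V]
  {Φ : ℂ → E →L[ℂ] V} {R T : ℝ}

/-- The solution operator commutes with derivatives. -/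
lemma IsSol.isWeakDeriv {E V : Type*} [NormedAddCommGroup E] [InnerProductSpace ℂ E]
    [NormedAddCommGroup V] [InnerProductSpace ℂ V] {Φ : ℂ → E →L[ℂ] V} {K K' : ℝ → E} {w w' : ℝ → V} {σ : ℝ}
    (h : IsSol Φ (fun t => (Real.exp (σ * t) : ℂ) • K t) w)
    (h' : IsSol Φ (fun t => (Real.exp (σ * t) : ℂ) • K' t) w') (hK : CompL2 R K)
    (hK' : CompL2 R K') (H : IsWeakDeriv univ 1 K K') :
    IsWeakDeriv univ 1 (fun t => (Real.exp (-σ * t) : ℂ) • w t)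
      (fun t => (Real.exp (-σ * t) : ℂ) • w' t) := by
  rw [isWeakDeriv_one_iff]
  intro θ hθ
  have e1 := h.pairing _ (hθ.deriv.smooth_mul (contDiff_rexp_mul (-σ)))
  have e2 := h'.pairing _ (hθ.smooth_mul (contDiff_rexp_mul (-σ)))
  -- The weights replace `s` by `s - σ` in the transforms of both the test function and the source,
  -- but not in `Φ(s)`. A derivative on either therefore gives the same factor up to sign.
  have e3 : ∀ (ξ : ℝ) (φ : ℝ → ℂ), lap (-vline 1 ξ) (fun t => (Real.exp (-σ * t) : ℂ) * φ t)
      = lap (-vline 1 ξ - (-σ : ℝ)) φ := fun ξ φ => lap_exp_smul _ _ φ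
  simp only [smul_smul, mul_comm (θ _), mul_comm (deriv θ _)]
  rw [e1, e2, ← integral_neg]
  refine integral_congr_ae (ae_of_all _ fun ξ => ?_)
  simp only [e3, lap_exp_smul, lap_deriv hθ, H.lap_eq hK hK', map_smul, smul_smul]
  rw [← neg_smul]
  congr 1
  push_cast; ring

/-- Each derivative of `e^{-σt} w` comes from solving with the corresponding derivative of `K`, so
it obeys the estimates for solutions and not merely a qualitative regularity statement. -/
lemma IsSol.exists_isWeakDeriv (hΦ : IsMultiplier Φ) {K : ℝ → E} {w : ℝ → V} {σ : ℝ} {m : ℕ}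
    (hK : HasChain (CompL2 R) m K) (h : IsSol Φ (fun t => (Real.exp (σ * t) : ℂ) • K t) w) {j : ℕ}
    (hj : j ≤ m) : ∃ (K' : ℝ → E) (w' : ℝ → V), CompL2 R K' ∧
      IsSol Φ (fun t => (Real.exp (σ * t) : ℂ) • K' t) w' ∧ IsWeakDeriv univ j K K' ∧
      IsWeakDeriv univ j (fun t => (Real.exp (-σ * t) : ℂ) • w t)
        (fun t => (Real.exp (-σ * t) : ℂ) • w' t) := by
  induction j generalizing m K w with
  | zero => exact ⟨K, w, hK.self, h, isWeakDeriv_zero _, isWeakDeriv_zero _⟩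
  | succ j ih =>
    obtain ⟨m, rfl⟩ : ∃ n, m = n + 1 := ⟨m - 1, by omega⟩
    obtain ⟨hK0, k, h1, h2⟩ := hK
    obtain ⟨v, hv⟩ := hΦ.exists_isSol
      (h2.self.smul (a := fun t => (Real.exp (σ * t) : ℂ)) (by fun_prop))
    obtain ⟨K', w', a1, a2, a3, a4⟩ := ih h2 hv (by omega)
    exact ⟨K', w', a1, a2, h1.trans a3, (h.isWeakDeriv hv hK0 h2.self h1).trans a4⟩

/-- A compactly supported modification of the source after time `T`, with its solution. -/
lemma exists_chain_isSol (hΦ : IsMultiplier Φ) {m : ℕ} (hT : 0 < T) {G : ℝ → E}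
    (hG : MemH m univ G) (h0 : ∀ᵐ t : ℝ, t < 0 → G t = 0) {F : ℝ → E}
    (hFG : G =ᵐ[volume.restrict (Ioo 0 T)] F) (hF : MemLp F 2 (volume.restrict (Ioo 0 T)))
    {w : ℝ → V} (hw : IsSol Φ (zext T F) w) (σ : ℝ) :
    ∃ (K : ℝ → E) (v : ℝ → V), HasChain (CompL2 (T + 1)) m K ∧
      IsSol Φ (fun t => (Real.exp (σ * t) : ℂ) • K t) v ∧
      (fun t => (Real.exp (-σ * t) : ℂ) • F t) =ᵐ[volume.restrict (Ioo 0 T)] K ∧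
      ∀ᵐ t : ℝ, t < T → v t = w t := by
  obtain ⟨χ, hχ, hχc, hχ1, hχs⟩ := exists_cutoff T hT
  -- The weight goes into `K` because the norms involve derivatives of `e^{-σt} F`. Solving with
  -- `e^{σt} K` restores the original source before `T`.
  have ha : IsTest (fun t : ℝ => (Real.exp (-σ * t) : ℂ) * (χ t : ℂ)) :=
    (isTest_ofReal hχ hχc).smooth_mul (contDiff_rexp_mul (-σ))
  have has : tsupport (fun t : ℝ => (Real.exp (-σ * t) : ℂ) * (χ t : ℂ)) ⊆ Iic (T + 1) := by
    refine (tsupport_mul_subset_right).trans ?_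
    rw [tsupport_ofReal]
    exact hχs.trans Icc_subset_Iic_self
  have hK := (hG.hasChain h0).smul ha has
  have hK' := hK.self.smul (a := fun t => (Real.exp (σ * t) : ℂ)) (by fun_prop)
  obtain ⟨v, hv⟩ := hΦ.exists_isSol hK'
  rw [EventuallyEq, ae_restrict_iff' measurableSet_Ioo] at hFG
  refine ⟨_, v, hK, hv, ?_, hv.ae_eq hΦ hw hK' ((compL2_zext hF).mono (by linarith)) ?_⟩
  · rw [EventuallyEq, ae_restrict_iff' measurableSet_Ioo]
    filter_upwards [hFG] with t ht hm
    rw [hχ1 t (abs_le.2 ⟨by linarith [hm.1], hm.2.le⟩), ht hm]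
    simp
  · filter_upwards [hFG, h0, compl_mem_ae_iff.2 (measure_singleton (0 : ℝ))] with t ht ht0 hne htT
    rcases lt_or_gt_of_ne hne with h | h
    · rw [ht0 h, zext, indicator_of_notMem fun hm => absurd hm.1 (not_lt.2 h.le)]
      simp
    · have hm : t ∈ Ioo 0 T := ⟨h, htT⟩
      rw [hχ1 t (abs_le.2 ⟨by linarith, htT.le⟩), ht hm, zext, indicator_of_mem hm, smul_smul,
        Complex.ofReal_one, mul_one, ← Complex.ofReal_mul, ← Real.exp_add]
      simp

/-- Solutions are square integrable only with a weight, so `e^{-t} v` is shown to be in `Hᵐ(ℝ)`.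
Multiplying by `e^t` times a cutoff then gives an unweighted extension that agrees with `u` on
`(0,T)`. -/
lemma IsSol.memH0 (hΦ : IsMultiplier Φ) {m : ℕ} (hT : 0 < T) {F : L2t (Ioo 0 T) E}
    (hF : MemH0 m T F) {w : ℝ → V} (hw : IsSol Φ (zext T F) w) {u : L2t (Ioo 0 T) V}
    (hu : u =ᵐ[volume.restrict (Ioo 0 T)] w) : MemH0 m T u := by
  obtain ⟨G, hG, h0, hGF⟩ := hF
  obtain ⟨K, v, hK, hv, -, hvw⟩ := exists_chain_isSol hΦ hT hG h0 hGF (Lp.memLp F) hw 1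
  have hK' := hK.self.smul (a := fun t => (Real.exp (1 * t) : ℂ)) (by fun_prop)
  have hsol : ∀ {k : ℝ → E} {z : ℝ → V}, CompL2 (T + 1) k →
      IsSol Φ (fun t => (Real.exp (1 * t) : ℂ) • k t) z →
      MemLp (fun t => (Real.exp (-1 * t) : ℂ) • z t) 2 := fun hk hz =>
    hz.memLp hΦ (hk.smul (a := fun t => (Real.exp (1 * t) : ℂ)) (by fun_prop)) one_pos
  have hH : MemH m univ (fun t => (Real.exp (-1 * t) : ℂ) • v t) :=
    memH_of_exists (hsol hK.self hv) fun j hj => by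
      obtain ⟨K', v', a1, a2, -, a4⟩ := hv.exists_isWeakDeriv hΦ hK hj
      exact ⟨_, hsol a1 a2, a4⟩
  obtain ⟨χ, hχ, hχc, hχ1, hχs⟩ := exists_cutoff T hT
  have ha : IsTest (fun t : ℝ => (Real.exp (1 * t) : ℂ) * (χ t : ℂ)) :=
    (isTest_ofReal hχ hχc).smooth_mul (contDiff_rexp_mul 1)
  have has : tsupport (fun t : ℝ => (Real.exp (1 * t) : ℂ) * (χ t : ℂ)) ⊆ Iic (T + 1) := by
    refine (tsupport_mul_subset_right).trans ?_
    rw [tsupport_ofReal]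
    exact hχs.trans Icc_subset_Iic_self
  have hc := (hH.hasChain (by
    filter_upwards [hv.zero_neg hΦ hK'] with t ht h
    rw [ht h, smul_zero])).smul ha has
  refine ⟨_, memH_of_exists hc.self.memLp fun j hj => ?_, hc.self.zero_neg, ?_⟩
  · obtain ⟨k, hk, hk'⟩ := hc.exists_isWeakDeriv hj
    exact ⟨k, hk.memLp, hk'⟩
  · rw [EventuallyEq, ae_restrict_iff' measurableSet_Ioo] at hu ⊢
    filter_upwards [hvw, hu] with t h1 h2 hm
    rw [h2 hm, ← h1 hm.2, hχ1 t (abs_le.2 ⟨by linarith [hm.1], hm.2.le⟩), smul_smul,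
      Complex.ofReal_one, mul_one, ← Complex.ofReal_mul, ← Real.exp_add]
    simp

lemma normH_le_mul {E V : Type*} [NormedAddCommGroup E] [NormedSpace ℂ E]
    [NormedAddCommGroup V] [NormedSpace ℂ V] {m : ℕ} {I : Set ℝ} {g : ℝ → E} {h : ℝ → V} {C : NNReal}
    (H : ∀ j ≤ m, (⨅ (k : L2t I V) (_ : IsWeakDeriv I j h k), ‖k‖ₑ)
      ≤ C * ⨅ (k : L2t I E) (_ : IsWeakDeriv I j g k), ‖k‖ₑ) : normH m I h ≤ C * normH m I g := by
  have h1 : (C : ENNReal) = ((C : ENNReal) ^ 2) ^ (1 / 2 : ℝ) := by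
    rw [← ENNReal.rpow_natCast, ← ENNReal.rpow_mul]; simp
  rw [normH, normH, h1, ← ENNReal.mul_rpow_of_nonneg _ _ (by norm_num), Finset.mul_sum]
  refine ENNReal.rpow_le_rpow (Finset.sum_le_sum fun j hj => ?_) (by norm_num)
  rw [← mul_pow]
  exact pow_le_pow_left' (H j (by simpa [Nat.lt_succ_iff] using hj)) 2

/-- Plancherel is global in time. Truncating the source at `T` leaves the solution before `T`
unchanged, so the estimate localises with the same constant. -/
lemma IsSol.eLpNorm_restrict_le (hΦ : IsMultiplier Φ) {K : ℝ → E} {w : ℝ → V} {σ : ℝ} (hσ : 0 < σ)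
    {C : NNReal} (hC : ∀ s : ℂ, s.re = σ → ∀ f, ‖Φ s f‖ ≤ C * ‖f‖) (hK : CompL2 R K) (hT : T ≤ R)
    (h : IsSol Φ (fun t => (Real.exp (σ * t) : ℂ) • K t) w) :
    eLpNorm (fun t => (Real.exp (-σ * t) : ℂ) • w t) 2 (volume.restrict (Ioo 0 T))
      ≤ C * eLpNorm K 2 (volume.restrict (Ioo 0 T)) := by
  have hz := compL2_zext (hK.memLp.restrict (Ioo 0 T))
  have c1 := (hz.mono hT).smul (a := fun t => (Real.exp (σ * t) : ℂ)) (by fun_prop)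
  have c2 := hK.smul (a := fun t => (Real.exp (σ * t) : ℂ)) (by fun_prop)
  obtain ⟨v, hv⟩ := hΦ.exists_isSol c1
  have hvw := hv.ae_eq hΦ h c1 c2 (a := T) (by
    filter_upwards [hK.zero_neg, compl_mem_ae_iff.2 (measure_singleton (0 : ℝ))] with t ht hne htT
    rcases lt_or_gt_of_ne hne with h | h
    · rw [ht h, zext, indicator_of_notMem fun hm => absurd hm.1 (not_lt.2 h.le)]
    · rw [zext, indicator_of_mem (mem_Ioo.2 ⟨h, htT⟩)])
  have e1 : eLpNorm (fun t => (Real.exp (-σ * t) : ℂ) • w t) 2 (volume.restrict (Ioo 0 T))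
      = eLpNorm (fun t => (Real.exp (-σ * t) : ℂ) • v t) 2 (volume.restrict (Ioo 0 T)) := by
    refine eLpNorm_congr_ae ?_
    rw [EventuallyEq, ae_restrict_iff' measurableSet_Ioo]
    filter_upwards [hvw] with t ht hm
    rw [ht hm.2]
  rw [e1, ← eLpNorm_indicator_eq_eLpNorm_restrict measurableSet_Ioo]
  have e2 := (hv.memLp_and_le hΦ c1 hσ hC).2
  simp only [exp_smul_exp_neg_smul] at e2
  rw [← eLpNorm_indicator_eq_eLpNorm_restrict (f := K) measurableSet_Ioo]
  exact (eLpNorm_indicator_le _).trans e2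

/-- The estimate holds for each derivative separately with the multiplier bound on `Re s = σ`, so
`C` depends neither on `m` nor on `T`. -/
lemma IsSol.normH_le (hΦ : IsMultiplier Φ) {m : ℕ} (hT : 0 < T) {F : L2t (Ioo 0 T) E}
    (hF : MemH0 m T F) {w : ℝ → V} (hw : IsSol Φ (zext T F) w) {u : L2t (Ioo 0 T) V}
    (hu : u =ᵐ[volume.restrict (Ioo 0 T)] w) {σ : ℝ} (hσ : 0 < σ) {C : NNReal}
    (hC : ∀ s : ℂ, s.re = σ → ∀ f, ‖Φ s f‖ ≤ C * ‖f‖) :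
    normH m (Ioo 0 T) (fun t => (Real.exp (-σ * t) : ℂ) • u t)
      ≤ C * normH m (Ioo 0 T) (fun t => (Real.exp (-σ * t) : ℂ) • F t) := by
  obtain ⟨G, hG, h0, hGF⟩ := hF
  obtain ⟨K, v, hK, hv, hFK, hvw⟩ := exists_chain_isSol hΦ hT hG h0 hGF (Lp.memLp F) hw σ
  refine normH_le_mul fun j hj => ?_
  obtain ⟨K', v', a1, a2, a3, a4⟩ := hv.exists_isWeakDeriv hΦ hK hj
  have hu' : (fun t => (Real.exp (-σ * t) : ℂ) • v t) =ᵐ[volume.restrict (Ioo 0 T)]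
      fun t => (Real.exp (-σ * t) : ℂ) • u t := by
    rw [EventuallyEq, ae_restrict_iff' measurableSet_Ioo] at hu ⊢
    filter_upwards [hvw, hu] with t h1 h2 hm
    rw [h2 hm, h1 hm.2]
  have hm := (a2.memLp hΦ (a1.smul (a := fun t => (Real.exp (σ * t) : ℂ)) (by fun_prop)) hσ).restrict
    (Ioo 0 T)
  have hk := a1.memLp.restrict (Ioo 0 T)
  have l1 : (⨅ (k : L2t (Ioo 0 T) V) (_ : IsWeakDeriv (Ioo 0 T) j
      (fun t => (Real.exp (-σ * t) : ℂ) • u t) k), ‖k‖ₑ)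
      ≤ C * eLpNorm K' 2 (volume.restrict (Ioo 0 T)) := by
    refine (iInf₂_le (hm.toLp _) (a4.restrict.congr hu' hm.coeFn_toLp.symm)).trans ?_
    rw [Lp.enorm_def, eLpNorm_congr_ae hm.coeFn_toLp]
    exact a2.eLpNorm_restrict_le hΦ hσ hC a1 (by linarith)
  -- Every candidate in the infimum equals `K'` almost everywhere by uniqueness of weak derivatives;
  -- without candidates the infimum is `∞`.
  refine l1.trans (mul_le_mul_right (le_iInf₂ fun k hk' => le_of_eq ?_) _)
  rw [Lp.enorm_def]
  exact eLpNorm_congr_ae ((a3.restrict.congr hFK.symm (ae_eq_refl _)).unique isOpen_Ioo hk' hk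
    (Lp.memLp k))

end Regularity

/-! ### Existence of weak solutions -/

section WeakSolution

variable {L H c d₁ T : ℝ} {bhat : ℝ × ℝ → ℂ → ℂ}

lemma CoeffAssumption.isMultiplier (hb : CoeffAssumption L H d₁ bhat) (hL : 0 < L) (hc : 0 < c) :
    IsMultiplier (resolv L c d₁ bhat) :=
  ⟨hb.differentiableOn_resolv hL hc, fun _ h => hb.exists_resolv_le hL hc h⟩

/-- The multiplier solution `w` has zero residual but lives on all positive times. Its truncation
`z` differs from it only after `T`, where the test functions vanish. -/
lemma CoeffAssumption.exists_isWeakSolution (hb : CoeffAssumption L H d₁ bhat) (hL : 0 < L)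
    (hc : 0 < c) (F : L2t (Ioo 0 T) (L2S L)) :
    ∃ (w : ℝ → H1p L) (u : L2t (Ioo 0 T) (H1p L)), IsSol (resolv L c d₁ bhat) (zext T F) w ∧
      u =ᵐ[volume.restrict (Ioo 0 T)] w ∧ IsWeakSolution L c d₁ T bhat F u := by
  have hΦ := hb.isMultiplier hL hc
  have cF := compL2_zext_Lp F
  obtain ⟨w, hw⟩ := hΦ.exists_isSol cF
  have hw2 : MemLp w 2 (volume.restrict (Ioo 0 T)) := by
    have h1 := (compL2_zext ((hw.memLp hΦ cF one_pos).restrict (Ioo 0 T))).smul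
      (a := fun t => (Real.exp (1 * t) : ℂ)) (by fun_prop)
    refine (h1.memLp.restrict (Ioo 0 T)).ae_eq ?_
    rw [EventuallyEq, ae_restrict_iff' measurableSet_Ioo]
    refine ae_of_all _ fun t ht => ?_
    rw [zext, indicator_of_mem ht, smul_smul, ← Complex.ofReal_mul, ← Real.exp_add]
    simp
  refine ⟨w, hw2.toLp w, hw, hw2.coeFn_toLp, ?_⟩
  have cu := compL2_zext_Lp (hw2.toLp w)
  have heq := hw2.coeFn_toLp
  rw [EventuallyEq, ae_restrict_iff' measurableSet_Ioo] at heq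
  set z : ℝ → H1p L := zext T (hw2.toLp w) with hz
  have hwW : ∀ σ : ℝ, 0 < σ → WInt σ w := fun σ hσ => hw.wInt hΦ cF hσ
  have htail : ∀ σ : ℝ, 0 < σ → WInt σ (fun t => z t - w t) := fun σ hσ => by
    refine ((cu.wInt σ).sub (hwW σ hσ)).congr (ae_of_all _ fun t => ?_)
    exact (smul_sub _ _ _).symm
  have htail0 : ∀ᵐ t : ℝ, t < T → z t - w t = 0 := by
    filter_upwards [heq, hw.zero_neg hΦ cF, compl_mem_ae_iff.2 (measure_singleton (0 : ℝ))]
      with t h1 h2 hne htT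
    rcases lt_or_gt_of_ne hne with h | h
    · rw [h2 h, hz, zext, indicator_of_notMem fun hm => absurd hm.1 (not_lt.2 h.le), sub_zero]
    · have hm : t ∈ Ioo 0 T := ⟨h, htT⟩
      rw [hz, zext, indicator_of_mem hm, h1 hm, sub_self]
  rw [hb.isWeakSolution_iff]
  intro φ hφ hs
  obtain ⟨a, haT, ha⟩ := hφ.exists_tsupport_subset hs
  obtain ⟨K, hK, hA⟩ := hb.exists_opA_le (c := c) (σ := 1 / 2) (by norm_num)
  -- The tail is integrable only with a positive weight, so its decay is measured from the abscissa
  -- `1/2`; this costs the constant `e^{T/2}`.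
  obtain ⟨D, hD, hlapD⟩ : ∃ D : ℝ, 0 ≤ D ∧ ∀ s : ℂ, 1 ≤ s.re →
      ‖lap s (fun t => z t - w t)‖ ≤ Real.exp (-(s.re - 1 / 2) * T) * D :=
    ⟨_, integral_nonneg fun t => by positivity, fun s h1 =>
      norm_lap_le_of_support (htail (1 / 2) (by norm_num)) htail0 (by linarith)⟩
  have key := integral_lap_smul_eq_zero hφ ha
    (p := fun s => opA L c d₁ bhat s (lap s (fun t => z t - w t)))
    (hb.differentiableOn_opA.clm_apply (differentiableOn_lap_halfPlane htail)) one_pos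
    (K := K * (D * Real.exp (T / 2))) (by positivity) 2 fun s h1 => by
      refine ((opA L c d₁ bhat s).le_opNorm _).trans ?_
      refine (mul_le_mul (hA s (by linarith)) (hlapD s h1) (norm_nonneg _)
        (by positivity)).trans ?_
      have h2 : Real.exp (-(s.re - 1 / 2) * T) ≤ Real.exp (T / 2) * Real.exp (-a * s.re) := by
        rw [← Real.exp_add]
        refine Real.exp_le_exp.2 ?_
        nlinarith
      calc K * ‖s‖ ^ 2 * (Real.exp (-(s.re - 1 / 2) * T) * D)
          ≤ K * ‖s‖ ^ 2 * ((Real.exp (T / 2) * Real.exp (-a * s.re)) * D) := by gcongr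
        _ = _ := by ring
  -- As `A(s)` maps the transform of `w` to `ι* F̂(s)`, the residual of `z` is `A(s)` applied to the
  -- transform of `z - w`.
  refine Eq.trans ?_ key
  refine integral_congr_ae ?_
  filter_upwards [hw.lap_eq hΦ cF] with y hy
  have h1 : lap (vline 1 y) (fun t => z t - w t) = lap (vline 1 y) z - lap (vline 1 y) w := by
    simp only [lap, smul_sub]
    exact integral_sub (cu.wInt _).integrable (hwW _ (by simp)).integrable
  simp only [residual, h1, map_sub, hy]
  rw [hb.opA_resolv hL hc (by simp)]

end WeakSolution

end Grating

end

/-! ### Well-posedness, regularity and the weighted estimate. -/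

theorem mainTheorem2 (L H c d₁ : ℝ) (hL : 0 < L) (hH : 0 < H) (hc : 0 < c)
    (bhat : ℝ × ℝ → ℂ → ℂ) (hb : Grating.CoeffAssumption L H d₁ bhat) :
    (∀ (m : ℕ) (T : ℝ), 0 < T →
      ∀ F : Grating.L2t (Set.Ioo 0 T) (Grating.L2S L), Grating.MemH0 m T F →
        (∃! w : Grating.L2t (Set.Ioo 0 T) (Grating.H1p L),
          Grating.IsWeakSolution L c d₁ T bhat F w) ∧
        ∀ w : Grating.L2t (Set.Ioo 0 T) (Grating.H1p L),
          Grating.IsWeakSolution L c d₁ T bhat F w → Grating.MemH0 m T w) ∧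
    (∀ σ₀ : ℝ, 0 < σ₀ → ∃ C : NNReal, ∀ σ : ℝ, σ₀ < σ → ∀ (m : ℕ) (T : ℝ), 0 < T →
      ∀ F : Grating.L2t (Set.Ioo 0 T) (Grating.L2S L), Grating.MemH0 m T F →
        ∀ w : Grating.L2t (Set.Ioo 0 T) (Grating.H1p L),
          Grating.IsWeakSolution L c d₁ T bhat F w →
          Grating.normH m (Set.Ioo 0 T) (fun t => (Real.exp (-σ * t) : ℂ) • w t) ≤
            C * Grating.normH m (Set.Ioo 0 T) (fun t => (Real.exp (-σ * t) : ℂ) • F t)) := by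
  have hΦ := hb.isMultiplier hL hc
  refine ⟨fun m T hT F hF => ?_, fun σ₀ hσ₀ => ?_⟩
  · obtain ⟨w, u, hw, hu, hsol⟩ := hb.exists_isWeakSolution hL hc F
    refine ⟨⟨u, hsol, fun v hv => hb.weakSolution_unique hL hc hv hsol⟩, fun v hv => ?_⟩
    rw [hb.weakSolution_unique hL hc hv hsol]
    exact hw.memH0 hΦ hT hF hu
  -- One bound for the solution operators on `Re s > σ₀` serves all lines `Re s = σ` with `σ > σ₀`.
  · obtain ⟨C, hC⟩ := hb.exists_resolv_le hL hc hσ₀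
    refine ⟨C, fun σ hσ m T hT F hF v hv => ?_⟩
    obtain ⟨w, u, hw, hu, hsol⟩ := hb.exists_isWeakSolution hL hc F
    rw [hb.weakSolution_unique hL hc hv hsol]
    exact hw.normH_le hΦ hT hF hu (hσ₀.trans hσ) fun s hs => hC s (by rw [hs]; exact hσ)
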